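/- All Banach lattices are real. Elements $x,y$ of a Banach lattice are disjoint if $|x|\wedge|y|=0$; a Banach lattice is an M-space if $\|\sum_{j<n}x_j\|=\max_{j<n}\|x_j\|$ for every finite sequence of pairwise disjoint elements. A sublattice is a linear subspace closed under $\vee$ and $\wedge$. For a Banach lattice $\mathcal E$, let $\mathrm{Iso}_\diamond(\mathcal E)$ be the group of surjective linear lattice isometries of $\mathcal E$ and $\mathrm{Iso}_\perp(\mathcal E)$ the group of surjective linear isometries $g$ of $\mathcal E$ such that $g$ and $g^{-1}$ preserve disjointness. Let $X$ be a finite-dimensional sublattice of $\mathcal E$, with normalized, positive, pairwise disjoint basis $(a_j)_{j<k}$ (unique up to order), and let $\delta\ge 0$. Let $\mathrm{Emb}^\perp_\delta(X,\mathcal E)$ be the set of linear maps $\gamma:X\to\mathcal E$ with $\frac1{1+\delta}\|x\|\le\|\gamma x\|\le(1+\delta)\|x\|$ for all $x\in X$ and $\big\||\gamma(a_i)|\wedge|\gamma(a_j)|\big\|\le\delta$ for all $i\ne j$. Let $\mathrm{Emb}^\diamond_\delta(X,\mathcal E)$ be the set of those $\gamma\in\mathrm{Emb}^\perp_\delta(X,\mathcal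 E)$ for which in addition $d(\gamma(a),\mathcal E_+)\le\delta$ for all $a\in X$ with $a\ge 0$ and $\|a\|\le1$. A group $S$ of isometries of $\mathcal E$ acts $r$-transitively on a set $T$ of operators $X\to\mathcal E$ if for all $\gamma,\eta\in T$ there is $g\in S$ with $\|g\circ\gamma-\eta\|<r$. A modulus is a function $\varpi:\mathbb N\times[0,\infty)\to[0,\infty)$ such that each $\varpi(k,\cdot)$ is nondecreasing, vanishes at $0$ and is continuous at $0$. The Banach lattice $\mathcal E$ is a Fraïssé Banach lattice with modulus $\varpi$ if for every $k$, every $k$-dimensional sublattice $X$ of $\mathcal E$, every $\delta\ge0$ and every $\varepsilon>0$, the group $\mathrm{Iso}_\diamond(\mathcal E)$ acts $(\varpi(k,\delta)+\varepsilon)$-transitively on $\mathrm{Emb}^\diamond_\delta(X,\mathcal E)$. **Theorem.** Let $p_n\in[1,\infty)$ with $p_n\to\infty$, let $\mathcal U$ be a non-principal ultrafilter on $\mathbb N$, and let $\mathfrak X=(\prod_n L_{p_n}(0,1))_{\mathcal U}$ be the Banach lattice ultraproduct, that is, the space of bounded sequences $(x_n)_n$ with $x_n\in L_{p_n}(0,1)$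 modulo those with $\lim_{\mathcal U}\|x_n\|=0$, with norm $\lim_{\mathcal U}\|x_n\|$ and coordinatewise lattice operations. Then: 1. $\mathfrak X$ is an M-space and a Fraïssé Banach lattice with some modulus $\varpi$ satisfying $\varpi(k,\delta)\le 3k\delta$ for all $k,\delta$. Moreover, for every finite-dimensional sublattice $X$ of $\mathfrak X$, every $\delta\ge0$ and every $\varepsilon>0$, $\mathrm{Iso}_\perp(\mathfrak X)$ acts $(3\delta\dim X+\varepsilon)$-transitively on $\mathrm{Emb}^\perp_\delta(X,\mathfrak X)$. 2. $\mathfrak X$ has an infinite-dimensional separable closed sublattice $\mathbb G_\diamond$ which is an M-space and a Fraïssé Banach lattice with some modulus $\varpi$ satisfying $\varpi(k,\delta)\le 3k\delta$ for all $k,\delta$, and such that for every finite-dimensional sublattice $X$ of $\mathbb G_\diamond$, every $\delta\ge0$ and every $\varepsilon>0$, $\mathrm{Iso}_\perp(\mathbb G_\diamond)$ acts $(3\delta\dim X+\varepsilon)$-transitively on $\mathrm{Emb}^\perp_\delta(X,\mathbb G_\diamond)$. -/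

import Mathlib

open Filter Topology MeasureTheory
open scoped ENNReal NNReal

universe u v

/-! A (real) Banach lattice is a type with the instances `NormedAddCommGroup`, `NormedSpace ℝ`,
`Lattice`, `IsOrderedAddMonoid`, `HasSolidNorm`, `CompleteSpace`. (Compatibility of the order with
multiplication by nonnegative reals follows from these.) -/

section Sublattices

/-- A (vector) sublattice of `E`: a linear subspace closed under `⊔` (hence also under `⊓`). -/
structure VectorSublattice (E : Type u) [NormedAddCommGroup E] [NormedSpace ℝ E] [Lattice E]
    extends Submodule ℝ E where
  sup_mem' : ∀ x ∈ carrier, ∀ y ∈ carrier, x ⊔ y ∈ carrier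

namespace VectorSublattice

variable {E : Type u} [NormedAddCommGroup E] [NormedSpace ℝ E] [Lattice E]

instance : CoeSort (VectorSublattice E) (Type u) := ⟨fun X => X.toSubmodule⟩

variable [IsOrderedAddMonoid E]

theorem inf_mem' (X : VectorSublattice E) (x : E) (hx : x ∈ X.toSubmodule) (y : E)
    (hy : y ∈ X.toSubmodule) : x ⊓ y ∈ X.toSubmodule := by
  have h := X.toSubmodule.neg_mem
    (X.sup_mem' (-x) (X.toSubmodule.neg_mem hx) (-y) (X.toSubmodule.neg_mem hy))
  rwa [neg_sup, neg_neg, neg_neg] at h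

/-- A sublattice carries the restricted lattice operations (and the restricted norm). -/
instance instLattice (X : VectorSublattice E) : Lattice X.toSubmodule :=
  Subtype.lattice (fun x y hx hy => X.sup_mem' x hx y hy) (fun x y hx hy => X.inf_mem' x hx y hy)

theorem coe_sup (X : VectorSublattice E) (x y : X) : ((x ⊔ y : X) : E) = (x : E) ⊔ (y : E) := rfl

theorem coe_abs (X : VectorSublattice E) (x : X) : ((|x| : X) : E) = |(x : E)| := rfl

instance instIsOrderedAddMonoid (X : VectorSublattice E) : IsOrderedAddMonoid X.toSubmodule where
  add_le_add_left a b h c := by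
    have h' : (a : E) ≤ (b : E) := h
    have := add_le_add_left h' (c : E)
    exact this

instance instHasSolidNorm [HasSolidNorm E] (X : VectorSublattice E) :
    HasSolidNorm X.toSubmodule where
  solid x y h := HasSolidNorm.solid (α := E) (x := (x : E)) (y := (y : E)) h

end VectorSublattice

end Sublattices

section BanachLatticeNotions

/-- Disjointness (orthogonality) in a lattice-ordered group. -/
def LatDisjoint {E : Type u} [AddCommGroup E] [Lattice E] (x y : E) : Prop := |x| ⊓ |y| = 0

/-- `M`-space: `‖∑ x_j‖ = max ‖x_j‖` for every finite sequence of pairwise disjoint elements. -/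
def IsMSpace (E : Type u) [NormedAddCommGroup E] [Lattice E] : Prop :=
  ∀ (n : ℕ) (x : Fin n → E), (∀ i j, i ≠ j → LatDisjoint (x i) (x j)) →
    ‖∑ j, x j‖₊ = Finset.univ.sup fun j => ‖x j‖₊

variable {A : Type u} [NormedAddCommGroup A] [NormedSpace ℝ A] [Lattice A]
variable {B : Type v} [NormedAddCommGroup B] [NormedSpace ℝ B] [Lattice B]

/-- A basis consisting of normalized, positive and pairwise disjoint vectors. In a
finite-dimensional Banach lattice such a basis exists and is unique up to a permutation. -/
def IsNormalizedDisjointBasis {k : ℕ} (a : Module.Basis (Fin k) ℝ A) : Prop :=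
  (∀ j, 0 ≤ a j ∧ ‖a j‖ = 1) ∧ ∀ i j, i ≠ j → LatDisjoint (a i) (a j)

/-- `γ` is a `δ`-isometric embedding. -/
def IsAlmostIsometric (δ : ℝ≥0) (γ : A →L[ℝ] B) : Prop :=
  ∀ x, (1 / (1 + (δ : ℝ))) * ‖x‖ ≤ ‖γ x‖ ∧ ‖γ x‖ ≤ (1 + (δ : ℝ)) * ‖x‖

/-- `γ` (with finite-dimensional domain) is `δ`-disjoint preserving:
`‖ |γ a_i| ∧ |γ a_j| ‖ ≤ δ` for distinct members of the normalized positive disjoint basis. -/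
def IsAlmostDisjointPreserving (δ : ℝ≥0) (γ : A →L[ℝ] B) : Prop :=
  ∀ (k : ℕ) (a : Module.Basis (Fin k) ℝ A), IsNormalizedDisjointBasis a →
    ∀ i j, i ≠ j → ‖|γ (a i)| ⊓ |γ (a j)|‖ ≤ δ

/-- `γ` is `δ`-positive: positive vectors of the unit ball are sent to vectors at distance at most
`δ` from the positive cone. -/
def IsAlmostPositive (δ : ℝ≥0) (γ : A →L[ℝ] B) : Prop :=
  ∀ a, 0 ≤ a → ‖a‖ ≤ 1 → Metric.infDist (γ a) {b : B | 0 ≤ b} ≤ δ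

/-- The `δ`-isometric lattice embeddings. -/
def EmbLat (δ : ℝ≥0) (A : Type u) [NormedAddCommGroup A] [NormedSpace ℝ A] [Lattice A]
    (B : Type v) [NormedAddCommGroup B] [NormedSpace ℝ B] [Lattice B] : Set (A →L[ℝ] B) :=
  {γ | IsAlmostDisjointPreserving δ γ ∧ IsAlmostPositive δ γ ∧ IsAlmostIsometric δ γ}

/-- The `δ`-isometric disjoint-preserving embeddings. -/
def EmbDisj (δ : ℝ≥0) (A : Type u) [NormedAddCommGroup A] [NormedSpace ℝ A] [Lattice A]
    (B : Type v) [NormedAddCommGroup B] [NormedSpace ℝ B] [Lattice B] : Set (A →L[ℝ] B) :=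
  {γ | IsAlmostDisjointPreserving δ γ ∧ IsAlmostIsometric δ γ}

/-- The surjective linear lattice isometries of `E`. -/
def IsoLat (E : Type u) [NormedAddCommGroup E] [NormedSpace ℝ E] [Lattice E] :
    Set (E ≃ₗᵢ[ℝ] E) :=
  {g | ∀ x y, g (x ⊔ y) = g x ⊔ g y}

/-- The surjective linear isometries of `E` that preserve disjointness, in both directions. -/
def IsoDisj (E : Type u) [NormedAddCommGroup E] [NormedSpace ℝ E] [Lattice E] :
    Set (E ≃ₗᵢ[ℝ] E) :=
  {g | ∀ x y, LatDisjoint (g x) (g y) ↔ LatDisjoint x y}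

/-- The action by composition of a set `S` of isometries of `E` on a set `T` of operators into `E`
is `r`-transitive. -/
def ActsTransitively {X : Type v} [NormedAddCommGroup X] [NormedSpace ℝ X]
    {E : Type u} [NormedAddCommGroup E] [NormedSpace ℝ E]
    (S : Set (E ≃ₗᵢ[ℝ] E)) (T : Set (X →L[ℝ] E)) (r : ℝ) : Prop :=
  ∀ γ ∈ T, ∀ η ∈ T, ∃ g ∈ S,
    ‖(g.toContinuousLinearEquiv : E →L[ℝ] E).comp γ - η‖ < r

/-- A modulus `ϖ : ℕ × [0,∞[ → [0,∞[`. -/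
def IsModulus (ϖ : ℕ → ℝ≥0 → ℝ≥0) : Prop :=
  ∀ k, Monotone (ϖ k) ∧ ContinuousAt (ϖ k) 0 ∧ ϖ k 0 = 0

/-- The Banach lattice `E` is Fraïssé with modulus of stability `ϖ`: for every `k`-dimensional
sublattice `X`, lattice isometries of `E` act `(ϖ(k,δ)+ε)`-transitively on the `δ`-isometric lattice
embeddings of `X` into `E`. -/
def IsFraisseBanachLattice (E : Type u) [NormedAddCommGroup E] [NormedSpace ℝ E] [Lattice E]
    [IsOrderedAddMonoid E] (ϖ : ℕ → ℝ≥0 → ℝ≥0) : Prop :=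
  IsModulus ϖ ∧
    ∀ X : VectorSublattice E, FiniteDimensional ℝ X → ∀ (δ : ℝ≥0) (ε : ℝ), 0 < ε →
      ActsTransitively (IsoLat E) (EmbLat δ X E) (ϖ (Module.finrank ℝ X) δ + ε)

end BanachLatticeNotions

noncomputable section Ultraproducts

variable {ι : Type u} (E : ι → Type v) [∀ i, NormedAddCommGroup (E i)] [∀ i, NormedSpace ℝ (E i)]
variable (U : Ultrafilter ι)

/-- The bounded families `(x i)` with `lim_U ‖x i‖ = 0`. -/
def ultraNull : Submodule ℝ (lp E ∞) where
  carrier := {x | Tendsto (fun i => ‖x i‖) U (𝓝 0)}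
  zero_mem' := by simp
  add_mem' {x y} hx hy := by
    have h : Tendsto (fun i => ‖x i‖ + ‖y i‖) U (𝓝 0) := by
      simpa using Tendsto.add (f := fun i => ‖x i‖) (g := fun i => ‖y i‖) hx hy
    exact squeeze_zero (fun i => norm_nonneg _) (fun i => norm_add_le (x i) (y i)) h
  smul_mem' c x hx := by
    have h : Tendsto (fun i => ‖c‖ * ‖x i‖) U (𝓝 0) := by
      simpa using Tendsto.const_mul (f := fun i => ‖x i‖) ‖c‖ hx
    refine h.congr fun i => ?_
    exact (norm_smul c (x i)).symm

theorem mem_ultraNull {x : lp E ∞} : x ∈ ultraNull E U ↔ Tendsto (fun i => ‖x i‖) U (𝓝 0) := Iff.rfl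

instance isClosed_ultraNull : IsClosed (ultraNull E U : Set (lp E ∞)) := by
  refine isClosed_of_closure_subset fun x hx => ?_
  rw [Metric.mem_closure_iff] at hx
  show Tendsto (fun i => ‖x i‖) U (𝓝 0)
  rw [Metric.tendsto_nhds]
  intro ε hε
  obtain ⟨y, hy, hxy⟩ := hx (ε / 2) (by positivity)
  have hy' : Tendsto (fun i => ‖y i‖) U (𝓝 0) := hy
  rw [Metric.tendsto_nhds] at hy'
  filter_upwards [hy' (ε / 2) (by positivity)] with i hi
  have h1 : ‖x i - y i‖ ≤ ‖x - y‖ := lp.norm_apply_le_norm (by simp) (x - y) i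
  rw [dist_eq_norm] at hxy
  simp only [dist_zero_right, norm_norm] at hi ⊢
  have h2 := norm_add_le (x i - y i) (y i)
  rw [sub_add_cancel] at h2
  linarith

/-- The Banach space ultraproduct `(∏ E i)_U = ℓ_∞(E i) / {x : lim_U ‖x i‖ = 0}` with the quotient
norm; see `norm_mk` for `‖[x]‖ = lim_U ‖x i‖`. -/
def BanachUltraproduct : Type (max u v) := lp E ∞ ⧸ ultraNull E U

namespace BanachUltraproduct

instance : NormedAddCommGroup (BanachUltraproduct E U) :=
  inferInstanceAs (NormedAddCommGroup (lp E ∞ ⧸ ultraNull E U))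

instance : NormedSpace ℝ (BanachUltraproduct E U) :=
  inferInstanceAs (NormedSpace ℝ (lp E ∞ ⧸ ultraNull E U))

instance [∀ i, CompleteSpace (E i)] : CompleteSpace (BanachUltraproduct E U) :=
  inferInstanceAs (CompleteSpace (lp E ∞ ⧸ ultraNull E U))

/-- The quotient map onto the ultraproduct. -/
def mk : lp E ∞ →ₗ[ℝ] BanachUltraproduct E U := (ultraNull E U).mkQ

variable {E U}

theorem mk_surjective : Function.Surjective (mk E U) := (ultraNull E U).mkQ_surjective

theorem mk_eq_mk {x y : lp E ∞} :
    mk E U x = mk E U y ↔ Tendsto (fun i => ‖x i - y i‖) U (𝓝 0) :=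
  Submodule.Quotient.eq (ultraNull E U)

theorem norm_mk_lt {x : lp E ∞} {c : ℝ} (h : ‖mk E U x‖ < c) :
    ∃ y : lp E ∞, mk E U y = mk E U x ∧ ‖y‖ < c :=
  QuotientAddGroup.norm_lt_iff.mp h

theorem norm_mk_le (x : lp E ∞) : ‖mk E U x‖ ≤ ‖x‖ :=
  Submodule.Quotient.norm_mk_le (ultraNull E U) x

theorem norm_mk (x : lp E ∞) : Tendsto (fun i => ‖x i‖) U (𝓝 ‖mk E U x‖) := by
  classical
  rw [tendsto_order]
  constructor
  · intro c hc
    by_contra hne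
    rw [← Ultrafilter.eventually_not] at hne
    obtain ⟨i₀, hi₀⟩ := hne.exists
    have hc0 : 0 ≤ c := (norm_nonneg _).trans (not_lt.mp hi₀)
    let z : PreLp E := fun i => if c < ‖x i‖ then 0 else x i
    have hz : ∀ i, ‖z i‖ ≤ c := fun i => by
      by_cases h : c < ‖x i‖
      · simp [z, h, hc0]
      · simpa [z, h] using not_lt.mp h
    let y : lp E ∞ := ⟨z, memℓp_infty ⟨c, by rintro _ ⟨i, rfl⟩; exact hz i⟩⟩
    have hxy : mk E U y = mk E U x := by
      rw [mk_eq_mk]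
      refine tendsto_const_nhds.congr' ?_
      filter_upwards [hne] with i hi
      show (0 : ℝ) = ‖z i - x i‖
      simp [z, hi]
    have h1 : ‖mk E U y‖ ≤ c := (norm_mk_le y).trans (lp.norm_le_of_forall_le hc0 hz)
    rw [hxy] at h1
    exact absurd hc (not_lt.mpr h1)
  · intro c hc
    obtain ⟨y, hy, hyc⟩ := norm_mk_lt hc
    have h := (mk_eq_mk.mp hy.symm).eventually_lt_const (sub_pos.mpr hyc)
    filter_upwards [h] with i hi
    have h1 : ‖y i‖ ≤ ‖y‖ := lp.norm_apply_le_norm (by simp) y i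
    have h2 := norm_add_le (x i - y i) (y i)
    rw [sub_add_cancel] at h2
    linarith

variable [∀ i, Lattice (E i)] [∀ i, HasSolidNorm (E i)] [∀ i, IsOrderedAddMonoid (E i)]

/-- Coordinatewise supremum of bounded families. -/
def lpSup (x y : lp E ∞) : lp E ∞ :=
  ⟨fun i => x i ⊔ y i, memℓp_infty ⟨‖x‖ + ‖y‖, by
    rintro _ ⟨i, rfl⟩
    exact (norm_sup_le_add (x i) (y i)).trans (add_le_add
      (lp.norm_apply_le_norm (by simp) x i) (lp.norm_apply_le_norm (by simp) y i))⟩⟩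

/-- Coordinatewise infimum of bounded families. -/
def lpInf (x y : lp E ∞) : lp E ∞ :=
  ⟨fun i => x i ⊓ y i, memℓp_infty ⟨‖x‖ + ‖y‖, by
    rintro _ ⟨i, rfl⟩
    exact (norm_inf_le_add (x i) (y i)).trans (add_le_add
      (lp.norm_apply_le_norm (by simp) x i) (lp.norm_apply_le_norm (by simp) y i))⟩⟩

theorem mk_lpSup_congr {x x' y y' : lp E ∞} (hx : mk E U x = mk E U x')
    (hy : mk E U y = mk E U y') : mk E U (lpSup x y) = mk E U (lpSup x' y') := by
  rw [mk_eq_mk] at *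
  have h : Tendsto (fun i => ‖x i - x' i‖ + ‖y i - y' i‖) U (𝓝 0) := by simpa using hx.add hy
  exact squeeze_zero (fun i => norm_nonneg _)
    (fun i => norm_sup_sub_sup_le_add_norm (x i) (y i) (x' i) (y' i)) h

theorem mk_lpInf_congr {x x' y y' : lp E ∞} (hx : mk E U x = mk E U x')
    (hy : mk E U y = mk E U y') : mk E U (lpInf x y) = mk E U (lpInf x' y') := by
  rw [mk_eq_mk] at *
  have h : Tendsto (fun i => ‖x i - x' i‖ + ‖y i - y' i‖) U (𝓝 0) := by simpa using hx.add hy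
  exact squeeze_zero (fun i => norm_nonneg _)
    (fun i => norm_inf_sub_inf_le_add_norm (x i) (y i) (x' i) (y' i)) h

instance : Max (BanachUltraproduct E U) :=
  ⟨fun a b => mk E U (lpSup (Function.surjInv mk_surjective a) (Function.surjInv mk_surjective b))⟩

instance : Min (BanachUltraproduct E U) :=
  ⟨fun a b => mk E U (lpInf (Function.surjInv mk_surjective a) (Function.surjInv mk_surjective b))⟩

/-- The lattice operations of the ultraproduct are the coordinatewise ones. -/
theorem mk_sup (x y : lp E ∞) : mk E U x ⊔ mk E U y = mk E U (lpSup x y) :=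
  mk_lpSup_congr (Function.surjInv_eq mk_surjective _) (Function.surjInv_eq mk_surjective _)

theorem mk_inf (x y : lp E ∞) : mk E U x ⊓ mk E U y = mk E U (lpInf x y) :=
  mk_lpInf_congr (Function.surjInv_eq mk_surjective _) (Function.surjInv_eq mk_surjective _)

/-- The lattice structure of the ultraproduct; `a ≤ b` means `a ⊔ b = b`. -/
instance instLattice : Lattice (BanachUltraproduct E U) :=
  Lattice.mk'
    (fun a b => by
      obtain ⟨x, rfl⟩ := mk_surjective a
      obtain ⟨y, rfl⟩ := mk_surjective b
      rw [mk_sup, mk_sup]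
      exact congrArg _ (lp.ext (funext fun i => sup_comm (x i) (y i))))
    (fun a b c => by
      obtain ⟨x, rfl⟩ := mk_surjective a
      obtain ⟨y, rfl⟩ := mk_surjective b
      obtain ⟨z, rfl⟩ := mk_surjective c
      rw [mk_sup, mk_sup, mk_sup, mk_sup]
      exact congrArg _ (lp.ext (funext fun i => sup_assoc (x i) (y i) (z i))))
    (fun a b => by
      obtain ⟨x, rfl⟩ := mk_surjective a
      obtain ⟨y, rfl⟩ := mk_surjective b
      rw [mk_inf, mk_inf]
      exact congrArg _ (lp.ext (funext fun i => inf_comm (x i) (y i))))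
    (fun a b c => by
      obtain ⟨x, rfl⟩ := mk_surjective a
      obtain ⟨y, rfl⟩ := mk_surjective b
      obtain ⟨z, rfl⟩ := mk_surjective c
      rw [mk_inf, mk_inf, mk_inf, mk_inf]
      exact congrArg _ (lp.ext (funext fun i => inf_assoc (x i) (y i) (z i))))
    (fun a b => by
      obtain ⟨x, rfl⟩ := mk_surjective a
      obtain ⟨y, rfl⟩ := mk_surjective b
      rw [mk_inf, mk_sup]
      exact congrArg _ (lp.ext (funext fun i => sup_inf_self (a := x i) (b := y i))))
    (fun a b => by
      obtain ⟨x, rfl⟩ := mk_surjective a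
      obtain ⟨y, rfl⟩ := mk_surjective b
      rw [mk_sup, mk_inf]
      exact congrArg _ (lp.ext (funext fun i => inf_sup_self (a := x i) (b := y i))))

instance instIsOrderedAddMonoid : IsOrderedAddMonoid (BanachUltraproduct E U) where
  add_le_add_left a b h c := by
    rw [← sup_eq_right] at h ⊢
    obtain ⟨x, rfl⟩ := mk_surjective a
    obtain ⟨y, rfl⟩ := mk_surjective b
    obtain ⟨z, rfl⟩ := mk_surjective c
    conv_rhs => rw [← h]
    rw [← map_add, ← map_add]
    refine (mk_sup (x + z) (y + z)).trans ?_
    refine Eq.trans ?_ (congrArg (fun t => t + mk E U z) (mk_sup x y).symm)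
    rw [← map_add]
    exact congrArg _ (lp.ext (funext fun i => (sup_add (x i) (y i) (z i)).symm))

instance instHasSolidNorm : HasSolidNorm (BanachUltraproduct E U) where
  solid a b h := by
    have key : ∀ w : lp E ∞, |mk E U w| = mk E U (lpSup w (-w)) := fun w => by
      show mk E U w ⊔ -mk E U w = _
      rw [← map_neg]
      exact mk_sup w (-w)
    obtain ⟨x, rfl⟩ := mk_surjective a
    obtain ⟨y, rfl⟩ := mk_surjective b
    rw [← inf_eq_left, key, key] at h
    have h' := (mk_inf (U := U) (lpSup x (-x)) (lpSup y (-y))).symm.trans h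
    have hn : ∀ w : lp E ∞, Tendsto (fun i => ‖|w i|‖) U (𝓝 ‖mk E U w‖) := fun w =>
      (norm_mk w).congr fun i => (norm_abs_eq_norm (w i)).symm
    have h1 := norm_mk (U := U) (lpInf (lpSup x (-x)) (lpSup y (-y)))
    have h2 := norm_mk (U := U) (lpSup x (-x))
    rw [h'] at h1
    have e : ‖mk E U (lpSup x (-x))‖ = ‖mk E U x‖ := tendsto_nhds_unique h2 (hn x)
    rw [e] at h1
    refine le_of_tendsto_of_tendsto' h1 (norm_mk y) fun i => ?_
    refine HasSolidNorm.solid ?_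
    show abs (|x i| ⊓ |y i|) ≤ |y i|
    rw [abs_of_nonneg (le_inf (abs_nonneg _) (abs_nonneg _))]
    exact inf_le_right

end BanachUltraproduct

/-- `L_p(0,1)` over the reals, for Lebesgue measure. -/
abbrev LpUnit (p : ℝ≥0∞) : Type := Lp ℝ p (volume.restrict (Set.Ioo (0 : ℝ) 1))

end Ultraproducts

/-! Everything follows from two properties of a Banach lattice, together with the existence of two
nonzero disjoint vectors.

The first is `IsAMNorm`. In L_p one has ‖f ⊔ g‖ ≤ 2^(1/p) max(‖f‖, ‖g‖), and 2^(1/p_n) tends to 1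
along U. The second is `IsApproxHomogeneous`. An almost disjoint tuple in L_p(0,1), p < ∞, is nearly
the tuple of pieces of one nonvanishing function w over a finite partition. Given two such functions
w, v whose corresponding pieces have equal norms, a measure isomorphism φ carrying |v|^p dt to |w|^p
dt piece by piece yields the isometry f ↦ v · (f ∘ φ) / (w ∘ φ), which sends each piece of w to that
of v (`Lp_exists_isometry`). Disjoint vectors of the ultraproduct lift to asymptotically disjoint
ones, so these coordinate isometries induce the required isometry of the ultraproduct.

Transitivity is then formal. For small δ, the images γ(a_j), or their positive parts in the lattice
case, are replaced by exactly disjoint vectors of the same norm as γ(a_j), at distance at most δ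
(`IsAMNorm.exists_disjoint_near`), and these are matched with those of η after rescaling. The
rescaling errors are disjoint, so they cost 2δ only once; the remaining errors cost at most 2δ per
basis vector, and at most δ if k = 1. Hence the total is at most 3kδ. For large δ, γ is moved to a
position almost disjoint from η, and the difference then has norm about 1 + δ ≤ 3δ.

The separable sublattice is the closure of a countable set stable under the lattice operations,
rational multiples and a countable selection of conjugating isometries and their inverses
(`IsApproxHomogeneous.exists_separable`). It inherits both properties, so the same argument applies
to it. -/

set_option linter.unusedSectionVars false

/-! ### Disjointness and truncation in lattice-ordered groups. -/

section LatticeGroup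

variable {E : Type u} [AddCommGroup E] [Lattice E] [IsOrderedAddMonoid E]

theorem inf_add_le_inf_add_inf {a b c : E} (ha : 0 ≤ a) (hb : 0 ≤ b) (hc : 0 ≤ c) :
    a ⊓ (b + c) ≤ a ⊓ b + a ⊓ c := by
  rw [add_inf, inf_add, inf_add]
  refine le_inf (le_inf ?_ ?_) (le_inf ?_ ?_)
  · exact inf_le_left.trans (le_add_of_nonneg_left ha)
  · exact inf_le_left.trans (le_add_of_nonneg_left hb)
  · exact inf_le_left.trans (le_add_of_nonneg_right hc)
  · exact inf_le_right

theorem latDisjoint_comm {x y : E} : LatDisjoint x y ↔ LatDisjoint y x := by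
  unfold LatDisjoint; rw [inf_comm]

theorem LatDisjoint.symm {x y : E} (h : LatDisjoint x y) : LatDisjoint y x :=
  latDisjoint_comm.1 h

theorem latDisjoint_zero_left (y : E) : LatDisjoint 0 y := by
  unfold LatDisjoint; rw [abs_zero]; exact inf_eq_left.2 (abs_nonneg y)

theorem LatDisjoint.mono {x y x' y' : E} (h : LatDisjoint x y) (hx : |x'| ≤ |x|)
    (hy : |y'| ≤ |y|) : LatDisjoint x' y' :=
  le_antisymm ((inf_le_inf hx hy).trans h.le) (le_inf (abs_nonneg _) (abs_nonneg _))

theorem latDisjoint_of_nonneg {x y : E} (hx : 0 ≤ x) (hy : 0 ≤ y) :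
    LatDisjoint x y ↔ x ⊓ y = 0 := by
  unfold LatDisjoint; rw [abs_of_nonneg hx, abs_of_nonneg hy]

theorem LatDisjoint.add_right {x y z : E} (hy : LatDisjoint x y) (hz : LatDisjoint x z) :
    LatDisjoint x (y + z) := by
  refine le_antisymm ?_ (le_inf (abs_nonneg _) (abs_nonneg _))
  calc |x| ⊓ |y + z| ≤ |x| ⊓ (|y| + |z|) := inf_le_inf_left _ (abs_add_le y z)
    _ ≤ |x| ⊓ |y| + |x| ⊓ |z| :=
      inf_add_le_inf_add_inf (abs_nonneg _) (abs_nonneg _) (abs_nonneg _)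
    _ = 0 := by rw [hy, hz, add_zero]

theorem LatDisjoint.neg_right {x y : E} (h : LatDisjoint x y) : LatDisjoint x (-y) :=
  h.mono le_rfl (abs_neg y).le

theorem LatDisjoint.sum_right {ι : Type*} {x : E} {s : Finset ι} {f : ι → E}
    (h : ∀ i ∈ s, LatDisjoint x (f i)) : LatDisjoint x (∑ i ∈ s, f i) := by
  classical
  induction s using Finset.induction_on with
  | empty => simpa using (latDisjoint_zero_left x).symm
  | insert a s ha ih =>
    rw [Finset.sum_insert ha]
    exact (h a (Finset.mem_insert_self a s)).add_right
      (ih fun i hi => h i (Finset.mem_insert_of_mem hi))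

theorem sup_eq_add_of_inf_eq_zero {a b : E} (h : a ⊓ b = 0) : a ⊔ b = a + b := by
  rw [← inf_add_sup a b, h, zero_add]

/-- One inequality is the triangle inequality, since the supremum of disjoint moduli is their sum.
The other is the reverse triangle inequality, since that supremum is also the modulus of |y| - |x|.
-/
theorem LatDisjoint.abs_add_eq_sup {x y : E} (h : LatDisjoint x y) : |x + y| = |x| ⊔ |y| := by
  refine le_antisymm ?_ ?_
  · rw [sup_eq_add_of_inf_eq_zero h]; exact abs_add_le x y
  · have h1 : |x| ⊔ |y| = |(|y| - |x|)| := by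
      rw [← sup_sub_inf_eq_abs_sub, h, sub_zero]
    have h2 := abs_abs_sub_abs_le y (-x)
    rw [abs_neg, sub_neg_eq_add, add_comm y x] at h2
    rw [h1]; exact h2

theorem LatDisjoint.abs_add_eq_add {x y : E} (h : LatDisjoint x y) : |x + y| = |x| + |y| := by
  rw [h.abs_add_eq_sup, sup_eq_add_of_inf_eq_zero h]

theorem abs_sum_of_disjoint {ι : Type*} (s : Finset ι) (f : ι → E)
    (h : ∀ i ∈ s, ∀ j ∈ s, i ≠ j → LatDisjoint (f i) (f j)) :
    |∑ i ∈ s, f i| = ∑ i ∈ s, |f i| := by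
  classical
  induction s using Finset.induction_on with
  | empty => simp
  | insert a s ha ih =>
    rw [Finset.sum_insert ha, Finset.sum_insert ha, LatDisjoint.abs_add_eq_add, ih]
    · exact fun i hi j hj => h i (Finset.mem_insert_of_mem hi) j (Finset.mem_insert_of_mem hj)
    · refine LatDisjoint.sum_right fun i hi => h a (Finset.mem_insert_self a s) i
        (Finset.mem_insert_of_mem hi) ?_
      rintro rfl; exact ha hi

theorem abs_le_abs_sum_of_disjoint {ι : Type*} (s : Finset ι) (f : ι → E)
    (h : ∀ i ∈ s, ∀ j ∈ s, i ≠ j → LatDisjoint (f i) (f j)) {i : ι} (hi : i ∈ s) :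
    |f i| ≤ |∑ i ∈ s, f i| := by
  rw [abs_sum_of_disjoint s f h]
  exact Finset.single_le_sum (fun j _ => abs_nonneg (f j)) hi

theorem latDisjoint_posPart_negPart (x : E) : LatDisjoint x⁺ x⁻ :=
  (latDisjoint_of_nonneg (posPart_nonneg x) (negPart_nonneg x)).2 (posPart_inf_negPart_eq_zero x)

theorem posPart_le_abs (x : E) : x⁺ ≤ |x| := by
  rw [← posPart_add_negPart]; exact le_add_of_nonneg_right (negPart_nonneg x)

theorem negPart_le_abs (x : E) : x⁻ ≤ |x| := by
  rw [← posPart_add_negPart]; exact le_add_of_nonneg_left (posPart_nonneg x)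

theorem abs_sum_le_sum_abs {ι : Type*} (s : Finset ι) (f : ι → E) :
    |∑ i ∈ s, f i| ≤ ∑ i ∈ s, |f i| := by
  classical
  induction s using Finset.induction_on with
  | empty => simp
  | insert a s ha ih =>
    rw [Finset.sum_insert ha, Finset.sum_insert ha]
    exact (abs_add_le _ _).trans (add_le_add le_rfl ih)

/-- The vector with modulus `|x| ⊓ v` and the same signs as `x`. -/
def signClip (x v : E) : E := x⁺ ⊓ v - x⁻ ⊓ v

/-- Distributivity: the two truncations are disjoint, so their sum is a supremum, and likewise |x|
is the supremum of its positive and negative parts. -/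
theorem signClip_add_inf (x : E) {v : E} (hv : 0 ≤ v) : x⁺ ⊓ v + x⁻ ⊓ v = |x| ⊓ v := by
  let _ : DistribLattice E := AddCommGroup.toDistribLattice E
  have h1 : (x⁺ ⊓ v) ⊓ (x⁻ ⊓ v) = 0 := by
    refine le_antisymm ?_ (le_inf (le_inf (posPart_nonneg x) hv) (le_inf (negPart_nonneg x) hv))
    exact (inf_le_inf inf_le_left inf_le_left).trans (posPart_inf_negPart_eq_zero x).le
  rw [← sup_eq_add_of_inf_eq_zero h1, ← posPart_add_negPart x,
    ← sup_eq_add_of_inf_eq_zero (posPart_inf_negPart_eq_zero x)]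
  exact (inf_sup_right (x⁺) (x⁻) v).symm

theorem abs_signClip (x : E) {v : E} (hv : 0 ≤ v) : |signClip x v| = |x| ⊓ v := by
  have hp : 0 ≤ x⁺ ⊓ v := le_inf (posPart_nonneg x) hv
  have hn : 0 ≤ x⁻ ⊓ v := le_inf (negPart_nonneg x) hv
  have hd : LatDisjoint (x⁺ ⊓ v) (-(x⁻ ⊓ v)) := by
    refine (latDisjoint_posPart_negPart x).mono ?_ ?_
    · rw [abs_of_nonneg hp, abs_of_nonneg (posPart_nonneg x)]; exact inf_le_left
    · rw [abs_neg, abs_of_nonneg hn, abs_of_nonneg (negPart_nonneg x)]; exact inf_le_left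
  rw [signClip, sub_eq_add_neg, hd.abs_add_eq_add, abs_neg, abs_of_nonneg hp, abs_of_nonneg hn,
    signClip_add_inf x hv]

theorem abs_sub_signClip_le (x : E) {v : E} (hv : 0 ≤ v) : |x - signClip x v| ≤ |x| - |x| ⊓ v := by
  have h1 : x - signClip x v = (x⁺ - x⁺ ⊓ v) - (x⁻ - x⁻ ⊓ v) := by
    calc x - signClip x v = (x⁺ - x⁻) - signClip x v := by rw [posPart_sub_negPart]
      _ = _ := by rw [signClip]; abel
  have hp : 0 ≤ x⁺ - x⁺ ⊓ v := sub_nonneg.2 inf_le_left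
  have hn : 0 ≤ x⁻ - x⁻ ⊓ v := sub_nonneg.2 inf_le_left
  rw [h1, ← signClip_add_inf x hv, ← posPart_add_negPart x]
  calc _ ≤ |x⁺ - x⁺ ⊓ v| + |x⁻ - x⁻ ⊓ v| := by
        rw [sub_eq_add_neg]
        exact (abs_add_le _ _).trans_eq (by rw [abs_neg])
    _ = _ := by rw [abs_of_nonneg hp, abs_of_nonneg hn]; abel

theorem signClip_abs (x : E) : signClip x |x| = x := by
  rw [signClip, inf_eq_left.2 (posPart_le_abs x), inf_eq_left.2 (negPart_le_abs x),
    posPart_sub_negPart]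

theorem signClip_nonneg {x v : E} (hx : 0 ≤ x) (hv : 0 ≤ v) : 0 ≤ signClip x v := by
  rw [signClip, negPart_eq_zero.2 hx, inf_eq_left.2 hv, sub_zero]
  exact le_inf (posPart_nonneg x) hv

theorem sub_inf_eq_posPart_sub (a b : E) : a - a ⊓ b = (a - b)⁺ := by
  rw [inf_eq_sub_posPart_sub, sub_sub_cancel]

theorem inf_posPart_sub_posPart_sub (a b : E) : (a - b)⁺ ⊓ (b - a)⁺ = 0 := by
  have := posPart_inf_negPart_eq_zero (a - b)
  rwa [← posPart_neg, neg_sub] at this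

theorem abs_sub_le_sup_of_nonneg {a b : E} (ha : 0 ≤ a) (hb : 0 ≤ b) : |a - b| ≤ a ⊔ b := by
  refine sup_le ?_ ?_
  · exact (sub_le_self a hb).trans le_sup_left
  · rw [neg_sub]; exact (sub_le_self b ha).trans le_sup_right

end LatticeGroup

/-! ### Disjointness and scalar multiplication. -/

section LatticeModule

variable {E : Type u} [AddCommGroup E] [Module ℝ E] [Lattice E] [IsOrderedAddMonoid E]
  [IsOrderedModule ℝ E]

theorem lattice_abs_smul_le (r : ℝ) (x : E) : |r • x| ≤ |r| • |x| := by
  rcases le_total 0 r with hr | hr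
  · rw [abs_of_nonneg hr]
    exact sup_le (smul_le_smul_of_nonneg_left (le_abs_self x) hr)
      (by rw [← smul_neg]; exact smul_le_smul_of_nonneg_left (neg_le_abs x) hr)
  · rw [abs_of_nonpos hr]
    have hr' : 0 ≤ -r := neg_nonneg.2 hr
    refine sup_le ?_ ?_
    · rw [← neg_smul_neg]; exact smul_le_smul_of_nonneg_left (neg_le_abs x) hr'
    · rw [← neg_smul]; exact smul_le_smul_of_nonneg_left (le_abs_self x) hr'

theorem lattice_abs_smul (r : ℝ) (x : E) : |r • x| = |r| • |x| := by
  rcases eq_or_ne r 0 with rfl | hr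
  · simp
  refine le_antisymm (lattice_abs_smul_le r x) ?_
  have h := smul_le_smul_of_nonneg_left (lattice_abs_smul_le r⁻¹ (r • x)) (abs_nonneg r)
  rwa [smul_smul, smul_smul, inv_mul_cancel₀ hr, one_smul, ← abs_mul, mul_inv_cancel₀ hr, abs_one,
    one_smul] at h

/-- Reduced to finite sums: |r| • |y| lies below a sum of n copies of |y|. -/
theorem LatDisjoint.smul_right {x y : E} (h : LatDisjoint x y) (r : ℝ) : LatDisjoint x (r • y) := by
  obtain ⟨n, hn⟩ := exists_nat_ge |r|
  have h1 : LatDisjoint x (∑ _i ∈ Finset.range n, |y|) :=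
    LatDisjoint.sum_right fun _ _ => h.mono le_rfl (abs_abs y).le
  refine h1.mono le_rfl ?_
  rw [lattice_abs_smul, Finset.sum_const, Finset.card_range, ← Nat.cast_smul_eq_nsmul ℝ]
  exact (smul_le_smul_of_nonneg_right hn (abs_nonneg y)).trans (le_abs_self _)

theorem LatDisjoint.smul_left {x y : E} (h : LatDisjoint x y) (r : ℝ) : LatDisjoint (r • x) y :=
  (h.symm.smul_right r).symm

/-- The basic disjointification step: truncating `u` at a large multiple of `u - w`. -/
theorem sub_inf_smul_sub_le {u w : E} (hw : w ≤ u) (hw0 : 0 ≤ w) {s : ℝ} (hs : 1 ≤ s) :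
    u - u ⊓ s • (u - w) ≤ w := by
  rw [sub_le_comm]
  refine le_inf (sub_le_self u hw0) ?_
  calc u - w = (1 : ℝ) • (u - w) := (one_smul _ _).symm
    _ ≤ s • (u - w) := smul_le_smul_of_nonneg_right hs (sub_nonneg.2 hw)

/-- The vector u is the convex combination of s • (u - w) and κ • w with weights 1/s and 1/κ, hence
lies below their supremum. In an M-norm this shows that the truncation loses no norm once ‖κ • w‖ <
‖u‖. -/
theorem le_inf_smul_sub_sup_smul {u w : E} {s κ : ℝ} (hs : 0 < s)
    (hκ : 0 < κ) (hsκ : 1 / s + 1 / κ = 1) : u ≤ (u ⊓ s • (u - w)) ⊔ κ • w := by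
  let _ : DistribLattice E := AddCommGroup.toDistribLattice E
  have h1 : u ≤ s • (u - w) ⊔ κ • w := by
    have e : u = (1 / s) • (s • (u - w)) + (1 / κ) • (κ • w) := by
      rw [smul_smul, smul_smul, one_div_mul_cancel hs.ne', one_div_mul_cancel hκ.ne']; simp
    calc u = (1 / s) • (s • (u - w)) + (1 / κ) • (κ • w) := e
      _ ≤ (1 / s) • (s • (u - w) ⊔ κ • w) + (1 / κ) • (s • (u - w) ⊔ κ • w) :=
        add_le_add (smul_le_smul_of_nonneg_left le_sup_left (by positivity))
          (smul_le_smul_of_nonneg_left le_sup_right (by positivity))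
      _ = _ := by rw [← add_smul, hsκ, one_smul]
  exact (le_inf le_sup_left h1).trans (sup_inf_right u (s • (u - w)) (κ • w)).ge

end LatticeModule

/-! ### M-norms, and disjoint bases of finite-dimensional lattices. -/

section NormedLattice

variable {E : Type u} [NormedAddCommGroup E] [NormedSpace ℝ E] [Lattice E] [IsOrderedAddMonoid E]
  [HasSolidNorm E] [IsOrderedModule ℝ E]

theorem norm_le_norm_of_abs_le {x y : E} (h : |x| ≤ y) : ‖x‖ ≤ ‖y‖ :=
  norm_le_norm_of_abs_le_abs (h.trans (le_abs_self y))

theorem norm_le_norm_of_nonneg_of_le {x y : E} (hx : 0 ≤ x) (h : x ≤ y) : ‖x‖ ≤ ‖y‖ :=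
  norm_le_norm_of_abs_le (by rwa [abs_of_nonneg hx])

/-- Abstract `M`-norm: `‖a ⊔ b‖ ≤ max ‖a‖ ‖b‖` on the positive cone. -/
def IsAMNorm (E : Type u) [NormedAddCommGroup E] [Lattice E] : Prop :=
  ∀ a b : E, 0 ≤ a → 0 ≤ b → ‖a ⊔ b‖ ≤ max ‖a‖ ‖b‖

theorem IsAMNorm.norm_add_le_of_disjoint (hE : IsAMNorm E) {x y : E} (h : LatDisjoint x y) :
    ‖x + y‖ ≤ max ‖x‖ ‖y‖ := by
  have := hE |x| |y| (abs_nonneg x) (abs_nonneg y)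
  rwa [← h.abs_add_eq_sup, norm_abs_eq_norm, norm_abs_eq_norm, norm_abs_eq_norm] at this

theorem IsAMNorm.norm_sum_le_of_disjoint (hE : IsAMNorm E) {ι : Type*} (s : Finset ι) (f : ι → E)
    (h : ∀ i ∈ s, ∀ j ∈ s, i ≠ j → LatDisjoint (f i) (f j)) {C : ℝ} (hC : 0 ≤ C)
    (hf : ∀ i ∈ s, ‖f i‖ ≤ C) : ‖∑ i ∈ s, f i‖ ≤ C := by
  classical
  induction s using Finset.induction_on with
  | empty => simpa using hC
  | insert a s ha ih =>
    rw [Finset.sum_insert ha]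
    refine (hE.norm_add_le_of_disjoint (LatDisjoint.sum_right fun i hi =>
      h a (Finset.mem_insert_self a s) i (Finset.mem_insert_of_mem hi) ?_)).trans (max_le ?_ ?_)
    · rintro rfl; exact ha hi
    · exact hf a (Finset.mem_insert_self a s)
    · exact ih (fun i hi j hj => h i (Finset.mem_insert_of_mem hi) j (Finset.mem_insert_of_mem hj))
        fun i hi => hf i (Finset.mem_insert_of_mem hi)

theorem norm_le_norm_sum_of_disjoint {ι : Type*} (s : Finset ι) (f : ι → E)
    (h : ∀ i ∈ s, ∀ j ∈ s, i ≠ j → LatDisjoint (f i) (f j)) {i : ι} (hi : i ∈ s) :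
    ‖f i‖ ≤ ‖∑ i ∈ s, f i‖ :=
  norm_le_norm_of_abs_le_abs (abs_le_abs_sum_of_disjoint s f h hi)

theorem IsAMNorm.isMSpace (hE : IsAMNorm E) : IsMSpace E := by
  intro n x hx
  refine le_antisymm ?_ ?_
  · rw [← NNReal.coe_le_coe, coe_nnnorm]
    refine hE.norm_sum_le_of_disjoint _ _ (fun i _ j _ => hx i j) (NNReal.coe_nonneg _)
      fun i hi => ?_
    rw [← coe_nnnorm, NNReal.coe_le_coe]
    exact Finset.le_sup (f := fun j => ‖x j‖₊) hi
  · refine Finset.sup_le fun i hi => ?_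
    exact norm_le_norm_sum_of_disjoint Finset.univ x (fun i _ j _ => hx i j) hi

/-- The supremum of 0 and the f i. In an M-norm the bound C does not deteriorate with the number of
terms. -/
theorem IsAMNorm.exists_upper_bound (hE : IsAMNorm E) {ι : Type*} (s : Finset ι) (f : ι → E)
    {u : E} (hu : 0 ≤ u) (hf0 : ∀ i ∈ s, 0 ≤ f i) (hfu : ∀ i ∈ s, f i ≤ u) {C : ℝ} (hC : 0 ≤ C)
    (hf : ∀ i ∈ s, ‖f i‖ ≤ C) : ∃ w, 0 ≤ w ∧ w ≤ u ∧ (∀ i ∈ s, f i ≤ w) ∧ ‖w‖ ≤ C := by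
  classical
  induction s using Finset.induction_on with
  | empty => exact ⟨0, le_rfl, hu, by simp, by simpa using hC⟩
  | insert a s ha ih =>
    obtain ⟨w, hw0, hwu, hw, hwC⟩ := ih (fun i hi => hf0 i (Finset.mem_insert_of_mem hi))
      (fun i hi => hfu i (Finset.mem_insert_of_mem hi))
      (fun i hi => hf i (Finset.mem_insert_of_mem hi))
    have haM := Finset.mem_insert_self a s
    refine ⟨f a ⊔ w, hw0.trans le_sup_right, sup_le (hfu a haM) hwu, ?_, ?_⟩
    · intro i hi
      rcases Finset.mem_insert.1 hi with rfl | hi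
      · exact le_sup_left
      · exact (hw i hi).trans le_sup_right
    · exact (hE _ _ (hf0 a haM) hw0).trans (max_le (hf a haM) hwC)

theorem lattice_posPart_smul_le {r : ℝ} (hr : 0 ≤ r) (x : E) : (r • x)⁺ ≤ r • x⁺ :=
  sup_le (smul_le_smul_of_nonneg_left (le_posPart x) hr) (smul_nonneg hr (posPart_nonneg x))

/-- An Archimedean argument: rescaling by s = 1/t gives (a + s • y)⁺ ⊓ a = 0 for all s > 0, and
letting s tend to 0 leaves a ⊓ a = 0. -/
theorem eq_zero_of_forall_posPart_disjoint {a y : E} (ha : 0 ≤ a)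
    (h : ∀ t : ℝ, LatDisjoint (y + t • a)⁺ a) : a = 0 := by
  have hc : Continuous fun s : ℝ => (a + s • y)⁺ ⊓ a :=
    (continuous_posPart.comp (by fun_prop)).inf continuous_const
  have h0 : ∀ s : ℝ, s ∈ Set.Ioi (0 : ℝ) → (a + s • y)⁺ ⊓ a = 0 := fun s hs => by
    have hs : 0 < s := hs
    rw [← latDisjoint_of_nonneg (posPart_nonneg _) ha]
    refine ((h s⁻¹).smul_left s).mono ?_ le_rfl
    rw [abs_of_nonneg (posPart_nonneg _)]
    refine le_trans ?_ (le_abs_self _)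
    have e : a + s • y = s • (y + s⁻¹ • a) := by
      rw [smul_add, smul_smul, mul_inv_cancel₀ hs.ne', one_smul, add_comm]
    rw [e]
    exact lattice_posPart_smul_le hs.le _
  have h1 : (0 : ℝ) ∈ {s : ℝ | (a + s • y)⁺ ⊓ a = 0} := by
    have hcl : IsClosed {s : ℝ | (a + s • y)⁺ ⊓ a = 0} := isClosed_eq hc continuous_const
    have : closure (Set.Ioi (0 : ℝ)) ⊆ {s : ℝ | (a + s • y)⁺ ⊓ a = 0} :=
      hcl.closure_subset_iff.2 h0
    apply this
    rw [closure_Ioi]; exact Set.self_mem_Ici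
  simpa [posPart_eq_self.2 ha] using h1

/-- If `a ≥ 0` cannot be split into two nonzero disjoint parts, every vector is proportional to `a`
up to a vector disjoint from `a`. -/
theorem exists_sub_smul_disjoint {a : E} (ha : 0 ≤ a)
    (hat : ∀ y z : E, 0 ≤ y → y ≤ a → 0 ≤ z → z ≤ a → y ⊓ z = 0 → y = 0 ∨ z = 0) (x : E) :
    ∃ t : ℝ, LatDisjoint (x - t • a) a := by
  rcases eq_or_ne a 0 with rfl | ha0
  · exact ⟨0, (latDisjoint_zero_left _).symm⟩
  -- A and B are closed and cover the line because a cannot be split. Both are nonempty by the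
  -- preceding lemma, so by connectedness they share a point t.
  let A : Set ℝ := {t | (x - t • a)⁺ ⊓ a = 0}
  let B : Set ℝ := {t | (x - t • a)⁻ ⊓ a = 0}
  have hA : IsClosed A := isClosed_eq
    ((continuous_posPart.comp (by fun_prop)).inf continuous_const) continuous_const
  have hB : IsClosed B := isClosed_eq
    ((continuous_negPart.comp (by fun_prop)).inf continuous_const) continuous_const
  have hAB : ∀ t, t ∈ A ∪ B := fun t => by
    refine hat _ _ (le_inf (posPart_nonneg _) ha) inf_le_right (le_inf (negPart_nonneg _) ha)
      inf_le_right (le_antisymm ?_ (le_inf (le_inf (posPart_nonneg _) ha)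
        (le_inf (negPart_nonneg _) ha)))
    exact (inf_le_inf inf_le_left inf_le_left).trans (posPart_inf_negPart_eq_zero _).le
  have hAne : A.Nonempty := by
    by_contra hne
    rw [Set.not_nonempty_iff_eq_empty] at hne
    refine ha0 (eq_zero_of_forall_posPart_disjoint (y := -x) ha fun t => ?_)
    have h1 := hAB t
    rw [hne, Set.empty_union] at h1
    have h2 : (x - t • a)⁻ ⊓ a = 0 := h1
    rwa [← posPart_neg, neg_sub, sub_eq_neg_add, ← latDisjoint_of_nonneg (posPart_nonneg _) ha] at h2
  have hBne : B.Nonempty := by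
    by_contra hne
    rw [Set.not_nonempty_iff_eq_empty] at hne
    refine ha0 (eq_zero_of_forall_posPart_disjoint (y := x) ha fun t => ?_)
    have h1 := hAB (-t)
    rw [hne, Set.union_empty] at h1
    have h2 : (x - -t • a)⁺ ⊓ a = 0 := h1
    rwa [neg_smul, sub_neg_eq_add, ← latDisjoint_of_nonneg (posPart_nonneg _) ha] at h2
  obtain ⟨t, -, ht⟩ := isPreconnected_closed_iff.1 isPreconnected_univ A B hA hB
    (fun t _ => hAB t) (by simpa using hAne) (by simpa using hBne)
  refine ⟨t, LatDisjoint.symm ?_⟩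
  rw [← posPart_sub_negPart (x - t • a), sub_eq_add_neg]
  exact (((latDisjoint_of_nonneg (posPart_nonneg _) ha).2 ht.1).symm).add_right
    (((latDisjoint_of_nonneg (negPart_nonneg _) ha).2 ht.2).symm).neg_right

theorem linearIndependent_of_disjoint {ι : Type*} [Fintype ι] {a : ι → E} (h0 : ∀ i, a i ≠ 0)
    (h : ∀ i j, i ≠ j → LatDisjoint (a i) (a j)) : LinearIndependent ℝ a := by
  rw [Fintype.linearIndependent_iff]
  intro g hg i
  have := norm_le_norm_sum_of_disjoint Finset.univ (fun i => g i • a i)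
    (fun i _ j _ hij => ((h i j hij).smul_right (g j)).smul_left (g i)) (Finset.mem_univ i)
  rw [hg, norm_zero, norm_le_zero_iff, smul_eq_zero] at this
  exact this.resolve_right (h0 i)

/-- Take a positive disjoint system of nonzero vectors of maximal length. By maximality no member
splits, so subtracting suitable multiples of the members from x leaves a vector disjoint from all of
them, which vanishes by maximality again. -/
theorem exists_isNormalizedDisjointBasis (E : Type u) [NormedAddCommGroup E] [NormedSpace ℝ E]
    [Lattice E] [IsOrderedAddMonoid E] [HasSolidNorm E] [IsOrderedModule ℝ E]
    [FiniteDimensional ℝ E] :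
    ∃ a : Module.Basis (Fin (Module.finrank ℝ E)) ℝ E, IsNormalizedDisjointBasis a := by
  let P : ∀ n, (Fin n → E) → Prop := fun n a =>
    (∀ i, a i ≠ 0) ∧ (∀ i, 0 ≤ a i) ∧ ∀ i j, i ≠ j → LatDisjoint (a i) (a j)
  have hb : ∀ n, ∀ a : Fin n → E, P n a → n ≤ Module.finrank ℝ E := fun n a ha => by
    simpa using (linearIndependent_of_disjoint ha.1 ha.2.2).fintype_card_le_finrank
  obtain ⟨n, ⟨a, ha⟩, hmax⟩ : ∃ n, (∃ a, P n a) ∧ ∀ m, (∃ a, P m a) → m ≤ n := by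
    have hbd : BddAbove {n | ∃ a, P n a} :=
      ⟨Module.finrank ℝ E, fun n ⟨a, ha⟩ => hb n a ha⟩
    have h0 : ∃ a, P 0 a :=
      ⟨fun i => i.elim0, fun i => i.elim0, fun i => i.elim0, fun i => i.elim0⟩
    exact ⟨sSup {n | ∃ a, P n a}, Nat.sSup_mem ⟨0, h0⟩ hbd, fun m hm => le_csSup hbd hm⟩
  have hext : ∀ (b : Fin n → E), P n b → ∀ y, 0 ≤ y → (∀ i, LatDisjoint y (b i)) → y = 0 := by
    intro b hb' y hy hyb
    by_contra hy0
    have := hmax (n + 1) ⟨Fin.cons y b, ?_, ?_, ?_⟩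
    · omega
    · intro i; refine Fin.cases ?_ (fun i => ?_) i
      · simpa using hy0
      · simpa using hb'.1 i
    · intro i; refine Fin.cases ?_ (fun i => ?_) i
      · simpa using hy
      · simpa using hb'.2.1 i
    · intro i j; refine Fin.cases ?_ (fun i => ?_) i <;> refine Fin.cases ?_ (fun j => ?_) j
      · simp
      · intro _; simpa using hyb j
      · intro _; simpa using (hyb i).symm
      · intro hij; simpa using hb'.2.2 i j (by simpa using hij)
  have hat : ∀ i, ∀ y z : E, 0 ≤ y → y ≤ a i → 0 ≤ z → z ≤ a i → y ⊓ z = 0 → y = 0 ∨ z = 0 := by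
    intro i y z hy hya hz hza hyz
    by_contra! hne
    have hle : ∀ w, 0 ≤ w → w ≤ a i → ∀ j, i ≠ j → LatDisjoint w (a j) := fun w hw hwa j hij =>
      (ha.2.2 i j hij).mono (by rwa [abs_of_nonneg hw, abs_of_nonneg (ha.2.1 i)]) le_rfl
    -- If y and z split a i, replacing a i by y gives a system of the same maximal length, which z
    -- would extend.
    refine hne.2 (hext (Function.update a i y) ⟨fun j => ?_, fun j => ?_, fun j l hjl => ?_⟩ z hz
      fun j => ?_)
    · rcases eq_or_ne j i with rfl | hj
      · simpa using hne.1
      · simpa [hj] using ha.1 j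
    · rcases eq_or_ne j i with rfl | hj
      · simpa using hy
      · simpa [hj] using ha.2.1 j
    · rcases eq_or_ne j i with hj | hj <;> rcases eq_or_ne l i with hl | hl
      · exact absurd (hj.trans hl.symm) hjl
      · simpa [hl, hj] using hle y hy hya l hl.symm
      · simpa [hl, hj] using (hle y hy hya j hj.symm).symm
      · simpa [hl, hj] using ha.2.2 j l hjl
    · rcases eq_or_ne j i with hj | hj
      · simpa [hj] using ((latDisjoint_of_nonneg hy hz).2 hyz).symm
      · simpa [hj] using hle z hz hza j hj.symm
  have hspan : ∀ x : E, ∃ t : Fin n → ℝ, x = ∑ i, t i • a i := by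
    intro x
    choose t ht using fun i => exists_sub_smul_disjoint (ha.2.1 i) (hat i) x
    refine ⟨t, ?_⟩
    have hdis : ∀ i, LatDisjoint (x - ∑ i, t i • a i) (a i) := fun i => by
      have e : x - ∑ i, t i • a i = (x - t i • a i) + -∑ j ∈ Finset.univ.erase i, t j • a j := by
        rw [← Finset.add_sum_erase _ _ (Finset.mem_univ i)]; abel
      rw [e]
      refine ((ht i).symm.add_right (LatDisjoint.neg_right (LatDisjoint.sum_right ?_))).symm
      intro j hj
      exact (ha.2.2 i j (Finset.ne_of_mem_erase hj).symm).smul_right _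
    have := hext a ha |x - ∑ i, t i • a i| (abs_nonneg _)
      fun i => (hdis i).mono (abs_abs _).le le_rfl
    have h0 : ‖x - ∑ i, t i • a i‖ = 0 := by rw [← norm_abs_eq_norm, this, norm_zero]
    exact sub_eq_zero.1 (norm_eq_zero.1 h0)
  let b : Fin n → E := fun i => ‖a i‖⁻¹ • a i
  have hn : ∀ i, ‖a i‖ ≠ 0 := fun i => norm_ne_zero_iff.2 (ha.1 i)
  have hbd : ∀ i j, i ≠ j → LatDisjoint (b i) (b j) := fun i j hij =>
    ((ha.2.2 i j hij).smul_right _).smul_left _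
  have hb1 : ∀ i, ‖b i‖ = 1 := fun i => by
    rw [norm_smul, norm_inv, norm_norm, inv_mul_cancel₀ (hn i)]
  have hli : LinearIndependent ℝ b :=
    linearIndependent_of_disjoint (fun i => by rw [← norm_ne_zero_iff, hb1]; exact one_ne_zero) hbd
  have hsp : ⊤ ≤ Submodule.span ℝ (Set.range b) := by
    intro x _
    obtain ⟨t, rfl⟩ := hspan x
    refine Submodule.sum_mem _ fun i _ => ?_
    have e : t i • a i = (t i * ‖a i‖) • b i := by
      rw [smul_smul, mul_assoc, mul_inv_cancel₀ (hn i), mul_one]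
    rw [e]
    exact Submodule.smul_mem _ _ (Submodule.subset_span ⟨i, rfl⟩)
  let B := Module.Basis.mk hli hsp
  have hrank : Module.finrank ℝ E = n := by simpa using Module.finrank_eq_card_basis B
  rw [hrank]
  refine ⟨B, fun j => ⟨?_, ?_⟩, fun i j hij => ?_⟩
  · simpa [B] using smul_nonneg (by positivity) (ha.2.1 j)
  · simpa [B] using hb1 j
  · simpa [B] using hbd i j hij

end NormedLattice

/-! ### Approximate homogeneity and its consequences for operators. -/

section Homogeneous

variable {E : Type u} [NormedAddCommGroup E] [NormedSpace ℝ E] [Lattice E] [IsOrderedAddMonoid E]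
  [HasSolidNorm E] [IsOrderedModule ℝ E]

theorem IsoLat.map_abs {g : E ≃ₗᵢ[ℝ] E} (hg : g ∈ IsoLat E) (x : E) : |g x| = g |x| := by
  have h : g (x ⊔ -x) = g x ⊔ g (-x) := hg x (-x)
  rw [map_neg] at h
  exact h.symm

theorem IsoLat.map_inf {g : E ≃ₗᵢ[ℝ] E} (hg : g ∈ IsoLat E) (x y : E) :
    g (x ⊓ y) = g x ⊓ g y := by
  have h : g (-x ⊔ -y) = g (-x) ⊔ g (-y) := hg (-x) (-y)
  rw [map_neg, map_neg, ← neg_inf, ← neg_inf, map_neg] at h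
  exact neg_injective h

theorem IsoLat.map_nonneg {g : E ≃ₗᵢ[ℝ] E} (hg : g ∈ IsoLat E) {x : E} (hx : 0 ≤ x) : 0 ≤ g x := by
  rw [← abs_of_nonneg hx, ← IsoLat.map_abs hg]; exact abs_nonneg _

/-- Disjointness depends only on moduli, so g inherits its preservation from the lattice isometry h.
-/
theorem mem_isoDisj_of_abs {g h : E ≃ₗᵢ[ℝ] E} (hh : h ∈ IsoLat E) (hgh : ∀ x, |g x| = h |x|) :
    g ∈ IsoDisj E := fun x y => by
  unfold LatDisjoint
  rw [hgh, hgh, ← IsoLat.map_inf hh]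
  exact h.map_eq_zero_iff

theorem isoLat_subset_isoDisj : IsoLat E ⊆ IsoDisj E := fun _ hg =>
  mem_isoDisj_of_abs hg (IsoLat.map_abs hg)

theorem refl_mem_isoLat : LinearIsometryEquiv.refl ℝ E ∈ IsoLat E := fun _ _ => rfl

variable (E) in
/-- Disjoint tuples with the same norms are conjugate, up to `ε`, by a surjective isometry
preserving disjointness, and by a lattice isometry when they are positive. -/
def IsApproxHomogeneous : Prop :=
  ∀ (k : ℕ) (b c : Fin k → E), (∀ i j, i ≠ j → LatDisjoint (b i) (b j)) →
    (∀ i j, i ≠ j → LatDisjoint (c i) (c j)) → (∀ j, ‖b j‖ = ‖c j‖) → (∀ j, b j ≠ 0) →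
    ∀ ε : ℝ, 0 < ε → ∃ g ∈ IsoDisj E, ((∀ j, 0 ≤ b j ∧ 0 ≤ c j) → g ∈ IsoLat E) ∧
      ∀ j, ‖g (b j) - c j‖ < ε

/-- Almost disjoint positive vectors are close to disjoint vectors of the same norms. -/
theorem IsAMNorm.exists_disjoint_near (hE : IsAMNorm E) {k : ℕ} (u : Fin k → E) (hu : ∀ j, 0 ≤ u j)
    {δ : ℝ} (hδ : 0 ≤ δ) (hd : ∀ i j, i ≠ j → ‖u i ⊓ u j‖ ≤ δ) (hn : ∀ j, δ < ‖u j‖) :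
    ∃ v : Fin k → E, (∀ j, 0 ≤ v j) ∧ (∀ j, v j ≤ u j) ∧
      (∀ i j, i ≠ j → LatDisjoint (v i) (v j)) ∧ (∀ j, ‖v j‖ = ‖u j‖) ∧
      ∀ j, ‖u j - v j‖ ≤ δ := by
  classical
  -- The strict inequality δ < ‖u j‖ leaves room for a factor κ > 1; its conjugate exponent s is the
  -- slope of the truncation.
  have hκ : ∀ j, ∃ κ : ℝ, 1 < κ ∧ κ * δ < ‖u j‖ := fun j => by
    have h1 : 0 < (‖u j‖ - δ) / (2 * (δ + 1)) := div_pos (sub_pos.2 (hn j)) (by linarith)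
    refine ⟨1 + (‖u j‖ - δ) / (2 * (δ + 1)), by linarith, ?_⟩
    have h2 : (‖u j‖ - δ) / (2 * (δ + 1)) * (2 * (δ + 1)) = ‖u j‖ - δ := by field_simp
    nlinarith
  choose κ hκ1 hκδ using hκ
  choose w hw0 hwu hw hwδ using fun j => hE.exists_upper_bound (Finset.univ.erase j)
    (fun i => u j ⊓ u i) (hu j) (fun i _ => le_inf (hu j) (hu i)) (fun i _ => inf_le_left) hδ
    (fun i hi => hd j i (Finset.ne_of_mem_erase hi).symm)
  let s : Fin k → ℝ := fun j => κ j / (κ j - 1)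
  have hs1 : ∀ j, 1 ≤ s j := fun j => by
    have := hκ1 j
    rw [one_le_div (by linarith)]; linarith
  have hsκ : ∀ j, 1 / s j + 1 / κ j = 1 := fun j => by
    have h1 := hκ1 j
    have h2 : κ j - 1 ≠ 0 := by linarith
    have h3 : κ j ≠ 0 := by linarith
    simp only [s]; field_simp; ring
  have hsub : ∀ j, 0 ≤ u j - w j := fun j => sub_nonneg.2 (hwu j)
  have hv0 : ∀ j, 0 ≤ u j ⊓ s j • (u j - w j) := fun j =>
    le_inf (hu j) (smul_nonneg (by linarith [hs1 j]) (hsub j))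
  refine ⟨fun j => u j ⊓ s j • (u j - w j), hv0, fun j => inf_le_left, fun i j hij => ?_,
    fun j => ?_, fun j => ?_⟩
  -- The vector w i dominates u i ⊓ u j, so u i - w i ≤ (u i - u j)⁺, and these positive parts are
  -- disjoint when the indices are exchanged.
  · have h1 : ∀ i j, i ≠ j → u i - w i ≤ (u i - u j)⁺ := fun i j hij => by
      rw [← sub_inf_eq_posPart_sub]
      exact sub_le_sub_left (hw i j (Finset.mem_erase.2 ⟨hij.symm, Finset.mem_univ j⟩)) _
    have h2 : LatDisjoint (u i - w i) (u j - w j) := by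
      rw [latDisjoint_of_nonneg (hsub i) (hsub j)]
      refine le_antisymm ?_ (le_inf (hsub i) (hsub j))
      exact (inf_le_inf (h1 i j hij) (h1 j i hij.symm)).trans
        (inf_posPart_sub_posPart_sub (u i) (u j)).le
    refine ((h2.smul_left (s i)).smul_right (s j)).mono ?_ ?_
    · rw [abs_of_nonneg (hv0 i)]; exact inf_le_right.trans (le_abs_self _)
    · rw [abs_of_nonneg (hv0 j)]; exact inf_le_right.trans (le_abs_self _)
  · refine le_antisymm (norm_le_norm_of_nonneg_of_le (hv0 j) inf_le_left) ?_
    -- Here u j lies below the supremum of the truncation and κ j • w j. The second has norm less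
    -- than ‖u j‖, so the first carries the full norm.
    have h1 := norm_le_norm_of_nonneg_of_le (hu j)
      (le_inf_smul_sub_sup_smul (u := u j) (w := w j) (by linarith [hs1 j])
        (by linarith [hκ1 j]) (hsκ j))
    have h2 : ‖κ j • w j‖ ≤ κ j * δ := by
      rw [norm_smul, Real.norm_of_nonneg (by linarith [hκ1 j])]
      exact mul_le_mul_of_nonneg_left (hwδ j) (by linarith [hκ1 j])
    have h3 := h1.trans (hE _ _ (hv0 j) (smul_nonneg (by linarith [hκ1 j]) (hw0 j)))
    rcases le_max_iff.1 h3 with h | h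
    · exact h
    · linarith [hκδ j]
  · exact (norm_le_norm_of_nonneg_of_le (sub_nonneg.2 inf_le_left)
      (sub_inf_smul_sub_le (hwu j) (hw0 j) (hs1 j))).trans (hwδ j)

section Operators

variable {A : Type v} [NormedAddCommGroup A] [NormedSpace ℝ A] [Lattice A] [IsOrderedAddMonoid A]
  [HasSolidNorm A] [IsOrderedModule ℝ A]

/-- Every coordinate of x is at most ‖x‖ in absolute value, because the components of x are disjoint
and the basis is normalized. -/
theorem IsNormalizedDisjointBasis.abs_map_le {k : ℕ} {a : Module.Basis (Fin k) ℝ A}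
    (ha : IsNormalizedDisjointBasis a) (T : A →L[ℝ] E) (x : A) :
    |T x| ≤ ‖x‖ • ∑ j, |T (a j)| := by
  have hx : ∀ j, |a.repr x j| ≤ ‖x‖ := fun j => by
    have := norm_le_norm_sum_of_disjoint Finset.univ (fun j => a.repr x j • a j)
      (fun i _ j _ hij => ((ha.2 i j hij).smul_right _).smul_left _) (Finset.mem_univ j)
    rwa [a.sum_repr, norm_smul, (ha.1 j).2, mul_one, Real.norm_eq_abs] at this
  calc |T x| = |∑ j, a.repr x j • T (a j)| := by
        conv_lhs => rw [← a.sum_repr x, map_sum]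
        simp only [map_smul]
    _ ≤ ∑ j, |a.repr x j • T (a j)| := abs_sum_le_sum_abs _ _
    _ ≤ ∑ j, ‖x‖ • |T (a j)| := Finset.sum_le_sum fun j _ => by
        rw [lattice_abs_smul]; exact smul_le_smul_of_nonneg_right (hx j) (abs_nonneg _)
    _ = _ := by rw [Finset.smul_sum]

/-- The sum is kept inside the norm, so that disjoint contributions count through their maximum in
an M-norm. -/
theorem IsNormalizedDisjointBasis.opNorm_le {k : ℕ} {a : Module.Basis (Fin k) ℝ A}
    (ha : IsNormalizedDisjointBasis a) (T : A →L[ℝ] E) : ‖T‖ ≤ ‖∑ j, |T (a j)|‖ :=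
  T.opNorm_le_bound (norm_nonneg _) fun x => by
    have := norm_le_norm_of_abs_le (ha.abs_map_le T x)
    rwa [norm_smul, norm_norm, mul_comm] at this

/-- Matching the disjoint parts `b j`, `c j` of two operators. -/
theorem IsApproxHomogeneous.exists_match (hH : IsApproxHomogeneous E) (hE : IsAMNorm E) {k : ℕ}
    {a : Module.Basis (Fin k) ℝ A} (ha : IsNormalizedDisjointBasis a) (γ η : A →L[ℝ] E)
    (b c : Fin k → E) (hb : ∀ i j, i ≠ j → LatDisjoint (b i) (b j))
    (hc : ∀ i j, i ≠ j → LatDisjoint (c i) (c j)) (hb0 : ∀ j, b j ≠ 0) (hc0 : ∀ j, c j ≠ 0)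
    {d : ℝ} (hd : 0 ≤ d) (hbc : ∀ j, |‖b j‖ - ‖c j‖| ≤ d) {ε : ℝ} (hε : 0 < ε) :
    ∃ g ∈ IsoDisj E, ((∀ j, 0 ≤ b j ∧ 0 ≤ c j) → g ∈ IsoLat E) ∧
      ‖(g.toContinuousLinearEquiv : E →L[ℝ] E).comp γ - η‖ <
        d + ∑ j, ‖g (γ (a j) - b j) - (η (a j) - c j)‖ + ε := by
  have hc0' : ∀ j, ‖c j‖ ≠ 0 := fun j => norm_ne_zero_iff.2 (hc0 j)
  -- Homogeneity asks for equal norms, so c j is first rescaled to the norm of b j.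
  let c' : Fin k → E := fun j => (‖b j‖ / ‖c j‖) • c j
  obtain ⟨g, hg, hgl, hgb⟩ := hH k b c' hb
    (fun i j hij => ((hc i j hij).smul_right _).smul_left _)
    (fun j => by rw [norm_smul, norm_div, norm_norm, norm_norm, div_mul_cancel₀ _ (hc0' j)])
    hb0 (ε / (k + 1)) (by positivity)
  refine ⟨g, hg, fun h => hgl fun j => ⟨(h j).1, smul_nonneg (by positivity) (h j).2⟩, ?_⟩
  refine (ha.opNorm_le _).trans_lt ?_
  have hsum : ∑ j, |((g.toContinuousLinearEquiv : E →L[ℝ] E).comp γ - η) (a j)| ≤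
      ∑ j, |c' j - c j| + (∑ j, |g (b j) - c' j| +
        ∑ j, |g (γ (a j) - b j) - (η (a j) - c j)|) := by
    rw [← Finset.sum_add_distrib, ← Finset.sum_add_distrib]
    refine Finset.sum_le_sum fun j _ => ?_
    have e : ((g.toContinuousLinearEquiv : E →L[ℝ] E).comp γ - η) (a j) =
        (c' j - c j) + ((g (b j) - c' j) + (g (γ (a j) - b j) - (η (a j) - c j))) := by
      have : ((g.toContinuousLinearEquiv : E →L[ℝ] E).comp γ - η) (a j) =
        g (γ (a j)) - η (a j) := rfl
      rw [this, map_sub]; abel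
    rw [e]
    exact (abs_add_le _ _).trans (add_le_add le_rfl (abs_add_le _ _))
  -- The rescaling errors are multiples of the disjoint c j: their maximum counts, not their sum,
  -- and d is paid only once.
  have h1 : ‖∑ j, |c' j - c j|‖ ≤ d := by
    have e : ∀ j, c' j - c j = (‖b j‖ / ‖c j‖ - 1) • c j := fun j => by
      rw [sub_smul, one_smul]
    have hdis : ∀ i ∈ Finset.univ, ∀ j ∈ Finset.univ, i ≠ j →
        LatDisjoint (c' i - c i) (c' j - c j) := fun i _ j _ hij => by
      rw [e, e]; exact ((hc i j hij).smul_right _).smul_left _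
    rw [← abs_sum_of_disjoint _ _ hdis, norm_abs_eq_norm]
    refine hE.norm_sum_le_of_disjoint _ _ hdis hd fun j _ => ?_
    rw [e, norm_smul, Real.norm_eq_abs]
    calc _ = |(‖b j‖ / ‖c j‖ - 1) * ‖c j‖| := by rw [abs_mul, abs_norm]
      _ = |‖b j‖ - ‖c j‖| := by rw [sub_mul, one_mul, div_mul_cancel₀ _ (hc0' j)]
      _ ≤ d := hbc j
  have h2 : ‖∑ j, |g (b j) - c' j|‖ < ε := by
    refine (norm_sum_le _ _).trans_lt ?_
    calc ∑ j, ‖|g (b j) - c' j|‖ ≤ ∑ _j : Fin k, ε / (k + 1) :=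
          Finset.sum_le_sum fun j _ => by rw [norm_abs_eq_norm]; exact (hgb j).le
      _ = k * (ε / (k + 1)) := by simp
      _ < ε := by
        rw [mul_div_assoc', div_lt_iff₀ (by positivity)]; nlinarith
  have h3 : ‖∑ j, |g (γ (a j) - b j) - (η (a j) - c j)|‖ ≤
      ∑ j, ‖g (γ (a j) - b j) - (η (a j) - c j)‖ :=
    (norm_sum_le _ _).trans_eq (Finset.sum_congr rfl fun j _ => norm_abs_eq_norm _)
  calc _ ≤ _ := norm_le_norm_of_nonneg_of_le (Finset.sum_nonneg fun j _ => abs_nonneg _) hsum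
    _ ≤ _ := (norm_add_le _ _).trans (add_le_add le_rfl (norm_add_le _ _))
    _ < _ := by linarith

/-- Any two positive vectors can be made almost disjoint by a lattice isometry. -/
theorem IsApproxHomogeneous.exists_almost_disjoint (hH : IsApproxHomogeneous E)
    (he : ∃ e f : E, e ≠ 0 ∧ f ≠ 0 ∧ LatDisjoint e f) {u w : E} (hu : 0 ≤ u) (hw : 0 ≤ w)
    {ε : ℝ} (hε : 0 < ε) : ∃ g ∈ IsoLat E, ‖g u ⊓ w‖ < ε := by
  rcases eq_or_ne u 0 with rfl | hu0
  · exact ⟨_, refl_mem_isoLat, by rw [map_zero, inf_eq_left.2 hw, norm_zero]; exact hε⟩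
  rcases eq_or_ne w 0 with rfl | hw0
  · exact ⟨_, refl_mem_isoLat, by
      rw [LinearIsometryEquiv.coe_refl, id, inf_eq_right.2 hu, norm_zero]; exact hε⟩
  obtain ⟨e, f, he0, hf0, hef⟩ := he
  have hnorm : ∀ {x y : E}, x ≠ 0 → ‖(‖y‖ / ‖x‖) • |x|‖ = ‖y‖ := fun {x y} hx => by
    rw [norm_smul, norm_div, norm_norm, norm_norm, norm_abs_eq_norm,
      div_mul_cancel₀ _ (norm_ne_zero_iff.2 hx)]
  have hone : ∀ x y : E, 0 ≤ x → 0 ≤ y → ‖x‖ = ‖y‖ → x ≠ 0 →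
      ∃ g ∈ IsoLat E, ‖g x - y‖ < ε / 2 := fun x y hx hy hxy hx0 => by
    obtain ⟨g, -, hg, hgx⟩ := hH 1 (fun _ => x) (fun _ => y)
      (fun i j hij => absurd (Subsingleton.elim i j) hij)
      (fun i j hij => absurd (Subsingleton.elim i j) hij) (fun _ => hxy) (fun _ => hx0)
      (ε / 2) (by linarith)
    exact ⟨g, hg fun _ => ⟨hx, hy⟩, hgx 0⟩
  -- The norms are crossed on purpose: g moves e' close to w, and then h moves u close to g f',
  -- which is disjoint from g e'.
  set e' := (‖w‖ / ‖e‖) • |e| with he'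
  set f' := (‖u‖ / ‖f‖) • |f| with hf'
  have hef' : LatDisjoint e' f' :=
    ((hef.mono (abs_abs e).le (abs_abs f).le).smul_left _).smul_right _
  have he'0 : 0 ≤ e' := smul_nonneg (by positivity) (abs_nonneg _)
  have hf'0 : 0 ≤ f' := smul_nonneg (by positivity) (abs_nonneg _)
  obtain ⟨g, hg, hgw⟩ := hone e' w he'0 hw (hnorm he0) (by
    rw [← norm_ne_zero_iff, hnorm he0]; exact norm_ne_zero_iff.2 hw0)
  obtain ⟨h, hh, hhu⟩ := hone u (g f') hu (IsoLat.map_nonneg hg hf'0)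
    (by rw [g.norm_map, hnorm hf0]) hu0
  refine ⟨h, hh, ?_⟩
  have h0 : g f' ⊓ g e' = 0 := by
    rw [← IsoLat.map_inf hg, (latDisjoint_of_nonneg hf'0 he'0).1 hef'.symm, map_zero]
  calc ‖h u ⊓ w‖ = ‖h u ⊓ w - g f' ⊓ g e'‖ := by rw [h0, sub_zero]
    _ ≤ ‖h u - g f'‖ + ‖w - g e'‖ := norm_inf_sub_inf_le_add_norm _ _ _ _
    _ < ε := by rw [norm_sub_rev w]; linarith

/-- From |x| + |y| = (|x| ⊔ |y|) + (|x| ⊓ |y|): almost disjoint vectors obey the M-norm estimate up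
to the size of their meet. -/
theorem norm_sub_le_max_add_norm_inf (hE : IsAMNorm E) (x y : E) :
    ‖x - y‖ ≤ max ‖x‖ ‖y‖ + ‖|x| ⊓ |y|‖ := by
  have h1 : |x - y| ≤ (|x| ⊔ |y|) + |x| ⊓ |y| := by
    rw [add_comm, inf_add_sup, sub_eq_add_neg]
    exact (abs_add_le _ _).trans_eq (by rw [abs_neg])
  refine (norm_le_norm_of_abs_le h1).trans ((norm_add_le _ _).trans (add_le_add ?_ le_rfl))
  exact (hE |x| |y| (abs_nonneg _) (abs_nonneg _)).trans_eq
    (by rw [norm_abs_eq_norm, norm_abs_eq_norm])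

/-- Two operators can be moved to almost disjoint position. -/
theorem IsApproxHomogeneous.exists_norm_comp_sub_lt (hH : IsApproxHomogeneous E) (hE : IsAMNorm E)
    (he : ∃ e f : E, e ≠ 0 ∧ f ≠ 0 ∧ LatDisjoint e f) {k : ℕ}
    {a : Module.Basis (Fin k) ℝ A} (ha : IsNormalizedDisjointBasis a) (γ η : A →L[ℝ] E) {C : ℝ}
    (hC : 0 ≤ C) (hγ : ∀ x, ‖γ x‖ ≤ C * ‖x‖) (hη : ∀ x, ‖η x‖ ≤ C * ‖x‖) {ε : ℝ} (hε : 0 < ε) :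
    ∃ g ∈ IsoLat E, ‖(g.toContinuousLinearEquiv : E →L[ℝ] E).comp γ - η‖ < C + ε := by
  have hpos : ∀ T : A →L[ℝ] E, 0 ≤ ∑ j, |T (a j)| := fun T =>
    Finset.sum_nonneg fun j _ => abs_nonneg _
  -- These two sums dominate |γ x| and |η x| for all x in the unit ball, so a single isometry
  -- separates the operators uniformly.
  obtain ⟨g, hg, hgd⟩ := hH.exists_almost_disjoint he (hpos γ) (hpos η) (half_pos hε)
  refine ⟨g, hg, ?_⟩
  refine (ContinuousLinearMap.opNorm_le_bound _ (by positivity : 0 ≤ C + ε / 2) fun x => ?_).trans_lt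
    (by linarith)
  have e : ((g.toContinuousLinearEquiv : E →L[ℝ] E).comp γ - η) x = g (γ x) - η x := rfl
  have h1 : |g (γ x)| ≤ ‖x‖ • g (∑ j, |γ (a j)|) := by
    rw [IsoLat.map_abs hg, ← map_smul, ← sub_nonneg, ← map_sub]
    exact IsoLat.map_nonneg hg (sub_nonneg.2 (ha.abs_map_le γ x))
  have h2 : |g (γ x)| ⊓ |η x| ≤ ‖x‖ • (g (∑ j, |γ (a j)|) ⊓ ∑ j, |η (a j)|) := by
    rcases eq_or_ne x 0 with rfl | hx
    · simp
    have hx' : 0 < ‖x‖ := norm_pos_iff.2 hx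
    rw [← inv_smul_le_iff_of_pos hx']
    refine le_inf ?_ ?_
    · rw [inv_smul_le_iff_of_pos hx']; exact inf_le_left.trans h1
    · rw [inv_smul_le_iff_of_pos hx']; exact inf_le_right.trans (ha.abs_map_le η x)
  have h3 := norm_le_norm_of_nonneg_of_le (le_inf (abs_nonneg _) (abs_nonneg _)) h2
  rw [norm_smul, norm_norm] at h3
  rw [e]
  calc _ ≤ max ‖g (γ x)‖ ‖η x‖ + ‖|g (γ x)| ⊓ |η x|‖ := norm_sub_le_max_add_norm_inf hE _ _
    _ ≤ C * ‖x‖ + ‖x‖ * (ε / 2) := by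
      refine add_le_add (max_le ?_ (hη x)) (h3.trans (mul_le_mul_of_nonneg_left hgd.le
        (norm_nonneg _)))
      rw [g.norm_map]; exact hγ x
    _ = _ := by ring

end Operators

end Homogeneous

/-! ### Transitivity on δ-embeddings, with constant 3kδ. -/

section Transitivity

variable {E : Type u} [NormedAddCommGroup E] [NormedSpace ℝ E] [Lattice E] [IsOrderedAddMonoid E]
  [HasSolidNorm E] [IsOrderedModule ℝ E]
variable {A : Type v} [NormedAddCommGroup A] [NormedSpace ℝ A] [Lattice A] [IsOrderedAddMonoid A]
  [HasSolidNorm A] [IsOrderedModule ℝ A]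

theorem norm_negPart_le_infDist (x : E) : ‖x⁻‖ ≤ Metric.infDist x {b : E | 0 ≤ b} := by
  refine (Metric.le_infDist (s := {b : E | 0 ≤ b}) ⟨0, le_refl (0 : E)⟩).2 fun p hp => ?_
  rw [dist_eq_norm]
  refine norm_le_norm_of_abs_le_abs ?_
  rw [abs_of_nonneg (negPart_nonneg x)]
  refine sup_le (le_trans ?_ (neg_le_abs _)) (abs_nonneg _)
  rw [neg_sub]
  have hp : 0 ≤ p := hp
  rw [sub_eq_add_neg]
  exact le_add_of_nonneg_left hp

theorem IsAMNorm.norm_sub_le_of_nonneg (hE : IsAMNorm E) {a b : E} (ha : 0 ≤ a) (hb : 0 ≤ b) {C : ℝ}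
    (haC : ‖a‖ ≤ C) (hbC : ‖b‖ ≤ C) : ‖a - b‖ ≤ C :=
  (norm_le_norm_of_abs_le (abs_sub_le_sup_of_nonneg ha hb)).trans
    ((hE a b ha hb).trans (max_le haC hbC))

/-- The norm of x is at most the larger of ‖x⁺‖ and ‖x⁻‖, and the hypothesis excludes the second. -/
theorem IsAMNorm.norm_posPart_eq (hE : IsAMNorm E) {x : E} (h : ‖x⁻‖ < ‖x‖) : ‖x⁺‖ = ‖x‖ := by
  refine le_antisymm ?_ ?_
  · refine norm_le_norm_of_abs_le_abs ?_
    rw [abs_of_nonneg (posPart_nonneg x)]; exact posPart_le_abs x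
  · have h1 := hE.norm_add_le_of_disjoint (latDisjoint_posPart_negPart x).neg_right
    rw [← sub_eq_add_neg, posPart_sub_negPart, norm_neg] at h1
    rcases le_max_iff.1 h1 with h2 | h2
    · exact h2
    · linarith

theorem IsAlmostIsometric.le_norm {δ : ℝ≥0} {γ : A →L[ℝ] E} (hγ : IsAlmostIsometric δ γ) {x : A}
    (hx : ‖x‖ = 1) : 1 / (1 + (δ : ℝ)) ≤ ‖γ x‖ := by simpa [hx] using (hγ x).1

theorem IsAlmostIsometric.norm_le {δ : ℝ≥0} {γ : A →L[ℝ] E} (hγ : IsAlmostIsometric δ γ) {x : A}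
    (hx : ‖x‖ = 1) : ‖γ x‖ ≤ 1 + (δ : ℝ) := by simpa [hx] using (hγ x).2

/-- Both numbers lie in [1 - δ, 1 + δ]. -/
theorem abs_sub_le_of_almostIsometric_bounds {δ s t : ℝ} (hδ : 0 ≤ δ) (hs : 1 / (1 + δ) ≤ s)
    (hs' : s ≤ 1 + δ) (ht : 1 / (1 + δ) ≤ t) (ht' : t ≤ 1 + δ) : |s - t| ≤ 2 * δ := by
  have h : 1 - δ ≤ 1 / (1 + δ) := by
    rw [le_div_iff₀ (by linarith)]; nlinarith
  rw [abs_le]; constructor <;> linarith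

/-- Large `δ`: any two `δ`-isometric operators are `3kδ`-conjugate. -/
theorem exists_isoLat_of_large (hE : IsAMNorm E) (hH : IsApproxHomogeneous E)
    (he : ∃ e f : E, e ≠ 0 ∧ f ≠ 0 ∧ LatDisjoint e f) {k : ℕ} (hk : 1 ≤ k)
    {a : Module.Basis (Fin k) ℝ A} (ha : IsNormalizedDisjointBasis a) {δ : ℝ≥0}
    (hδ : 1 / (1 + (δ : ℝ)) ≤ δ) {γ η : A →L[ℝ] E} (hγ : IsAlmostIsometric δ γ)
    (hη : IsAlmostIsometric δ η) {ε : ℝ} (hε : 0 < ε) :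
    ∃ g ∈ IsoLat E, ‖(g.toContinuousLinearEquiv : E →L[ℝ] E).comp γ - η‖ < 3 * k * δ + ε := by
  have hδ0 : (0 : ℝ) ≤ δ := δ.coe_nonneg
  obtain ⟨g, hg, hgn⟩ := hH.exists_norm_comp_sub_lt hE he ha γ η (C := 1 + δ) (by positivity)
    (fun x => (hγ x).2) (fun x => (hη x).2) hε
  refine ⟨g, hg, hgn.trans_le ?_⟩
  -- From δ(1 + δ) ≥ 1 one gets δ ≥ 1/2, hence 1 + δ ≤ 3δ ≤ 3kδ.
  have h1 : (1 : ℝ) / 2 ≤ δ := by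
    rw [div_le_iff₀ (by positivity)] at hδ
    by_contra! h
    nlinarith
  have hk' : (1 : ℝ) ≤ k := by exact_mod_cast hk
  nlinarith

/-- The tolerance for the disjointness of `k` vectors; there is no error for a single vector. -/
def disjointnessError (k : ℕ) (δ : ℝ) : ℝ := if k = 1 then 0 else δ

theorem disjointnessError_nonneg {k : ℕ} {δ : ℝ} (hδ : 0 ≤ δ) : 0 ≤ disjointnessError k δ := by
  unfold disjointnessError; split_ifs <;> simp [hδ]

theorem disjointnessError_le {k : ℕ} {δ : ℝ} (hδ : 0 ≤ δ) : disjointnessError k δ ≤ δ := by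
  unfold disjointnessError; split_ifs <;> simp [hδ]

theorem disjointnessError_of_ne {k : ℕ} {δ : ℝ} {i j : Fin k} (hij : i ≠ j) :
    disjointnessError k δ = δ := by
  unfold disjointnessError
  rw [if_neg]
  rintro rfl
  exact hij (Subsingleton.elim i j)

/-- If δ < 1/(1 + δ), the images of the basis vectors have norm greater than δ, so their positive
parts keep the whole norm and can be disjointified. Otherwise the crude bound of
`exists_isoLat_of_large` suffices. -/
theorem actsTransitively_isoLat [FiniteDimensional ℝ A] (hE : IsAMNorm E)
    (hH : IsApproxHomogeneous E) (he : ∃ e f : E, e ≠ 0 ∧ f ≠ 0 ∧ LatDisjoint e f) (δ : ℝ≥0) (ε : ℝ)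
    (hε : 0 < ε) :
    ActsTransitively (IsoLat E) (EmbLat δ A E) (3 * Module.finrank ℝ A * δ + ε) := by
  obtain ⟨k, hkA, a, ha⟩ : ∃ k, Module.finrank ℝ A = k ∧
      ∃ a : Module.Basis (Fin k) ℝ A, IsNormalizedDisjointBasis a :=
    ⟨_, rfl, exists_isNormalizedDisjointBasis A⟩
  rw [hkA]
  rintro γ ⟨hγd, hγp, hγi⟩ η ⟨hηd, hηp, hηi⟩
  have hδ0 : (0 : ℝ) ≤ δ := δ.coe_nonneg
  rcases Nat.eq_zero_or_pos k with hk | hk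
  · refine ⟨_, refl_mem_isoLat, (ha.opNorm_le _).trans_lt ?_⟩
    have : IsEmpty (Fin k) := by rw [hk]; infer_instance
    rw [Finset.univ_eq_empty, Finset.sum_empty, norm_zero]
    positivity
  rcases le_or_gt (1 / (1 + (δ : ℝ))) δ with hδ | hδ
  · exact exists_isoLat_of_large hE hH he hk ha hδ hγi hηi hε
  have hprep : ∀ θ : A →L[ℝ] E, IsAlmostDisjointPreserving δ θ → IsAlmostPositive δ θ →
      IsAlmostIsometric δ θ → ∃ v : Fin k → E, (∀ j, 0 ≤ v j) ∧ (∀ j, v j ≤ (θ (a j))⁺) ∧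
      (∀ i j, i ≠ j → LatDisjoint (v i) (v j)) ∧ (∀ j, ‖v j‖ = ‖θ (a j)‖) ∧
      (∀ j, ‖(θ (a j))⁺ - v j‖ ≤ disjointnessError k δ) ∧ ∀ j, ‖(θ (a j))⁻‖ ≤ δ := by
    intro θ hd hp hi
    have hneg : ∀ j, ‖(θ (a j))⁻‖ ≤ δ := fun j =>
      (norm_negPart_le_infDist _).trans (hp (a j) (ha.1 j).1 (ha.1 j).2.le)
    have hlow : ∀ j, (δ : ℝ) < ‖θ (a j)‖ := fun j => hδ.trans_le (hi.le_norm (ha.1 j).2)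
    have hpos : ∀ j, ‖(θ (a j))⁺‖ = ‖θ (a j)‖ := fun j =>
      hE.norm_posPart_eq ((hneg j).trans_lt (hlow j))
    obtain ⟨v, hv0, hvu, hvd, hvn, hv⟩ := hE.exists_disjoint_near (fun j => (θ (a j))⁺)
      (fun j => posPart_nonneg _) (disjointnessError_nonneg (k := k) hδ0)
      (fun i j hij => by
        rw [disjointnessError_of_ne hij]
        refine (norm_le_norm_of_nonneg_of_le (le_inf (posPart_nonneg _) (posPart_nonneg _))
          (inf_le_inf (posPart_le_abs _) (posPart_le_abs _))).trans (hd k a ha i j hij))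
      (fun j => by
        rw [hpos]; exact (disjointnessError_le hδ0).trans_lt (hlow j))
    exact ⟨v, hv0, hvu, hvd, fun j => (hvn j).trans (hpos j), hv, hneg⟩
  obtain ⟨b, hb0, hbu, hbd, hbn, hb, hbneg⟩ := hprep γ hγd hγp hγi
  obtain ⟨c, hc0, hcu, hcd, hcn, hc, hcneg⟩ := hprep η hηd hηp hηi
  have hinv : 0 < 1 / (1 + (δ : ℝ)) := by positivity
  obtain ⟨g, -, hg, hgn⟩ := hH.exists_match hE ha γ η b c hbd hcd
    (fun j => by
      rw [← norm_pos_iff, hbn]; exact hinv.trans_le (hγi.le_norm (ha.1 j).2))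
    (fun j => by
      rw [← norm_pos_iff, hcn]; exact hinv.trans_le (hηi.le_norm (ha.1 j).2))
    (d := 2 * δ) (by positivity) (fun j => by
      rw [hbn, hcn]
      exact abs_sub_le_of_almostIsometric_bounds hδ0 (hγi.le_norm (ha.1 j).2)
        (hγi.norm_le (ha.1 j).2) (hηi.le_norm (ha.1 j).2) (hηi.norm_le (ha.1 j).2)) hε
  have hgl : g ∈ IsoLat E := hg fun j => ⟨hb0 j, hc0 j⟩
  refine ⟨g, hgl, hgn.trans_le ?_⟩
  -- As g is positive, the error is a difference of positive vectors for the overlaps and another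
  -- for the negative parts. In an M-norm such differences cost a maximum, so the errors of γ and η
  -- do not add up.
  have hterm : ∀ j, ‖g (γ (a j) - b j) - (η (a j) - c j)‖ ≤ disjointnessError k δ + δ := by
    intro j
    have e : g (γ (a j) - b j) - (η (a j) - c j) =
        (g ((γ (a j))⁺ - b j) - ((η (a j))⁺ - c j)) - (g (γ (a j))⁻ - (η (a j))⁻) := by
      have h1 : γ (a j) - b j = ((γ (a j))⁺ - b j) - (γ (a j))⁻ := by
        conv_lhs => rw [← posPart_sub_negPart (γ (a j))]
        abel
      have h2 : η (a j) - c j = ((η (a j))⁺ - c j) - (η (a j))⁻ := by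
        conv_lhs => rw [← posPart_sub_negPart (η (a j))]
        abel
      rw [h1, h2, map_sub g ((γ (a j))⁺ - b j)]; abel
    rw [e]
    refine (norm_sub_le _ _).trans (add_le_add ?_ ?_)
    · exact hE.norm_sub_le_of_nonneg (IsoLat.map_nonneg hgl (sub_nonneg.2 (hbu j)))
        (sub_nonneg.2 (hcu j)) (by rw [g.norm_map]; exact hb j) (hc j)
    · exact hE.norm_sub_le_of_nonneg (IsoLat.map_nonneg hgl (negPart_nonneg _))
        (negPart_nonneg _) (by rw [g.norm_map]; exact hbneg j) (hcneg j)
  have hsum : ∑ j, ‖g (γ (a j) - b j) - (η (a j) - c j)‖ ≤ k * (disjointnessError k δ + δ) :=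
    (Finset.sum_le_sum fun j _ => hterm j).trans_eq (by simp [mul_add])
  -- The bound 2δ + 2kδ ≤ 3kδ needs k ≥ 2; for k = 1 the disjointness error vanishes and 2δ + δ
  -- remains.
  have hfin : 2 * (δ : ℝ) + k * (disjointnessError k δ + δ) ≤ 3 * k * δ := by
    by_cases h1 : k = 1
    · simp only [disjointnessError, h1]; norm_num; linarith
    · have h2 : (2 : ℝ) ≤ k := by exact_mod_cast (by omega : 2 ≤ k)
      simp only [disjointnessError, h1, if_false]; nlinarith
  linarith

/-- The moduli of the images are disjointified and `signClip` restores their signs. Without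
positivity the errors of γ and η do add up, but no negative part has to be paid for. -/
theorem actsTransitively_isoDisj [FiniteDimensional ℝ A] (hE : IsAMNorm E)
    (hH : IsApproxHomogeneous E) (he : ∃ e f : E, e ≠ 0 ∧ f ≠ 0 ∧ LatDisjoint e f) (δ : ℝ≥0) (ε : ℝ)
    (hε : 0 < ε) :
    ActsTransitively (IsoDisj E) (EmbDisj δ A E) (3 * Module.finrank ℝ A * δ + ε) := by
  obtain ⟨k, hkA, a, ha⟩ : ∃ k, Module.finrank ℝ A = k ∧
      ∃ a : Module.Basis (Fin k) ℝ A, IsNormalizedDisjointBasis a :=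
    ⟨_, rfl, exists_isNormalizedDisjointBasis A⟩
  rw [hkA]
  rintro γ ⟨hγd, hγi⟩ η ⟨hηd, hηi⟩
  have hδ0 : (0 : ℝ) ≤ δ := δ.coe_nonneg
  rcases Nat.eq_zero_or_pos k with hk | hk
  · refine ⟨_, isoLat_subset_isoDisj refl_mem_isoLat, (ha.opNorm_le _).trans_lt ?_⟩
    have : IsEmpty (Fin k) := by rw [hk]; infer_instance
    rw [Finset.univ_eq_empty, Finset.sum_empty, norm_zero]
    positivity
  rcases le_or_gt (1 / (1 + (δ : ℝ))) δ with hδ | hδ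
  · obtain ⟨g, hg, h⟩ := exists_isoLat_of_large hE hH he hk ha hδ hγi hηi hε
    exact ⟨g, isoLat_subset_isoDisj hg, h⟩
  have hprep : ∀ θ : A →L[ℝ] E, IsAlmostDisjointPreserving δ θ →
      IsAlmostIsometric δ θ → ∃ v : Fin k → E,
      (∀ i j, i ≠ j → LatDisjoint (v i) (v j)) ∧ (∀ j, ‖v j‖ = ‖θ (a j)‖) ∧
      (∀ j, ‖θ (a j) - v j‖ ≤ disjointnessError k δ) := by
    intro θ hd hi
    have hlow : ∀ j, (δ : ℝ) < ‖θ (a j)‖ := fun j => hδ.trans_le (hi.le_norm (ha.1 j).2)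
    obtain ⟨v, hv0, hvu, hvd, hvn, hv⟩ := hE.exists_disjoint_near (fun j => |θ (a j)|)
      (fun j => abs_nonneg _) (disjointnessError_nonneg (k := k) hδ0)
      (fun i j hij => by rw [disjointnessError_of_ne hij]; exact hd k a ha i j hij)
      (fun j => by
        rw [norm_abs_eq_norm]; exact (disjointnessError_le hδ0).trans_lt (hlow j))
    have habs : ∀ j, |signClip (θ (a j)) (v j)| = v j := fun j => by
      rw [abs_signClip _ (hv0 j), inf_eq_right.2 (hvu j)]
    refine ⟨fun j => signClip (θ (a j)) (v j), fun i j hij => ?_, fun j => ?_, fun j => ?_⟩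
    · refine (hvd i j hij).mono ?_ ?_ <;> rw [habs] <;> exact le_abs_self _
    · rw [← norm_abs_eq_norm, habs, hvn, norm_abs_eq_norm]
    · refine (norm_le_norm_of_abs_le (abs_sub_signClip_le _ (hv0 j))).trans ?_
      rw [inf_eq_right.2 (hvu j)]; exact hv j
  obtain ⟨b, hbd, hbn, hb⟩ := hprep γ hγd hγi
  obtain ⟨c, hcd, hcn, hc⟩ := hprep η hηd hηi
  have hinv : 0 < 1 / (1 + (δ : ℝ)) := by positivity
  obtain ⟨g, hg, -, hgn⟩ := hH.exists_match hE ha γ η b c hbd hcd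
    (fun j => by
      rw [← norm_pos_iff, hbn]; exact hinv.trans_le (hγi.le_norm (ha.1 j).2))
    (fun j => by
      rw [← norm_pos_iff, hcn]; exact hinv.trans_le (hηi.le_norm (ha.1 j).2))
    (d := 2 * δ) (by positivity) (fun j => by
      rw [hbn, hcn]
      exact abs_sub_le_of_almostIsometric_bounds hδ0 (hγi.le_norm (ha.1 j).2)
        (hγi.norm_le (ha.1 j).2) (hηi.le_norm (ha.1 j).2) (hηi.norm_le (ha.1 j).2)) hε
  refine ⟨g, hg, hgn.trans_le ?_⟩
  have hterm : ∀ j, ‖g (γ (a j) - b j) - (η (a j) - c j)‖ ≤ 2 * disjointnessError k δ := by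
    intro j
    refine (norm_sub_le _ _).trans ?_
    rw [g.norm_map]
    linarith [hb j, hc j]
  have hsum : ∑ j, ‖g (γ (a j) - b j) - (η (a j) - c j)‖ ≤ k * (2 * disjointnessError k δ) :=
    (Finset.sum_le_sum fun j _ => hterm j).trans_eq (by simp)
  have hfin : 2 * (δ : ℝ) + k * (2 * disjointnessError k δ) ≤ 3 * k * δ := by
    by_cases h1 : k = 1
    · simp only [disjointnessError, h1]; norm_num; linarith
    · have h2 : (2 : ℝ) ≤ k := by exact_mod_cast (by omega : 2 ≤ k)
      simp only [disjointnessError, h1, if_false]; nlinarith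
  linarith

end Transitivity

/-! ### The Fraïssé property with modulus 3kδ. -/

section Fraisse

variable {E : Type u} [NormedAddCommGroup E] [NormedSpace ℝ E] [Lattice E] [IsOrderedAddMonoid E]
  [HasSolidNorm E] [IsOrderedModule ℝ E]

instance VectorSublattice.instIsOrderedModule (X : VectorSublattice E) :
    IsOrderedModule ℝ X.toSubmodule where
  smul_le_smul_of_nonneg_left r hr x y h := by
    have h' : (x : E) ≤ (y : E) := h
    have := smul_le_smul_of_nonneg_left h' hr
    exact this
  smul_le_smul_of_nonneg_right x hx r s h := by
    have hx' : (0 : E) ≤ (x : E) := hx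
    have := smul_le_smul_of_nonneg_right h hx'
    exact this

theorem isModulus_linear : IsModulus fun k δ => 3 * (k : ℝ≥0) * δ := fun k =>
  ⟨fun _ _ h => mul_le_mul_right h _, by fun_prop, by simp⟩

theorem isFraisseBanachLattice_of_homogeneous (hE : IsAMNorm E) (hH : IsApproxHomogeneous E)
    (he : ∃ e f : E, e ≠ 0 ∧ f ≠ 0 ∧ LatDisjoint e f) :
    IsFraisseBanachLattice E fun k δ => 3 * (k : ℝ≥0) * δ := by
  refine ⟨isModulus_linear, fun X hX δ ε hε => ?_⟩
  have := actsTransitively_isoLat (A := X) hE hH he δ ε hε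
  simpa using this

end Fraisse

/-! ### Passing to a separable homogeneous sublattice; infinite dimension. -/

/-- Closing a countable set under countably many finitary operations keeps it countable. -/
theorem exists_countable_closed {α : Type u} {ι : Type v} [Countable ι]
    (F : ι → (k : ℕ) → (Fin k → α) → (Fin k → α) → α → α) {S : Set α} (hS : S.Countable) :
    ∃ C : Set α, C.Countable ∧ S ⊆ C ∧ ∀ i k b c x, (∀ j, b j ∈ C) → (∀ j, c j ∈ C) → x ∈ C →
      F i k b c x ∈ C := by
  let step : Set α → Set α := fun T => T ∪ ⋃ i : ι, ⋃ k : ℕ,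
    Set.range fun t : (Fin k → T) × (Fin k → T) × T =>
      F i k (fun j => t.1 j) (fun j => t.2.1 j) t.2.2
  let C : ℕ → Set α := fun n => step^[n] S
  have hC : ∀ n, C (n + 1) = step (C n) := fun n => Function.iterate_succ_apply' step n S
  have hmono : Monotone C := monotone_nat_of_le_succ fun n => by
    rw [hC]; exact Set.subset_union_left
  have hcount : ∀ n, (C n).Countable := by
    intro n
    induction n with
    | zero => exact hS
    | succ n ih =>
      rw [hC]
      have : Countable (C n) := ih
      exact ih.union (Set.countable_iUnion fun i => Set.countable_iUnion fun k =>
        Set.countable_range _)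
  have hfin : ∀ (k : ℕ) (b : Fin k → α), (∀ j, b j ∈ ⋃ n, C n) → ∃ n, ∀ j, b j ∈ C n := by
    intro k b hb
    choose n hn using fun j => Set.mem_iUnion.1 (hb j)
    exact ⟨Finset.univ.sup n, fun j => hmono (Finset.le_sup (Finset.mem_univ j)) (hn j)⟩
  refine ⟨⋃ n, C n, Set.countable_iUnion hcount, Set.subset_iUnion C 0,
    fun i k b c x hb hc hx => ?_⟩
  obtain ⟨n₁, h₁⟩ := hfin k b hb
  obtain ⟨n₂, h₂⟩ := hfin k c hc
  obtain ⟨n₃, h₃⟩ := Set.mem_iUnion.1 hx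
  let n := max n₁ (max n₂ n₃)
  refine Set.mem_iUnion.2 ⟨n + 1, ?_⟩
  rw [hC]
  refine Or.inr (Set.mem_iUnion.2 ⟨i, Set.mem_iUnion.2 ⟨k, ?_⟩⟩)
  exact ⟨⟨fun j => ⟨b j, hmono (le_max_left _ _) (h₁ j)⟩,
    fun j => ⟨c j, hmono ((le_max_left _ _).trans (le_max_right _ _)) (h₂ j)⟩,
    ⟨x, hmono ((le_max_right _ _).trans (le_max_right _ _)) h₃⟩⟩, rfl⟩

section SeparableSublattice

variable {E : Type u} [NormedAddCommGroup E] [NormedSpace ℝ E] [Lattice E] [IsOrderedAddMonoid E]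
  [HasSolidNorm E] [IsOrderedModule ℝ E]

/-- A continuous retraction of tuples onto disjoint tuples. -/
def disjointify {k : ℕ} (z : Fin k → E) (j : Fin k) : E :=
  signClip (z j) (|z j| - ∑ i ∈ Finset.univ.erase j, |z i|)⁺

theorem lattice_continuous_abs : Continuous fun x : E => |x| := continuous_id.sup continuous_neg

theorem continuous_disjointify {k : ℕ} : Continuous (disjointify : (Fin k → E) → Fin k → E) := by
  refine continuous_pi fun j => ?_
  have h1 : Continuous fun z : Fin k → E => (|z j| - ∑ i ∈ Finset.univ.erase j, |z i|)⁺ :=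
    continuous_posPart.comp ((lattice_continuous_abs.comp (continuous_apply j)).sub
      (continuous_finsetSum _ fun i _ => lattice_continuous_abs.comp (continuous_apply i)))
  exact ((continuous_posPart.comp (continuous_apply j)).inf h1).sub
    ((continuous_negPart.comp (continuous_apply j)).inf h1)

/-- The i-th entry has modulus at most (|z i| - |z j|)⁺, and exchanging i and j gives a disjoint
positive part. -/
theorem disjointify_disjoint {k : ℕ} (z : Fin k → E) {i j : Fin k} (hij : i ≠ j) :
    LatDisjoint (disjointify z i) (disjointify z j) := by
  have h : ∀ i j, i ≠ j → |disjointify z i| ≤ (|z i| - |z j|)⁺ := fun i j hij => by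
    rw [disjointify, abs_signClip _ (posPart_nonneg _)]
    refine inf_le_right.trans (posPart_mono (sub_le_sub_left ?_ _))
    exact Finset.single_le_sum (f := fun i => |z i|) (fun l _ => abs_nonneg (z l))
      (Finset.mem_erase.2 ⟨hij.symm, Finset.mem_univ j⟩)
  refine le_antisymm ?_ (le_inf (abs_nonneg _) (abs_nonneg _))
  exact (inf_le_inf (h i j hij) (h j i hij.symm)).trans (inf_posPart_sub_posPart_sub _ _).le

theorem disjointify_eq_self {k : ℕ} {b : Fin k → E}
    (hb : ∀ i j, i ≠ j → LatDisjoint (b i) (b j)) : disjointify b = b := by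
  funext j
  have h : LatDisjoint (b j) (∑ i ∈ Finset.univ.erase j, |b i|) :=
    LatDisjoint.sum_right fun i hi =>
      (hb j i (Finset.ne_of_mem_erase hi).symm).mono le_rfl (abs_abs _).le
  have h1 : |b j| ⊓ ∑ i ∈ Finset.univ.erase j, |b i| = 0 := by
    have h2 := h
    unfold LatDisjoint at h2
    rwa [abs_of_nonneg (Finset.sum_nonneg fun i _ => abs_nonneg (b i))] at h2
  rw [disjointify, ← sub_inf_eq_posPart_sub, h1, sub_zero, signClip_abs]

theorem disjointify_mem {k : ℕ} {z : Fin k → E} (C : AddSubgroup E)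
    (hC : ∀ x ∈ C, ∀ y ∈ C, x ⊔ y ∈ C) (hz : ∀ j, z j ∈ C) (j : Fin k) : disjointify z j ∈ C := by
  have hinf : ∀ x ∈ C, ∀ y ∈ C, x ⊓ y ∈ C := fun x hx y hy => by
    have := C.neg_mem (hC _ (C.neg_mem hx) _ (C.neg_mem hy))
    rwa [neg_sup, neg_neg, neg_neg] at this
  have habs : ∀ x ∈ C, |x| ∈ C := fun x hx => hC _ hx _ (C.neg_mem hx)
  have hv : (|z j| - ∑ i ∈ Finset.univ.erase j, |z i|)⁺ ∈ C :=
    hC _ (C.sub_mem (habs _ (hz j)) (C.sum_mem fun i _ => habs _ (hz i))) _ C.zero_mem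
  exact C.sub_mem (hinf _ (hC _ (hz j) _ C.zero_mem) _ hv)
    (hinf _ (hC _ (C.neg_mem (hz j)) _ C.zero_mem) _ hv)

/-- Nearby tuples in C need not be disjoint. Applying `disjointify`, which is continuous, fixes b
and does not leave C, repairs this; for positive b, moduli are taken first. -/
theorem exists_disjoint_approx (C : AddSubgroup E) (hC : ∀ x ∈ C, ∀ y ∈ C, x ⊔ y ∈ C) {k : ℕ}
    (b : Fin k → E) (hbC : ∀ j, b j ∈ closure (C : Set E))
    (hb : ∀ i j, i ≠ j → LatDisjoint (b i) (b j)) {r : ℝ} (hr : 0 < r) :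
    ∃ z : Fin k → E, (∀ j, z j ∈ C) ∧ (∀ i j, i ≠ j → LatDisjoint (z i) (z j)) ∧
      (∀ j, ‖z j - b j‖ < r) ∧ ((∀ j, 0 ≤ b j) → ∀ j, 0 ≤ z j) := by
  have hmem : b ∈ closure (Set.univ.pi fun _ : Fin k => (C : Set E)) := by
    rw [closure_pi_set]; exact fun j _ => hbC j
  have happ : ∀ D : (Fin k → E) → Fin k → E, Continuous D → D b = b →
      ∃ z : Fin k → E, (∀ j, z j ∈ C) ∧ ∀ j, ‖D z j - b j‖ < r := by
    intro D hD hDb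
    have hU : D ⁻¹' Metric.ball b r ∈ 𝓝 b :=
      hD.continuousAt.preimage_mem_nhds (by rw [hDb]; exact Metric.ball_mem_nhds b hr)
    obtain ⟨z, hz, hzC⟩ := mem_closure_iff_nhds.1 hmem _ hU
    refine ⟨z, fun j => hzC j (Set.mem_univ j), fun j => ?_⟩
    rw [← dist_eq_norm]
    exact (dist_le_pi_dist (D z) b j).trans_lt hz
  by_cases hpos : ∀ j, 0 ≤ b j
  · obtain ⟨z, hz, hzb⟩ := happ (fun z => disjointify fun j => |z j|)
      (continuous_disjointify.comp
        (continuous_pi fun j => lattice_continuous_abs.comp (continuous_apply j)))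
      (by
        have : (fun j => |b j|) = b := funext fun j => abs_of_nonneg (hpos j)
        rw [this, disjointify_eq_self hb])
    exact ⟨_, disjointify_mem C hC fun j => hC _ (hz j) _ (C.neg_mem (hz j)),
      fun i j hij => disjointify_disjoint _ hij, hzb,
      fun _ j => signClip_nonneg (abs_nonneg _) (posPart_nonneg _)⟩
  · obtain ⟨z, hz, hzb⟩ := happ disjointify continuous_disjointify (disjointify_eq_self hb)
    exact ⟨_, disjointify_mem C hC hz, fun i j hij => disjointify_disjoint _ hij, hzb,
      fun h => absurd h hpos⟩

/-- The restriction of a surjective isometry to an invariant subspace. -/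
def LinearIsometryEquiv.restrictSubmodule (g : E ≃ₗᵢ[ℝ] E) (G : Submodule ℝ E)
    (h : ∀ x ∈ G, g x ∈ G) (h' : ∀ x ∈ G, g.symm x ∈ G) : G ≃ₗᵢ[ℝ] G where
  toLinearEquiv := LinearEquiv.ofLinearMap
    (g.toLinearEquiv.toLinearMap.restrict h) (g.symm.toLinearEquiv.toLinearMap.restrict h')
    (LinearMap.ext fun x => Subtype.ext (g.apply_symm_apply x))
    (LinearMap.ext fun x => Subtype.ext (g.symm_apply_apply x))
  norm_map' x := g.norm_map x

theorem VectorSublattice.latDisjoint_coe {G : VectorSublattice E} {x y : G} :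
    LatDisjoint (x : E) (y : E) ↔ LatDisjoint x y :=
  ⟨fun h => Subtype.ext h, fun h => congrArg Subtype.val h⟩

theorem IsAMNorm.vectorSublattice (hE : IsAMNorm E) (G : VectorSublattice E) : IsAMNorm G :=
  fun a b ha hb => hE (a : E) (b : E) ha hb

/-- A Löwenheim–Skolem argument. Countably many isometries suffice because disjoint tuples in the
closure of C are limits of disjoint tuples in C. -/
theorem IsApproxHomogeneous.exists_separable (hH : IsApproxHomogeneous E)
    {S : Set E} (hS : S.Countable) (hS0 : S.Nonempty) :
    ∃ G : VectorSublattice E, IsClosed (G.toSubmodule : Set E) ∧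
      TopologicalSpace.SeparableSpace G ∧ S ⊆ G.toSubmodule ∧ IsApproxHomogeneous G := by
  classical
  -- The target is the rescaled tuple, because approximants of tuples with equal norms need not have
  -- equal norms. The identity is the default on inadmissible pairs.
  have hΦ : ∀ (m k : ℕ) (b c : Fin k → E), ∃ g : E ≃ₗᵢ[ℝ] E,
      (∀ i j, i ≠ j → LatDisjoint (b i) (b j)) → (∀ i j, i ≠ j → LatDisjoint (c i) (c j)) →
      (∀ j, b j ≠ 0) → (∀ j, c j ≠ 0) → g ∈ IsoDisj E ∧
        ((∀ j, 0 ≤ b j ∧ 0 ≤ c j) → g ∈ IsoLat E) ∧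
        ∀ j, ‖g (b j) - (‖b j‖ / ‖c j‖) • c j‖ < 1 / ((m : ℝ) + 1) := by
    intro m k b c
    by_cases h : (∀ i j, i ≠ j → LatDisjoint (b i) (b j)) ∧
      (∀ i j, i ≠ j → LatDisjoint (c i) (c j)) ∧ (∀ j, b j ≠ 0) ∧ (∀ j, c j ≠ 0)
    · obtain ⟨hb, hc, hb0, hc0⟩ := h
      obtain ⟨g, hg, hgl, hgb⟩ := hH k b (fun j => (‖b j‖ / ‖c j‖) • c j) hb
        (fun i j hij => ((hc i j hij).smul_right _).smul_left _)
        (fun j => by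
          rw [norm_smul, norm_div, norm_norm, norm_norm,
            div_mul_cancel₀ _ (norm_ne_zero_iff.2 (hc0 j))])
        hb0 (1 / ((m : ℝ) + 1)) (by positivity)
      exact ⟨g, fun _ _ _ _ => ⟨hg, fun h => hgl fun j => ⟨(h j).1,
        smul_nonneg (by positivity) (h j).2⟩, hgb⟩⟩
    · exact ⟨LinearIsometryEquiv.refl ℝ E, fun h1 h2 h3 h4 => absurd ⟨h1, h2, h3, h4⟩ h⟩
  choose Φ hΦ using hΦ
  -- The inverses are among the operations so that each chosen isometry maps the closure onto
  -- itself.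
  let F : Bool ⊕ ℚ ⊕ ℕ ⊕ ℕ → (k : ℕ) → (Fin k → E) → (Fin k → E) → E → E
    | Sum.inl true => fun k b _ x => x + ∑ j, b j
    | Sum.inl false => fun k b _ x => x ⊔ ∑ j, b j
    | Sum.inr (Sum.inl q) => fun _ _ _ x => (q : ℝ) • x
    | Sum.inr (Sum.inr (Sum.inl m)) => fun k b c x => Φ m k b c x
    | Sum.inr (Sum.inr (Sum.inr m)) => fun k b c x => (Φ m k b c).symm x
  obtain ⟨C, hCc, hSC, hC⟩ := exists_countable_closed F hS
  have hadd : ∀ x ∈ C, ∀ y ∈ C, x + y ∈ C := fun x hx y hy => by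
    simpa [F] using hC (Sum.inl true) 1 (fun _ => y) (fun _ => y) x (fun _ => hy) (fun _ => hy) hx
  have hsup : ∀ x ∈ C, ∀ y ∈ C, x ⊔ y ∈ C := fun x hx y hy => by
    simpa [F] using hC (Sum.inl false) 1 (fun _ => y) (fun _ => y) x (fun _ => hy) (fun _ => hy) hx
  have hsmul : ∀ q : ℚ, ∀ x ∈ C, (q : ℝ) • x ∈ C := fun q x hx =>
    hC (Sum.inr (Sum.inl q)) 0 Fin.elim0 Fin.elim0 x (fun j => j.elim0) (fun j => j.elim0) hx
  have hneg : ∀ x ∈ C, -x ∈ C := fun x hx => by simpa using hsmul (-1) x hx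
  have hzero : (0 : E) ∈ C := by
    obtain ⟨x, hx⟩ := hS0
    simpa using hsmul 0 x (hSC hx)
  let K : AddSubgroup E :=
    { carrier := C
      zero_mem' := hzero
      add_mem' := fun hx hy => hadd _ hx _ hy
      neg_mem' := fun hx => hneg _ hx }
  let G : VectorSublattice E :=
    { carrier := closure C
      zero_mem' := subset_closure hzero
      add_mem' := fun hx hy => map_mem_closure₂ continuous_add hx hy hadd
      smul_mem' := fun r x hx => by
        have hr : r ∈ closure (Set.range ((↑) : ℚ → ℝ)) := Rat.denseRange_cast r
        refine map_mem_closure₂ continuous_smul hr hx ?_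
        rintro _ ⟨q, rfl⟩ y hy
        exact hsmul q y hy
      sup_mem' := fun x hx y hy => map_mem_closure₂ continuous_sup hx hy hsup }
  have hGmem : ∀ x, x ∈ G.toSubmodule ↔ x ∈ closure C := fun x => Iff.rfl
  have hsep : TopologicalSpace.IsSeparable (G.toSubmodule : Set E) := hCc.isSeparable.closure
  refine ⟨G, isClosed_closure, hsep.separableSpace, hSC.trans subset_closure, ?_⟩
  intro k b c hb hc hbc hb0 ε hε
  -- The first condition keeps the approximants nonzero. The final error is less than 4r + 1/(m +
  -- 1), which is below ε.
  have hev : ∀ᶠ r in 𝓝[>] (0 : ℝ), (∀ j, r < ‖b j‖) ∧ r < ε / 8 := by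
    refine Filter.Eventually.filter_mono nhdsWithin_le_nhds (Filter.Eventually.and ?_ ?_)
    · exact Filter.eventually_all.2 fun j => eventually_lt_nhds (norm_pos_iff.2 (hb0 j))
    · exact eventually_lt_nhds (by linarith)
  obtain ⟨r, ⟨hrb, hrε⟩, hr⟩ := (hev.and self_mem_nhdsWithin).exists
  have hr : 0 < r := hr
  obtain ⟨m, hm⟩ := exists_nat_one_div_lt (half_pos hε)
  obtain ⟨y, hyC, hyd, hyb, hypos⟩ := exists_disjoint_approx K hsup (fun j => (b j : E))
    (fun j => (b j).2) (fun i j hij => VectorSublattice.latDisjoint_coe.2 (hb i j hij)) hr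
  obtain ⟨z, hzC, hzd, hzc, hzpos⟩ := exists_disjoint_approx K hsup (fun j => (c j : E))
    (fun j => (c j).2) (fun i j hij => VectorSublattice.latDisjoint_coe.2 (hc i j hij)) hr
  have hne : ∀ x y : E, ‖x - y‖ < r → r < ‖y‖ → x ≠ 0 := by
    rintro x y h1 h2 rfl
    rw [zero_sub, norm_neg] at h1; linarith
  have hcb : ∀ j, ‖(c j : E)‖ = ‖(b j : E)‖ := fun j => (hbc j).symm
  have hy0 : ∀ j, y j ≠ 0 := fun j => hne _ _ (hyb j) (hrb j)
  have hz0 : ∀ j, z j ≠ 0 := fun j => hne _ _ (hzc j) (by rw [hcb]; exact hrb j)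
  obtain ⟨hgd, hgl, hgy⟩ := hΦ m k y z hyd hzd hy0 hz0
  set g := Φ m k y z
  have hgG : ∀ x ∈ G.toSubmodule, g x ∈ G.toSubmodule := fun x hx =>
    map_mem_closure g.continuous hx fun w hw =>
      hC (Sum.inr (Sum.inr (Sum.inl m))) k y z w hyC hzC hw
  have hgG' : ∀ x ∈ G.toSubmodule, g.symm x ∈ G.toSubmodule := fun x hx =>
    map_mem_closure g.symm.continuous hx fun w hw =>
      hC (Sum.inr (Sum.inr (Sum.inr m))) k y z w hyC hzC hw
  refine ⟨g.restrictSubmodule G.toSubmodule hgG hgG', fun x w => ?_, fun hpos x w => ?_,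
    fun j => ?_⟩
  · rw [← VectorSublattice.latDisjoint_coe, ← VectorSublattice.latDisjoint_coe]
    exact hgd x w
  · exact Subtype.ext (hgl (fun j => ⟨hypos (fun j => (hpos j).1) j,
      hzpos (fun j => (hpos j).2) j⟩) x w)
  · change ‖g (b j) - (c j : E)‖ < ε
    have h1 : g (b j) - (c j : E) = g (b j - y j) + ((g (y j) - (‖y j‖ / ‖z j‖) • z j) +
        ((‖y j‖ / ‖z j‖ - 1) • z j + (z j - c j))) := by
      rw [map_sub, sub_smul, one_smul]; abel
    have h2 : ‖(‖y j‖ / ‖z j‖ - 1) • z j‖ ≤ 2 * r := by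
      have e : ‖(‖y j‖ / ‖z j‖ - 1) • z j‖ = |‖y j‖ - ‖z j‖| := by
        rw [norm_smul, Real.norm_eq_abs]
        calc _ = |(‖y j‖ / ‖z j‖ - 1) * ‖z j‖| := by rw [abs_mul, abs_norm]
          _ = _ := by rw [sub_mul, one_mul, div_mul_cancel₀ _ (norm_ne_zero_iff.2 (hz0 j))]
      rw [e]
      have h3 := abs_norm_sub_norm_le (y j) (b j : E)
      have h4 := abs_norm_sub_norm_le (z j) (c j : E)
      rw [hcb] at h4
      have h5 := hyb j
      have h6 := hzc j
      rw [abs_le] at *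
      constructor <;> linarith
    rw [h1]
    refine (norm_add_le _ _).trans_lt ?_
    have h3 := (norm_add_le (g (y j) - (‖y j‖ / ‖z j‖) • z j)
      ((‖y j‖ / ‖z j‖ - 1) • z j + (z j - c j))).trans
      (add_le_add le_rfl (norm_add_le ((‖y j‖ / ‖z j‖ - 1) • z j) (z j - (c j : E))))
    rw [g.norm_map, norm_sub_rev]
    linarith [hyb j, hzc j, hgy j]

/-- In finite dimension the unit ball has a finite 1/4-net. A unit vector moved to be almost
disjoint from the sum of the moduli of the net stays far from every point of it. -/
theorem IsApproxHomogeneous.not_finiteDimensional (hH : IsApproxHomogeneous E)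
    (he : ∃ e f : E, e ≠ 0 ∧ f ≠ 0 ∧ LatDisjoint e f) : ¬ FiniteDimensional ℝ E := by
  intro hfd
  have : ProperSpace E := FiniteDimensional.proper ℝ E
  obtain ⟨t, -, htf, ht⟩ := Metric.totallyBounded_iff.1
    (isCompact_closedBall (0 : E) 1).totallyBounded (1 / 4) (by norm_num) |>.imp
      fun t h => (⟨trivial, h.1, h.2⟩ : True ∧ t.Finite ∧ _)
  obtain ⟨e, f, he0, hf0, hef⟩ := he
  let u : E := ‖e‖⁻¹ • |e|
  have hu : 0 ≤ u := smul_nonneg (by positivity) (abs_nonneg _)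
  have hun : ‖u‖ = 1 := by
    rw [norm_smul, norm_inv, norm_norm, norm_abs_eq_norm,
      inv_mul_cancel₀ (norm_ne_zero_iff.2 he0)]
  obtain ⟨g, hg, hgn⟩ := hH.exists_almost_disjoint ⟨e, f, he0, hf0, hef⟩ hu
    (Finset.sum_nonneg fun z _ => abs_nonneg z : 0 ≤ ∑ z ∈ htf.toFinset, |z|)
    (by norm_num : (0 : ℝ) < 1 / 4)
  have hmem : g u ∈ Metric.closedBall (0 : E) 1 := by
    rw [mem_closedBall_zero_iff, g.norm_map, hun]
  obtain ⟨z, hz, hgz⟩ := Set.mem_iUnion₂.1 (ht hmem)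
  rw [Metric.mem_ball, dist_eq_norm] at hgz
  have hgu : 0 ≤ g u := IsoLat.map_nonneg hg hu
  have h1 : ‖g u ⊓ |z|‖ ≤ 1 / 4 := by
    refine (norm_le_norm_of_nonneg_of_le (le_inf hgu (abs_nonneg _))
      (inf_le_inf_left _ ?_)).trans hgn.le
    exact Finset.single_le_sum (f := fun z : E => |z|) (fun l _ => abs_nonneg l)
      (htf.mem_toFinset.2 hz)
  have h2 : ‖g u - g u ⊓ |z|‖ ≤ 1 / 4 := by
    calc ‖g u - g u ⊓ |z|‖ = ‖g u ⊓ |g u| - g u ⊓ |z|‖ := by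
          rw [abs_of_nonneg hgu, inf_idem]
      _ ≤ ‖g u - g u‖ + ‖|g u| - |z|‖ := norm_inf_sub_inf_le_add_norm _ _ _ _
      _ ≤ 1 / 4 := by
        rw [sub_self, norm_zero, zero_add]
        exact (norm_abs_sub_abs _ _).trans hgz.le
  have h3 := norm_add_le (g u - g u ⊓ |z|) (g u ⊓ |z|)
  rw [sub_add_cancel, g.norm_map, hun] at h3
  linarith

end SeparableSublattice

/-! ### Isomorphism of atomless measures on the line. -/

section Quantile

variable (ν : Measure ℝ)

/-- The distribution function of a measure on the line. -/
noncomputable def distFun (t : ℝ) : ℝ := ν.real (Set.Iic t)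

/-- The generalized inverse of the distribution function, on `(0, ν(ℝ))`. -/
noncomputable def quantile (u : ℝ) : ℝ :=
  open scoped Classical in
  if u ∈ Set.Ioo 0 (ν.real Set.univ) then sInf {t | u ≤ distFun ν t} else 0

variable [IsFiniteMeasure ν]

theorem distFun_mono : Monotone (distFun ν) := fun _ _ h =>
  measureReal_mono (Set.Iic_subset_Iic.2 h)

theorem tendsto_distFun_atTop : Tendsto (distFun ν) atTop (𝓝 (ν.real Set.univ)) :=
  (ENNReal.tendsto_toReal (measure_ne_top ν _)).comp (tendsto_measure_Iic_atTop ν)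

theorem tendsto_distFun_atBot : Tendsto (distFun ν) atBot (𝓝 0) := by
  have h1 := (ENNReal.tendsto_toReal (measure_ne_top ν Set.univ)).comp
    (tendsto_measure_Ici_atBot ν)
  have h2 : Tendsto (fun t => ν.real (Set.Ioi t)) atBot (𝓝 (ν.real Set.univ)) := by
    refine tendsto_of_tendsto_of_tendsto_of_le_of_le
      (h1.comp (tendsto_atBot_add_const_right _ 1 tendsto_id)) tendsto_const_nhds
      (fun t => measureReal_mono ?_) (fun t => measureReal_mono (Set.subset_univ _))
    intro x hx
    have hx : t + 1 ≤ x := hx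
    exact Set.mem_Ioi.2 (by linarith)
  have h3 : ∀ t, distFun ν t = ν.real Set.univ - ν.real (Set.Ioi t) := fun t => by
    rw [← Set.compl_Iic, measureReal_compl measurableSet_Iic]; simp [distFun]
  simpa [← h3] using (tendsto_const_nhds (x := ν.real Set.univ)).sub h2

theorem distFun_le (t : ℝ) : distFun ν t ≤ ν.real Set.univ := measureReal_mono (Set.subset_univ _)

variable [NullSingletonClass ν]

theorem continuous_distFun : Continuous (distFun ν) := by
  have h : ∀ b : ℝ, distFun ν b = ∫ _x in Set.Iic b, (1 : ℝ) ∂ν := fun b => by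
    simp [distFun]
  rw [continuous_iff_continuousAt]
  intro t
  have h1 : ContinuousOn (fun b => ∫ _x in Set.Iic b, (1 : ℝ) ∂ν) (Set.Iic (t + 1)) :=
    (integrable_const _).integrableOn.continuousOn_Iic_primitive_Iic
  rw [funext h]
  exact h1.continuousAt (Iic_mem_nhds (by linarith))

variable {ν}

/-- The infimum is attained, the defining set being closed by continuity of the distribution
function. -/
theorem quantile_le_iff {u : ℝ} (hu : u ∈ Set.Ioo 0 (ν.real Set.univ)) {t : ℝ} :
    quantile ν u ≤ t ↔ u ≤ distFun ν t := by
  have hbdd : BddBelow {t | u ≤ distFun ν t} := by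
    obtain ⟨s, hs⟩ := ((tendsto_distFun_atBot ν).eventually_lt_const hu.1).exists
    exact ⟨s, fun t ht => le_of_not_gt fun h => absurd (hs.trans_le ht)
      (not_lt.2 (distFun_mono ν h.le))⟩
  have hne : {t | u ≤ distFun ν t}.Nonempty := by
    obtain ⟨s, hs⟩ := ((tendsto_distFun_atTop ν).eventually_const_lt hu.2).exists
    exact ⟨s, hs.le⟩
  have hcl : IsClosed {t | u ≤ distFun ν t} := isClosed_le continuous_const (continuous_distFun ν)
  rw [quantile, if_pos hu]
  constructor
  · intro h
    exact (hcl.csInf_mem hne hbdd : u ≤ _).trans (distFun_mono ν h)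
  · intro h
    exact csInf_le hbdd h

theorem distFun_quantile {u : ℝ} (hu : u ∈ Set.Ioo 0 (ν.real Set.univ)) :
    distFun ν (quantile ν u) = u := by
  refine le_antisymm ?_ ((quantile_le_iff hu).1 le_rfl)
  obtain ⟨s, hs⟩ := ((tendsto_distFun_atBot ν).eventually_lt_const hu.1).exists
  obtain ⟨s', hs'⟩ := ((tendsto_distFun_atTop ν).eventually_const_lt hu.2).exists
  obtain ⟨t, ht⟩ := mem_range_of_exists_le_of_exists_ge (continuous_distFun ν) ⟨s, hs.le⟩
    ⟨s', hs'.le⟩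
  calc _ ≤ distFun ν t := distFun_mono ν ((quantile_le_iff hu).2 ht.ge)
    _ = u := ht

theorem measurable_distFun : Measurable (distFun ν) := (distFun_mono ν).measurable

theorem measurable_quantile : Measurable (quantile ν) := by
  refine measurable_of_Iic fun t => ?_
  have : quantile ν ⁻¹' Set.Iic t =
      (Set.Ioo 0 (ν.real Set.univ) ∩ Set.Iic (distFun ν t)) ∪
        ((Set.Ioo 0 (ν.real Set.univ))ᶜ ∩ {_u | 0 ≤ t}) := by
    ext u
    by_cases hu : u ∈ Set.Ioo 0 (ν.real Set.univ)
    · simp only [Set.mem_preimage, Set.mem_Iic, quantile_le_iff hu, Set.mem_union, Set.mem_inter_iff,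
        hu, true_and, Set.mem_compl_iff, not_true, false_and, or_false]
    · simp only [Set.mem_preimage, Set.mem_Iic, quantile, Set.mem_union,
        Set.mem_inter_iff, hu, false_and, Set.mem_compl_iff, not_false_iff, true_and, false_or,
        Set.mem_ofPred_eq, if_false]
  rw [this]
  exact (measurableSet_Ioo.inter measurableSet_Iic).union
    (measurableSet_Ioo.compl.inter (MeasurableSet.const _))

theorem map_quantile :
    (volume.restrict (Set.Ioo 0 (ν.real Set.univ))).map (quantile ν) = ν := by
  refine Measure.ext_of_Iic _ _ fun t => ?_
  rw [Measure.map_apply measurable_quantile measurableSet_Iic,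
    Measure.restrict_apply (measurable_quantile measurableSet_Iic)]
  have h1 : quantile ν ⁻¹' Set.Iic t ∩ Set.Ioo 0 (ν.real Set.univ) =
      Set.Ioo 0 (ν.real Set.univ) ∩ Set.Iic (distFun ν t) := by
    ext u
    constructor
    · rintro ⟨h, hu⟩; exact ⟨hu, (quantile_le_iff hu).1 h⟩
    · rintro ⟨hu, h⟩; exact ⟨(quantile_le_iff hu).2 h, hu⟩
  have h2 : volume (Set.Ioo 0 (ν.real Set.univ) ∩ Set.Iic (distFun ν t)) =
      ENNReal.ofReal (distFun ν t) := by
    refine le_antisymm ?_ ?_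
    · calc _ ≤ volume (Set.Ioc 0 (distFun ν t)) :=
            measure_mono fun u hu => ⟨hu.1.1, hu.2⟩
        _ = _ := by rw [Real.volume_Ioc, sub_zero]
    · have h3 : Set.Ioo 0 (distFun ν t) ⊆
          Set.Ioo 0 (ν.real Set.univ) ∩ Set.Iic (distFun ν t) := fun u hu =>
        ⟨⟨hu.1, hu.2.trans_le (distFun_le ν t)⟩, hu.2.le⟩
      have h4 := measure_mono (μ := volume) h3
      rwa [Real.volume_Ioo, sub_zero] at h4
  rw [h1, h2, distFun, ofReal_measureReal]

theorem map_distFun :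
    ν.map (distFun ν) = volume.restrict (Set.Ioo 0 (ν.real Set.univ)) := by
  have h : ((volume.restrict (Set.Ioo 0 (ν.real Set.univ))).map (quantile ν)).map (distFun ν) =
      volume.restrict (Set.Ioo 0 (ν.real Set.univ)) := by
    rw [Measure.map_map measurable_distFun measurable_quantile]
    conv_rhs => rw [← Measure.map_id (μ := volume.restrict (Set.Ioo 0 (ν.real Set.univ)))]
    refine Measure.map_congr ?_
    filter_upwards [ae_restrict_mem measurableSet_Ioo] with u hu
    exact distFun_quantile hu
  rwa [map_quantile] at h

theorem quantile_distFun_ae : ∀ᵐ t ∂ν, quantile ν (distFun ν t) = t := by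
  have hms : MeasurableSet {t | quantile ν (distFun ν t) = t} :=
    measurableSet_eq_fun (measurable_quantile.comp measurable_distFun) measurable_id
  have h : ∀ᵐ t ∂((volume.restrict (Set.Ioo 0 (ν.real Set.univ))).map (quantile ν)),
      quantile ν (distFun ν t) = t := by
    rw [ae_map_iff measurable_quantile.aemeasurable hms]
    filter_upwards [ae_restrict_mem measurableSet_Ioo] with u hu
    rw [distFun_quantile hu]
  rwa [map_quantile] at h

theorem distFun_mem_ae : ∀ᵐ t ∂ν, distFun ν t ∈ Set.Ioo 0 (ν.real Set.univ) := by
  have h : ∀ᵐ u ∂(ν.map (distFun ν)), u ∈ Set.Ioo 0 (ν.real Set.univ) := by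
    rw [map_distFun]; exact ae_restrict_mem measurableSet_Ioo
  exact ae_of_ae_map measurable_distFun.aemeasurable h

/-- Two atomless finite measures on the line of the same mass are isomorphic modulo null sets. -/
theorem exists_measurable_isomorphism (ν ν' : Measure ℝ) [IsFiniteMeasure ν] [IsFiniteMeasure ν']
    [NullSingletonClass ν] [NullSingletonClass ν'] (h : ν.real Set.univ = ν'.real Set.univ) :
    ∃ φ ψ : ℝ → ℝ, Measurable φ ∧ Measurable ψ ∧ ν'.map φ = ν ∧ ν.map ψ = ν' ∧
      (∀ᵐ t ∂ν', ψ (φ t) = t) ∧ ∀ᵐ t ∂ν, φ (ψ t) = t := by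
  -- Each measure is identified with Lebesgue measure on the interval from 0 to the common mass.
  refine ⟨quantile ν ∘ distFun ν', quantile ν' ∘ distFun ν, measurable_quantile.comp
    measurable_distFun, measurable_quantile.comp measurable_distFun, ?_, ?_, ?_, ?_⟩
  · rw [← Measure.map_map measurable_quantile measurable_distFun, map_distFun, ← h, map_quantile]
  · rw [← Measure.map_map measurable_quantile measurable_distFun, map_distFun, h, map_quantile]
  · filter_upwards [quantile_distFun_ae (ν := ν'), distFun_mem_ae (ν := ν')] with t ht hm
    rw [← h] at hm
    simp only [Function.comp_apply]
    rw [distFun_quantile hm, ht]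
  · filter_upwards [quantile_distFun_ae (ν := ν), distFun_mem_ae (ν := ν)] with t ht hm
    rw [h] at hm
    simp only [Function.comp_apply]
    rw [distFun_quantile hm, ht]

end Quantile

/-- The isomorphism of atomless measures can be chosen to respect given finite partitions. -/
theorem exists_measurable_isomorphism_of_partition (ν ν' : Measure ℝ) [IsFiniteMeasure ν]
    [IsFiniteMeasure ν'] [NullSingletonClass ν] [NullSingletonClass ν'] {k : ℕ}
    {κ κ' : ℝ → Fin k} (hκ : Measurable κ) (hκ' : Measurable κ')
    (h : ∀ j, ν (κ ⁻¹' {j}) = ν' (κ' ⁻¹' {j})) :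
    ∃ φ ψ : ℝ → ℝ, Measurable φ ∧ Measurable ψ ∧ ν'.map φ = ν ∧ ν.map ψ = ν' ∧
      (∀ᵐ t ∂ν', ψ (φ t) = t) ∧ (∀ᵐ t ∂ν, φ (ψ t) = t) ∧ (∀ᵐ t ∂ν', κ (φ t) = κ' t) ∧
      ∀ᵐ t ∂ν, κ' (ψ t) = κ t := by
  have hm : ∀ j, MeasurableSet (κ ⁻¹' {j}) := fun j => hκ (measurableSet_singleton j)
  have hm' : ∀ j, MeasurableSet (κ' ⁻¹' {j}) := fun j => hκ' (measurableSet_singleton j)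
  have hiso := fun j => exists_measurable_isomorphism (ν.restrict (κ ⁻¹' {j}))
    (ν'.restrict (κ' ⁻¹' {j})) (by simp [Measure.real, h j])
  choose φ ψ hφ hψ hmapφ hmapψ hψφ hφψ using hiso
  -- Gluing in one direction: t is moved by the map of the piece containing it. The claim is general
  -- so that it applies again with the roles of the two measures exchanged.
  have key : ∀ (ν ν' : Measure ℝ) (κ κ' : ℝ → Fin k), Measurable κ → Measurable κ' →
      ∀ (φ ψ : Fin k → ℝ → ℝ), (∀ j, Measurable (φ j)) → (∀ j, Measurable (ψ j)) →
      (∀ j, (ν'.restrict (κ' ⁻¹' {j})).map (φ j) = ν.restrict (κ ⁻¹' {j})) →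
      (∀ j, ∀ᵐ t ∂(ν'.restrict (κ' ⁻¹' {j})), ψ j (φ j t) = t) →
      Measurable (fun t => φ (κ' t) t) ∧ ν'.map (fun t => φ (κ' t) t) = ν ∧
      (∀ᵐ t ∂ν', ψ (κ (φ (κ' t) t)) (φ (κ' t) t) = t) ∧ ∀ᵐ t ∂ν', κ (φ (κ' t) t) = κ' t := by
    intro ν ν' κ κ' hκ hκ' φ ψ hφ hψ hmap hψφ
    have hm : ∀ j, MeasurableSet (κ ⁻¹' {j}) := fun j => hκ (measurableSet_singleton j)
    have hm' : ∀ j, MeasurableSet (κ' ⁻¹' {j}) := fun j => hκ' (measurableSet_singleton j)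
    have hmeas : Measurable fun t => φ (κ' t) t :=
      (measurable_from_prod_countable_right (f := fun x : Fin k × ℝ => φ x.1 x.2) hφ).comp
        (hκ'.prodMk measurable_id)
    have hsum : ∀ (ρ : Measure ℝ) (θ : ℝ → Fin k), Measurable θ → ∀ s, MeasurableSet s →
        ρ s = ∑ j, ρ.restrict (θ ⁻¹' {j}) s := by
      intro ρ θ hθ s hs
      have e : s = ⋃ j : Fin k, s ∩ θ ⁻¹' {j} := by
        ext t; simp
      conv_lhs => rw [e]
      rw [measure_iUnion ?_ fun j => hs.inter (hθ (measurableSet_singleton j)), tsum_fintype]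
      · exact Finset.sum_congr rfl fun j _ => (Measure.restrict_apply hs).symm
      · intro i j hij
        refine Set.disjoint_left.2 fun t h1 h2 => hij ?_
        exact (h1.2 : θ t = i).symm.trans h2.2
    have hae : ∀ {P : ℝ → Prop}, (∀ j, ∀ᵐ t ∂(ν'.restrict (κ' ⁻¹' {j})), P t) → ∀ᵐ t ∂ν', P t := by
      intro P hP
      have h1 : ∀ᵐ t ∂(ν'.restrict (⋃ j, κ' ⁻¹' {j})), P t := (ae_restrict_iUnion_iff _ _).2 hP
      have e : (⋃ j, κ' ⁻¹' {j}) = (Set.univ : Set ℝ) := by ext t; simp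
      rwa [e, Measure.restrict_univ] at h1
    have hκφ : ∀ j, ∀ᵐ t ∂(ν'.restrict (κ' ⁻¹' {j})), κ (φ j t) = j := fun j => by
      have : ∀ᵐ t ∂((ν'.restrict (κ' ⁻¹' {j})).map (φ j)), κ t = j := by
        rw [hmap]; exact ae_restrict_mem (hm j)
      exact ae_of_ae_map (hφ j).aemeasurable this
    refine ⟨hmeas, ?_, hae fun j => ?_, hae fun j => ?_⟩
    · ext s hs
      rw [Measure.map_apply hmeas hs, hsum ν' κ' hκ' _ (hmeas hs), hsum ν κ hκ s hs]
      refine Finset.sum_congr rfl fun j _ => ?_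
      rw [← hmap j, Measure.map_apply (hφ j) hs]
      refine measure_congr ?_
      filter_upwards [ae_restrict_mem (hm' j)] with t ht
      have ht : κ' t = j := ht
      refine propext ?_
      change φ (κ' t) t ∈ s ↔ φ j t ∈ s
      rw [ht]
    · filter_upwards [ae_restrict_mem (hm' j), hκφ j, hψφ j] with t ht h1 h2
      have ht : κ' t = j := ht
      rw [ht, h1, h2]
    · filter_upwards [ae_restrict_mem (hm' j), hκφ j] with t ht h1
      have ht : κ' t = j := ht
      rw [ht, h1]
  obtain ⟨h1, h2, h3, h4⟩ := key ν ν' κ κ' hκ hκ' φ ψ hφ hψ hmapφ hψφ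
  obtain ⟨h1', h2', h3', h4'⟩ := key ν' ν κ' κ hκ' hκ ψ φ hψ hφ hmapψ hφψ
  exact ⟨_, _, h1, h1', h2, h2', h3, h3', h4, h4'⟩

/-! ### Weighted composition operators as isometries of L_p. -/

section WeightedComposition

variable {α : Type*} {mα : MeasurableSpace α} {μ : Measure α} {p : ℝ≥0∞}

/-- The measure `|w|^p dμ`. -/
noncomputable def weightMeasure (μ : Measure α) (p : ℝ≥0∞) (w : α → ℝ) : Measure α :=
  μ.withDensity fun t => ‖w t‖ₑ ^ p.toReal

theorem weightMeasure_abs (w : α → ℝ) :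
    weightMeasure μ p (fun t => |w t|) = weightMeasure μ p w := by
  unfold weightMeasure
  congr 1
  funext t
  rw [Real.enorm_abs]

theorem measurable_weight {w : α → ℝ} (hw : Measurable w) :
    Measurable fun t => ‖w t‖ₑ ^ p.toReal := hw.enorm.pow_const _

/-- As w' never vanishes, μ and the weighted measure have the same null sets. This makes composition
with φ well defined on classes of functions. -/
theorem quasiMeasurePreserving_of_map_weight {φ : α → α} {w w' : α → ℝ} (hφ : Measurable φ)
    (hw' : Measurable w') (hw'0 : ∀ t, w' t ≠ 0)
    (hmap : (weightMeasure μ p w').map φ = weightMeasure μ p w) :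
    Measure.QuasiMeasurePreserving φ μ μ := by
  have h1 : μ ≪ weightMeasure μ p w' :=
    withDensity_absolutelyContinuous' (measurable_weight hw').aemeasurable
      (Eventually.of_forall fun t => by
        have : ‖w' t‖ₑ ≠ 0 := enorm_ne_zero.2 (hw'0 t)
        simp [ENNReal.rpow_eq_zero_iff, this])
  refine ⟨hφ, (h1.map hφ).trans ?_⟩
  rw [hmap]
  exact withDensity_absolutelyContinuous _ _

/-- Change of variables: absorb |w'|^p into the measure, push forward along φ, and cancel |w|^p. -/
theorem eLpNorm_weightedComp (hp0 : p ≠ 0) (hp : p ≠ ∞) {φ : α → α} {w w' : α → ℝ}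
    (hφ : Measurable φ) (hw : Measurable w) (hw' : Measurable w') (hw0 : ∀ t, w t ≠ 0)
    (hmap : (weightMeasure μ p w').map φ = weightMeasure μ p w) {f : α → ℝ} (hf : Measurable f) :
    eLpNorm (fun t => w' t * (f (φ t) / w (φ t))) p μ = eLpNorm f p μ := by
  have hq : 0 ≤ p.toReal := ENNReal.toReal_nonneg
  have hh : Measurable fun t => ‖f t / w t‖ₑ ^ p.toReal := (hf.div hw).enorm.pow_const _
  have key : ∫⁻ t, ‖w' t * (f (φ t) / w (φ t))‖ₑ ^ p.toReal ∂μ = ∫⁻ t, ‖f t‖ₑ ^ p.toReal ∂μ := by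
    calc ∫⁻ t, ‖w' t * (f (φ t) / w (φ t))‖ₑ ^ p.toReal ∂μ
        = ∫⁻ t, ((fun t => ‖w' t‖ₑ ^ p.toReal) * fun t => ‖f (φ t) / w (φ t)‖ₑ ^ p.toReal) t ∂μ := by
          refine lintegral_congr fun t => ?_
          rw [enorm_mul, ENNReal.mul_rpow_of_nonneg _ _ hq]; rfl
      _ = ∫⁻ t, ‖f (φ t) / w (φ t)‖ₑ ^ p.toReal ∂(weightMeasure μ p w') :=
          (lintegral_withDensity_eq_lintegral_mul _ (measurable_weight hw') (hh.comp hφ)).symm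
      _ = ∫⁻ t, ‖f t / w t‖ₑ ^ p.toReal ∂(weightMeasure μ p w) := by
          rw [← hmap, lintegral_map hh hφ]
      _ = ∫⁻ t, ((fun t => ‖w t‖ₑ ^ p.toReal) * fun t => ‖f t / w t‖ₑ ^ p.toReal) t ∂μ :=
          lintegral_withDensity_eq_lintegral_mul _ (measurable_weight hw) hh
      _ = _ := by
          refine lintegral_congr fun t => ?_
          rw [Pi.mul_apply, ← ENNReal.mul_rpow_of_nonneg _ _ hq, ← enorm_mul,
            mul_div_cancel₀ _ (hw0 t)]
  rw [eLpNorm_eq_lintegral_rpow_enorm_toReal hp0 hp, eLpNorm_eq_lintegral_rpow_enorm_toReal hp0 hp,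
    key]

/-- Weighted composition operators between weights matched by `φ` are isometric. -/
theorem exists_weightedComp [Fact (1 ≤ p)] (hp : p ≠ ∞) {φ : α → α} {w w' : α → ℝ}
    (hφ : Measurable φ) (hw : Measurable w) (hw' : Measurable w') (hw0 : ∀ t, w t ≠ 0)
    (hw'0 : ∀ t, w' t ≠ 0)
    (hmap : (weightMeasure μ p w').map φ = weightMeasure μ p w) :
    ∃ T : Lp ℝ p μ →ₗᵢ[ℝ] Lp ℝ p μ, ∀ f, T f =ᵐ[μ] fun t => w' t * (f (φ t) / w (φ t)) := by
  have hp0 : p ≠ 0 := (zero_lt_one.trans_le (Fact.out : 1 ≤ p)).ne'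
  have hq := quasiMeasurePreserving_of_map_weight hφ hw' hw'0 hmap
  have hfm : ∀ f : Lp ℝ p μ, Measurable f := fun f => (Lp.stronglyMeasurable f).measurable
  have hmem : ∀ f : Lp ℝ p μ, MemLp (fun t => w' t * (f (φ t) / w (φ t))) p μ := fun f =>
    ⟨(hw'.mul (((hfm f).comp hφ).div (hw.comp hφ))).aestronglyMeasurable, by
      rw [eLpNorm_weightedComp hp0 hp hφ hw hw' hw0 hmap (hfm f)]; exact (Lp.memLp f).2⟩
  refine ⟨⟨⟨⟨fun f => (hmem f).toLp _, fun f g => ?_⟩, fun c f => ?_⟩, fun f => ?_⟩,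
    fun f => (hmem f).coeFn_toLp⟩
  · refine Lp.ext ?_
    filter_upwards [(hmem (f + g)).coeFn_toLp, Lp.coeFn_add ((hmem f).toLp _) ((hmem g).toLp _),
      (hmem f).coeFn_toLp, (hmem g).coeFn_toLp, hq.ae (Lp.coeFn_add f g)] with t h1 h2 h3 h4 h5
    rw [h1, h2, Pi.add_apply, h3, h4, h5, Pi.add_apply]; ring
  · refine Lp.ext ?_
    filter_upwards [(hmem (c • f)).coeFn_toLp, Lp.coeFn_smul c ((hmem f).toLp _),
      (hmem f).coeFn_toLp, hq.ae (Lp.coeFn_smul c f)] with t h1 h2 h3 h5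
    rw [RingHom.id_apply]
    change ((hmem (c • f)).toLp _) t = (c • (hmem f).toLp _ : Lp ℝ p μ) t
    rw [h1, h2, Pi.smul_apply, h3, h5, Pi.smul_apply, smul_eq_mul, smul_eq_mul]; ring
  · change ‖(hmem f).toLp _‖ = ‖f‖
    rw [Lp.norm_toLp, eLpNorm_weightedComp hp0 hp hφ hw hw' hw0 hmap (hfm f), Lp.norm_def]

/-- An isometry is injective, so only surjectivity is at stake; the weighted composition with ψ
supplies preimages. -/
theorem exists_weightedCompEquiv [Fact (1 ≤ p)] (hp : p ≠ ∞) {φ ψ : α → α} {w w' : α → ℝ}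
    (hφ : Measurable φ) (hψ : Measurable ψ) (hw : Measurable w) (hw' : Measurable w')
    (hw0 : ∀ t, w t ≠ 0) (hw'0 : ∀ t, w' t ≠ 0)
    (hmap : (weightMeasure μ p w').map φ = weightMeasure μ p w)
    (hmap' : (weightMeasure μ p w).map ψ = weightMeasure μ p w')
    (hψφ : ∀ᵐ t ∂μ, ψ (φ t) = t) :
    ∃ T : Lp ℝ p μ ≃ₗᵢ[ℝ] Lp ℝ p μ, ∀ f, T f =ᵐ[μ] fun t => w' t * (f (φ t) / w (φ t)) := by
  obtain ⟨T, hT⟩ := exists_weightedComp hp hφ hw hw' hw0 hw'0 hmap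
  obtain ⟨S, hS⟩ := exists_weightedComp hp hψ hw' hw hw'0 hw0 hmap'
  have hq := quasiMeasurePreserving_of_map_weight hφ hw' hw'0 hmap
  refine ⟨LinearIsometryEquiv.ofSurjective T fun f => ⟨S f, Lp.ext ?_⟩, hT⟩
  filter_upwards [hT (S f), hq.ae (hS f), hψφ] with t h1 h2 h3
  rw [h1, h2, h3]
  have := hw0 (φ t)
  have := hw'0 t
  field_simp

end WeightedComposition

/-! ### Almost disjoint tuples as pieces of one function. -/

section LpModel

/-- Measurable selection from a finite measurable cover. -/
theorem exists_measurable_selection {α : Type*} [MeasurableSpace α] {k : ℕ} (s : Fin k → Set α)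
    (hs : ∀ j, MeasurableSet (s j)) (hcov : ∀ t, ∃ j, t ∈ s j) :
    ∃ κ : α → Fin k, Measurable κ ∧ ∀ t, t ∈ s (κ t) := by
  classical
  have hp : ∀ t, ∃ n, ∃ h : n < k, t ∈ s ⟨n, h⟩ := fun t => by
    obtain ⟨j, hj⟩ := hcov t
    exact ⟨j, j.2, hj⟩
  have hm : Measurable fun t => Nat.find (hp t) := by
    refine measurable_find hp fun n => ?_
    by_cases h : n < k
    · simpa [h] using hs ⟨n, h⟩
    · simp [h]
  refine ⟨fun t => ⟨Nat.find (hp t), (Nat.find_spec (hp t)).1⟩, ?_,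
    fun t => (Nat.find_spec (hp t)).2⟩
  refine measurable_to_countable' fun j => ?_
  have : (fun t => (⟨Nat.find (hp t), (Nat.find_spec (hp t)).1⟩ : Fin k)) ⁻¹' {j} =
      (fun t => Nat.find (hp t)) ⁻¹' {(j : ℕ)} := by
    ext t; simp [Fin.ext_iff]
  rw [this]
  exact hm (measurableSet_singleton _)

variable {α : Type*} {mα : MeasurableSpace α} {μ : Measure α} {p : ℝ≥0∞} [Fact (1 ≤ p)]

/-- How far a tuple is from being disjoint at index `j`. -/
noncomputable def overlap {E : Type*} [NormedAddCommGroup E] [Lattice E] {k : ℕ} (x : Fin k → E)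
    (j : Fin k) : ℝ :=
  ∑ i ∈ Finset.univ.erase j, ‖|x i| ⊓ |x j|‖

theorem Lp_coeFn_sum {ι : Type*} (s : Finset ι) (f : ι → Lp ℝ p μ) :
    ⇑(∑ i ∈ s, f i) =ᵐ[μ] fun t => ∑ i ∈ s, f i t := by
  classical
  induction s using Finset.induction_on with
  | empty =>
    simp only [Finset.sum_empty]
    exact Lp.coeFn_zero ℝ p μ
  | insert a s ha ih =>
    rw [Finset.sum_insert ha]
    filter_upwards [Lp.coeFn_add (f a) (∑ i ∈ s, f i), ih] with t h1 h2
    rw [h1, Pi.add_apply, h2, Finset.sum_insert ha]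

/-- A tuple in `L_p` is approximated by the pieces of one nonvanishing function over a measurable
partition. -/
theorem exists_partition_approx [IsProbabilityMeasure μ] {k : ℕ} [NeZero k] (x : Fin k → Lp ℝ p μ)
    {ε : ℝ} (hε : 0 < ε) :
    ∃ (κ : α → Fin k) (w : α → ℝ) (hκ : Measurable κ) (hw : MemLp w p μ), Measurable w ∧
      (∀ t, w t ≠ 0) ∧ ((∀ j, 0 ≤ x j) → ∀ᵐ t ∂μ, 0 < w t) ∧
      ∀ j, ‖(hw.indicator (hκ (measurableSet_singleton j))).toLp _ - x j‖ ≤ ε + overlap x j := by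
  have hxm : ∀ j, Measurable (x j) := fun j => (Lp.stronglyMeasurable (x j)).measurable
  -- The index κ t is one at which |x j t| is largest.
  obtain ⟨κ, hκ, hκx⟩ := exists_measurable_selection
    (fun j => {t | ∀ i, |x i t| ≤ |x j t|})
    (fun j => by
      have : {t | ∀ i, |x i t| ≤ |x j t|} = ⋂ i, {t | |x i t| ≤ |x j t|} := by
        ext t; simp
      rw [this]
      exact MeasurableSet.iInter fun i => measurableSet_le (hxm i).abs (hxm j).abs)
    (fun t => by
      obtain ⟨j, -, hj⟩ := Finset.exists_max_image Finset.univ (fun j => |x j t|)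
        ⟨0, Finset.mem_univ _⟩
      exact ⟨j, fun i => hj i (Finset.mem_univ i)⟩)
  let y : α → ℝ := fun t => x (κ t) t
  have hy : Measurable y :=
    (measurable_from_prod_countable_right (f := fun q : Fin k × α => x q.1 q.2) hxm).comp
      (hκ.prodMk measurable_id)
  -- Pushing y away from 0 by ε makes w nonvanishing, and positive wherever y is nonnegative.
  let w : α → ℝ := fun t => y t + if 0 ≤ y t then ε else -ε
  have hwm : Measurable w :=
    hy.add (Measurable.ite (measurableSet_le measurable_const hy) measurable_const measurable_const)
  have habs : ∀ t, |if 0 ≤ y t then ε else -ε| = ε := fun t => by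
    split_ifs <;> simp [abs_of_pos hε]
  have hw0 : ∀ t, w t ≠ 0 := fun t => by
    simp only [w]
    split_ifs with h
    · linarith
    · push Not at h; linarith
  have hwbound : ∀ t, ‖w t‖ ≤ ∑ j, |x j t| + ε := fun t => by
    rw [Real.norm_eq_abs]
    refine (abs_add_le _ _).trans (add_le_add ?_ (habs t).le)
    exact Finset.single_le_sum (f := fun j => |x j t|) (fun j _ => abs_nonneg _)
      (Finset.mem_univ (κ t))
  have hw : MemLp w p μ := by
    refine MemLp.mono' (g := fun t => ∑ j, |x j t| + ε) ?_ hwm.aestronglyMeasurable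
      (Eventually.of_forall hwbound)
    exact (memLp_finsetSum _ fun j _ => (Lp.memLp (x j)).abs).add (memLp_const ε)
  refine ⟨κ, w, hκ, hw, hwm, hw0, fun hpos => ?_, fun j => ?_⟩
  · have h1 : ∀ᵐ t ∂μ, ∀ j, 0 ≤ x j t := by
      rw [ae_all_iff]
      exact fun j => (Lp.coeFn_nonneg (x j)).2 (hpos j)
    filter_upwards [h1] with t ht
    have h2 : 0 ≤ y t := ht (κ t)
    simp only [w, if_pos h2]; linarith
  · let c : Lp ℝ p μ := (memLp_const ε).toLp _
    have hc : ‖c‖ ≤ ε := by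
      have := Lp.norm_le_of_ae_bound (f := c) hε.le (by
        filter_upwards [(memLp_const (μ := μ) (p := p) ε).coeFn_toLp] with t ht
        rw [ht, Real.norm_of_nonneg hε.le])
      simpa [measureUnivNNReal] using this
    have hle : ‖(hw.indicator (hκ (measurableSet_singleton j))).toLp _ - x j‖ ≤
        ‖c + ∑ i ∈ Finset.univ.erase j, |x i| ⊓ |x j|‖ := by
      refine Lp.norm_le_norm_of_ae_le ?_
      have h1 : ∀ᵐ t ∂μ, ∀ i, (|x i| ⊓ |x j| : Lp ℝ p μ) t = |x i t| ⊓ |x j t| := by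
        rw [ae_all_iff]
        intro i
        filter_upwards [Lp.coeFn_inf |x i| |x j|, Lp.coeFn_abs (x i), Lp.coeFn_abs (x j)]
          with t h1 h2 h3
        rw [h1, Pi.inf_apply, h2, h3]
      filter_upwards [Lp.coeFn_sub ((hw.indicator (hκ (measurableSet_singleton j))).toLp _) (x j),
        (hw.indicator (hκ (measurableSet_singleton j))).coeFn_toLp,
        Lp.coeFn_add c (∑ i ∈ Finset.univ.erase j, |x i| ⊓ |x j|),
        (memLp_const (μ := μ) (p := p) ε).coeFn_toLp, Lp_coeFn_sum (Finset.univ.erase j)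
          fun i => |x i| ⊓ |x j|, h1] with t h2 h3 h4 h5 h6 h7
      rw [h2, Pi.sub_apply, h3, h4, Pi.add_apply, h5, h6]
      simp only [h7]
      have hs : 0 ≤ ∑ i ∈ Finset.univ.erase j, |x i t| ⊓ |x j t| :=
        Finset.sum_nonneg fun i _ => le_inf (abs_nonneg _) (abs_nonneg _)
      rw [Real.norm_eq_abs, Real.norm_of_nonneg (by linarith)]
      by_cases hj : κ t = j
      · rw [Set.indicator_of_mem (show t ∈ κ ⁻¹' {j} from hj)]
        have e : w t - x j t = if 0 ≤ y t then ε else -ε := by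
          simp only [w, y, hj]; ring
        rw [e, habs]; linarith
      · rw [Set.indicator_of_notMem (show t ∉ κ ⁻¹' {j} from hj), zero_sub, abs_neg]
        -- Off the j-th piece, |x j| is its own meet with a larger entry, hence one term of the
        -- overlap.
        have h8 : |x j t| = |x (κ t) t| ⊓ |x j t| := (inf_eq_right.2 (hκx t j)).symm
        have h9 := Finset.single_le_sum (s := Finset.univ.erase j)
          (f := fun i => |x i t| ⊓ |x j t|) (fun i _ => le_inf (abs_nonneg _) (abs_nonneg _))
          (Finset.mem_erase.2 ⟨hj, Finset.mem_univ (κ t)⟩)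
        rw [← h8] at h9
        linarith
    exact hle.trans ((norm_add_le _ _).trans (add_le_add hc (norm_sum_le _ _)))

end LpModel

/-! ### Approximate homogeneity of L_p. -/

section LpIsometries

variable {μ : Measure ℝ} {p : ℝ≥0∞} [Fact (1 ≤ p)]

theorem weightMeasure_apply_eq_eLpNorm (hp : p ≠ ∞) (w : ℝ → ℝ) {s : Set ℝ}
    (hs : MeasurableSet s) :
    weightMeasure μ p w s = eLpNorm (s.indicator w) p μ ^ p.toReal := by
  have hp0 : p ≠ 0 := (zero_lt_one.trans_le (Fact.out : 1 ≤ p)).ne'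
  have hq : 0 < p.toReal := ENNReal.toReal_pos hp0 hp
  rw [eLpNorm_indicator_eq_eLpNorm_restrict hs, eLpNorm_eq_lintegral_rpow_enorm_toReal hp0 hp,
    ← ENNReal.rpow_mul, one_div, inv_mul_cancel₀ hq.ne', ENNReal.rpow_one, weightMeasure,
    withDensity_apply _ hs]

/-- Approximate homogeneity of `L_p` for tuples that are almost disjoint. -/
theorem Lp_exists_isometry [IsProbabilityMeasure μ] [NullSingletonClass μ] (hp : p ≠ ∞) {k : ℕ}
    [NeZero k] (x y : Fin k → Lp ℝ p μ) {ε : ℝ} (hε : 0 < ε)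
    (hx : ∀ j, ε + overlap x j < ‖x j‖) (hy : ∀ j, ε + overlap y j < ‖y j‖) :
    ∃ g T : Lp ℝ p μ ≃ₗᵢ[ℝ] Lp ℝ p μ, T ∈ IsoLat (Lp ℝ p μ) ∧ (∀ f, |g f| = T |f|) ∧
      ((∀ j, 0 ≤ x j ∧ 0 ≤ y j) → g = T) ∧
      ∀ j, ‖g (x j) - y j‖ ≤
        2 * ((ε + overlap x j) + (ε + overlap y j)) + |‖x j‖ - ‖y j‖| := by
  obtain ⟨κ, w, hκ, hw, hwm, hw0, hwpos, hwx⟩ := exists_partition_approx x hε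
  obtain ⟨κ', w', hκ', hw', hwm', hw0', hwpos', hwy⟩ := exists_partition_approx y hε
  have hms : ∀ j, MeasurableSet (κ ⁻¹' {j}) := fun j => hκ (measurableSet_singleton j)
  have hms' : ∀ j, MeasurableSet (κ' ⁻¹' {j}) := fun j => hκ' (measurableSet_singleton j)
  set X : Fin k → Lp ℝ p μ := fun j => (hw.indicator (hms j)).toLp _ with hX
  set Y : Fin k → Lp ℝ p μ := fun j => (hw'.indicator (hms' j)).toLp _ with hY
  have hXpos : ∀ j, 0 < ‖X j‖ := fun j => by
    have h1 := norm_sub_norm_le (x j) (X j)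
    rw [norm_sub_rev] at h1
    linarith [hx j, hwx j]
  have hYpos : ∀ j, 0 < ‖Y j‖ := fun j => by
    have h1 := norm_sub_norm_le (y j) (Y j)
    rw [norm_sub_rev] at h1
    linarith [hy j, hwy j]
  -- Rescaling piece by piece gives corresponding pieces of w and v equal norms, hence equal masses
  -- for the weighted measures.
  let c : Fin k → ℝ := fun j => ‖X j‖ / ‖Y j‖
  have hc : ∀ j, 0 < c j := fun j => div_pos (hXpos j) (hYpos j)
  let v : ℝ → ℝ := fun t => c (κ' t) * w' t
  have hcm : Measurable fun t => c (κ' t) := (measurable_from_top (f := c)).comp hκ'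
  have hvm : Measurable v := hcm.mul hwm'
  have hv0 : ∀ t, v t ≠ 0 := fun t => mul_ne_zero (hc _).ne' (hw0' t)
  have hvind : ∀ j, (κ' ⁻¹' {j}).indicator v = c j • (κ' ⁻¹' {j}).indicator w' := fun j => by
    funext t
    by_cases ht : κ' t = j
    · have ht' : t ∈ κ' ⁻¹' {j} := ht
      rw [Pi.smul_apply, Set.indicator_of_mem ht', Set.indicator_of_mem ht', smul_eq_mul]
      simp only [v, ht]
    · have ht' : t ∉ κ' ⁻¹' {j} := ht
      rw [Pi.smul_apply, Set.indicator_of_notMem ht', Set.indicator_of_notMem ht', smul_zero]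
  have hnorm : ∀ j, eLpNorm ((κ ⁻¹' {j}).indicator w) p μ =
      eLpNorm ((κ' ⁻¹' {j}).indicator v) p μ := fun j => by
    have h1 : ‖X j‖ = c j * ‖Y j‖ := (div_mul_cancel₀ _ (hYpos j).ne').symm
    rw [Lp.norm_toLp, Lp.norm_toLp] at h1
    rw [hvind, eLpNorm_const_smul, ← ENNReal.toReal_eq_toReal_iff' (hw.indicator (hms j)).2.ne
      (ENNReal.mul_ne_top enorm_ne_top (hw'.indicator (hms' j)).2.ne), ENNReal.toReal_mul, h1,
      toReal_enorm, Real.norm_of_nonneg (hc j).le]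
  have hvmem : MemLp v p μ := by
    refine MemLp.mono' (g := fun t => (∑ j, c j) * |w' t|) ?_ hvm.aestronglyMeasurable
      (Eventually.of_forall fun t => ?_)
    · exact hw'.abs.const_mul _
    · rw [Real.norm_eq_abs, abs_mul, abs_of_pos (hc _)]
      exact mul_le_mul_of_nonneg_right (Finset.single_le_sum (f := c) (fun j _ => (hc j).le)
        (Finset.mem_univ _)) (abs_nonneg _)
  have hfin : ∀ u : ℝ → ℝ, MemLp u p μ → IsFiniteMeasure (weightMeasure μ p u) := fun u hu => by
    refine ⟨?_⟩
    rw [weightMeasure_apply_eq_eLpNorm hp u MeasurableSet.univ, Set.indicator_univ]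
    exact ENNReal.rpow_lt_top_of_nonneg ENNReal.toReal_nonneg hu.2.ne
  have := hfin w hw
  have := hfin v hvmem
  have : NullSingletonClass (weightMeasure μ p w) := nullSingletonClass_withDensity _
  have : NullSingletonClass (weightMeasure μ p v) := nullSingletonClass_withDensity _
  obtain ⟨φ, ψ, hφ, hψ, hmap, hmap', hψφ, -, hκφ, -⟩ :=
    exists_measurable_isomorphism_of_partition (weightMeasure μ p w) (weightMeasure μ p v) hκ hκ'
      fun j => by
        rw [weightMeasure_apply_eq_eLpNorm hp _ (hms j),
          weightMeasure_apply_eq_eLpNorm hp _ (hms' j), hnorm]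
  have hq := quasiMeasurePreserving_of_map_weight hφ hvm hv0 hmap
  have hac : μ ≪ weightMeasure μ p v :=
    withDensity_absolutelyContinuous' (measurable_weight hvm).aemeasurable
      (Eventually.of_forall fun t => by
        have : ‖v t‖ₑ ≠ 0 := enorm_ne_zero.2 (hv0 t)
        simp [ENNReal.rpow_eq_zero_iff, this])
  have hψφ := hac.ae_le hψφ
  have hκφ := hac.ae_le hκφ
  obtain ⟨g, hg⟩ := exists_weightedCompEquiv hp hφ hψ hwm hvm hw0 hv0 hmap hmap' hψφ
  -- The same φ with weights |w| and |v| gives the positive operator T governing the moduli of g;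
  -- the two coincide when the weights are positive.
  obtain ⟨T, hT⟩ := exists_weightedCompEquiv (w := fun t => |w t|) (w' := fun t => |v t|) hp hφ hψ
    hwm.abs hvm.abs (fun t => abs_ne_zero.2 (hw0 t)) (fun t => abs_ne_zero.2 (hv0 t))
    (by rw [weightMeasure_abs, weightMeasure_abs, hmap])
    (by rw [weightMeasure_abs, weightMeasure_abs, hmap']) hψφ
  refine ⟨g, T, fun f₁ f₂ => ?_, fun f => ?_, fun hpos => ?_, fun j => ?_⟩
  · refine Lp.ext ?_
    filter_upwards [hT (f₁ ⊔ f₂), Lp.coeFn_sup (T f₁) (T f₂), hT f₁, hT f₂,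
      hq.ae (Lp.coeFn_sup f₁ f₂)] with t h1 h2 h3 h4 h5
    rw [h1, h2, Pi.sup_apply, h3, h4, h5, Pi.sup_apply]
    have hr : 0 ≤ |v t| / |w (φ t)| := by positivity
    have e : ∀ s : ℝ, |v t| * (s / |w (φ t)|) = |v t| / |w (φ t)| * s := fun s => by ring
    rw [e, e, e]
    exact mul_max_of_nonneg _ _ hr
  · refine Lp.ext ?_
    filter_upwards [Lp.coeFn_abs (g f), hg f, hT |f|, hq.ae (Lp.coeFn_abs f)] with t h1 h2 h3 h4
    rw [h1, h2, h3, h4, abs_mul, abs_div]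
  · refine LinearIsometryEquiv.ext fun f => Lp.ext ?_
    filter_upwards [hg f, hT f, hq.ae (hwpos fun j => (hpos j).1), hwpos' fun j => (hpos j).2]
      with t h1 h2 h3 h4
    rw [h1, h2, abs_of_pos h3, abs_of_pos (mul_pos (hc _) h4)]
  · have hgX : g (X j) = c j • Y j := by
      refine Lp.ext ?_
      filter_upwards [hg (X j), hq.ae (hw.indicator (hms j)).coeFn_toLp, Lp.coeFn_smul (c j) (Y j),
        (hw'.indicator (hms' j)).coeFn_toLp, hκφ] with t h1 h2 h3 h4 h5
      rw [h1, h2, h3, Pi.smul_apply, h4, smul_eq_mul]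
      by_cases ht : κ' t = j
      · have ht' : t ∈ κ' ⁻¹' {j} := ht
        have ht2 : φ t ∈ κ ⁻¹' {j} := h5.trans ht
        rw [Set.indicator_of_mem ht', Set.indicator_of_mem ht2, div_self (hw0 _), mul_one]
        simp only [v, ht]
      · have ht' : t ∉ κ' ⁻¹' {j} := ht
        have ht2 : φ t ∉ κ ⁻¹' {j} := fun h => ht (h5.symm.trans h)
        rw [Set.indicator_of_notMem ht', Set.indicator_of_notMem ht2, zero_div, mul_zero, mul_zero]
    have e : g (x j) - y j = g (x j - X j) + ((c j - 1) • Y j + (Y j - y j)) := by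
      rw [map_sub, hgX, sub_smul, one_smul]; abel
    have h2 : ‖(c j - 1) • Y j‖ = |‖X j‖ - ‖Y j‖| := by
      rw [norm_smul, Real.norm_eq_abs]
      calc _ = |(c j - 1) * ‖Y j‖| := by rw [abs_mul, abs_norm]
        _ = _ := by rw [sub_mul, one_mul, div_mul_cancel₀ _ (hYpos j).ne']
    have h3 : |‖X j‖ - ‖Y j‖| ≤ ‖X j - x j‖ + ‖Y j - y j‖ + |‖x j‖ - ‖y j‖| := by
      have h4 := abs_norm_sub_norm_le (X j) (x j)
      have h5 := abs_norm_sub_norm_le (Y j) (y j)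
      have h6 := le_abs_self (‖x j‖ - ‖y j‖)
      have h7 := neg_abs_le (‖x j‖ - ‖y j‖)
      rw [abs_le] at h4 h5
      rw [abs_le]
      constructor <;> linarith
    rw [e]
    refine (norm_add_le _ _).trans ?_
    rw [g.norm_map, norm_sub_rev]
    have h4 := norm_add_le ((c j - 1) • Y j) (Y j - y j)
    rw [h2] at h4
    linarith [hwx j, hwy j]

end LpIsometries

/-! ### Operators and order on ultraproducts. -/

namespace BanachUltraproduct

section Basic

variable {ι : Type u} {E : ι → Type v} [∀ i, NormedAddCommGroup (E i)] [∀ i, NormedSpace ℝ (E i)]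
  {U : Ultrafilter ι}

/-- Coordinatewise application of isometries to bounded families. -/
def lpMap (g : ∀ i, E i ≃ₗᵢ[ℝ] E i) : lp E ∞ →ₗ[ℝ] lp E ∞ where
  toFun x := ⟨fun i => g i (x i), memℓp_infty ⟨‖x‖, by
    rintro _ ⟨i, rfl⟩
    simpa using lp.norm_apply_le_norm (by simp) x i⟩⟩
  map_add' x y := lp.ext (funext fun i => (g i).map_add (x i) (y i))
  map_smul' c x := lp.ext (funext fun i => (g i).map_smul c (x i))

theorem lpMap_apply (g : ∀ i, E i ≃ₗᵢ[ℝ] E i) (x : lp E ∞) (i : ι) : lpMap g x i = g i (x i) := rfl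

/-- The operator induced on the ultraproduct by a family of isometries. -/
noncomputable def mapLinear (U : Ultrafilter ι) (g : ∀ i, E i ≃ₗᵢ[ℝ] E i) :
    BanachUltraproduct E U →ₗ[ℝ] BanachUltraproduct E U :=
  (ultraNull E U).mapQ (ultraNull E U) (lpMap g) fun x hx => by
    have hx : Tendsto (fun i => ‖x i‖) U (𝓝 0) := hx
    change Tendsto (fun i => ‖lpMap g x i‖) U (𝓝 0)
    simpa only [lpMap_apply, LinearIsometryEquiv.norm_map] using hx

/-- The surjective isometry of the ultraproduct induced by a family of surjective isometries. -/
noncomputable def mapEquiv (U : Ultrafilter ι) (g : ∀ i, E i ≃ₗᵢ[ℝ] E i) :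
    BanachUltraproduct E U ≃ₗᵢ[ℝ] BanachUltraproduct E U where
  toLinearEquiv := LinearEquiv.ofLinearMap (mapLinear U g) (mapLinear U fun i => (g i).symm)
    (LinearMap.ext fun a => by
      obtain ⟨x, rfl⟩ := mk_surjective a
      exact congrArg (mk E U) (lp.ext (funext fun i => (g i).apply_symm_apply (x i))))
    (LinearMap.ext fun a => by
      obtain ⟨x, rfl⟩ := mk_surjective a
      exact congrArg (mk E U) (lp.ext (funext fun i => (g i).symm_apply_apply (x i))))
  norm_map' a := by
    obtain ⟨x, rfl⟩ := mk_surjective a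
    change ‖mk E U (lpMap g x)‖ = ‖mk E U x‖
    refine tendsto_nhds_unique (norm_mk (lpMap g x)) ?_
    simpa only [lpMap_apply, LinearIsometryEquiv.norm_map] using norm_mk (U := U) x

theorem mapEquiv_mk (g : ∀ i, E i ≃ₗᵢ[ℝ] E i) (x : lp E ∞) :
    mapEquiv U g (mk E U x) = mk E U (lpMap g x) := rfl

end Basic

section Order

variable {ι : Type u} {E : ι → Type v} [∀ i, NormedAddCommGroup (E i)] [∀ i, NormedSpace ℝ (E i)]
  {U : Ultrafilter ι} [∀ i, Lattice (E i)] [∀ i, HasSolidNorm (E i)]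
  [∀ i, IsOrderedAddMonoid (E i)]

theorem abs_mk (x : lp E ∞) : |mk E U x| = mk E U (lpSup x (-x)) := by
  change mk E U x ⊔ -mk E U x = _
  rw [← map_neg]
  exact mk_sup x (-x)

theorem lpSup_neg_apply (x : lp E ∞) (i : ι) : lpSup x (-x) i = |x i| := rfl

/-- A positive class equals its modulus, which lifts to the coordinatewise modulus. -/
theorem exists_lift (a : BanachUltraproduct E U) :
    ∃ x, mk E U x = a ∧ (0 ≤ a → ∀ i, 0 ≤ x i) := by
  obtain ⟨x, rfl⟩ := mk_surjective a
  by_cases h : 0 ≤ mk E U x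
  · refine ⟨lpSup x (-x), ?_, fun _ i => ?_⟩
    · rw [← abs_mk, abs_of_nonneg h]
    · rw [lpSup_neg_apply]; exact abs_nonneg _
  · exact ⟨x, rfl, fun h' => absurd h' h⟩

instance instIsOrderedModule [∀ i, IsOrderedModule ℝ (E i)] :
    IsOrderedModule ℝ (BanachUltraproduct E U) := by
  have key : ∀ (r : ℝ) (a : BanachUltraproduct E U), 0 ≤ r → 0 ≤ a → 0 ≤ r • a := by
    intro r a hr ha
    obtain ⟨x, rfl, hx⟩ := exists_lift a
    have hx := hx ha
    have h : r • mk E U x = |r • mk E U x| := by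
      rw [← map_smul, abs_mk]
      refine congrArg (mk E U) (lp.ext (funext fun i => ?_))
      rw [lpSup_neg_apply, abs_of_nonneg]
      exact smul_nonneg hr (hx i)
    rw [h]; exact abs_nonneg _
  exact
    { smul_le_smul_of_nonneg_left := fun r hr a b hab => by
        rw [← sub_nonneg, ← smul_sub]; exact key _ _ hr (sub_nonneg.2 hab)
      smul_le_smul_of_nonneg_right := fun a ha r s hrs => by
        rw [← sub_nonneg, ← sub_smul]; exact key _ _ (sub_nonneg.2 hrs) ha }

theorem mapEquiv_mem_isoLat {g : ∀ i, E i ≃ₗᵢ[ℝ] E i} (hg : ∀ i, g i ∈ IsoLat (E i)) :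
    mapEquiv U g ∈ IsoLat (BanachUltraproduct E U) := fun a b => by
  obtain ⟨x, rfl⟩ := mk_surjective a
  obtain ⟨y, rfl⟩ := mk_surjective b
  rw [mk_sup, mapEquiv_mk, mapEquiv_mk, mapEquiv_mk, mk_sup]
  exact congrArg (mk E U) (lp.ext (funext fun i => hg i (x i) (y i)))

theorem abs_mapEquiv {g T : ∀ i, E i ≃ₗᵢ[ℝ] E i} (h : ∀ i x, |g i x| = T i |x|)
    (a : BanachUltraproduct E U) : |mapEquiv U g a| = mapEquiv U T |a| := by
  obtain ⟨x, rfl⟩ := mk_surjective a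
  rw [mapEquiv_mk, abs_mk, abs_mk, mapEquiv_mk]
  exact congrArg (mk E U) (lp.ext (funext fun i => h i (x i)))

theorem tendsto_norm_abs_inf_abs (x y : lp E ∞) :
    Tendsto (fun i => ‖|x i| ⊓ |y i|‖) U (𝓝 ‖|mk E U x| ⊓ |mk E U y|‖) := by
  rw [abs_mk, abs_mk, mk_inf]
  exact norm_mk (lpInf (lpSup x (-x)) (lpSup y (-y)))

theorem isAMNorm_of_tendsto (C : ι → ℝ) (hC : Tendsto C U (𝓝 1))
    (h : ∀ i, ∀ a b : E i, ‖a ⊔ b‖ ≤ C i * max ‖a‖ ‖b‖) : IsAMNorm (BanachUltraproduct E U) := by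
  intro a b _ _
  obtain ⟨x, rfl⟩ := mk_surjective a
  obtain ⟨y, rfl⟩ := mk_surjective b
  rw [mk_sup]
  have h1 := hC.mul ((norm_mk (U := U) x).max (norm_mk (U := U) y))
  rw [one_mul] at h1
  exact le_of_tendsto_of_tendsto' (norm_mk (lpSup x y)) h1 fun i => h i (x i) (y i)

end Order

end BanachUltraproduct

/-! ### The ultraproduct of the spaces L_p(0,1). -/

section LpUltraproduct

instance Lp.instIsOrderedModule {α : Type*} {mα : MeasurableSpace α} {μ : Measure α} {p : ℝ≥0∞} :
    IsOrderedModule ℝ (Lp ℝ p μ) := by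
  have key : ∀ (r : ℝ) (f : Lp ℝ p μ), 0 ≤ r → 0 ≤ f → 0 ≤ r • f := fun r f hr hf => by
    rw [← Lp.coeFn_nonneg] at hf ⊢
    filter_upwards [hf, Lp.coeFn_smul r f] with t h1 h2
    rw [h2]
    exact smul_nonneg hr h1
  exact
    { smul_le_smul_of_nonneg_left := fun r hr a b hab => by
        rw [← sub_nonneg, ← smul_sub]; exact key _ _ hr (sub_nonneg.2 hab)
      smul_le_smul_of_nonneg_right := fun a ha r s hrs => by
        rw [← sub_nonneg, ← sub_smul]; exact key _ _ (sub_nonneg.2 hrs) ha }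

/-- Pointwise |f ⊔ g|^p ≤ |f|^p + |g|^p; integrate and take p-th roots. -/
theorem Lp_norm_sup_le {α : Type*} {mα : MeasurableSpace α} {μ : Measure α} {p : ℝ≥0∞}
    [Fact (1 ≤ p)] (hp : p ≠ ∞) (f g : Lp ℝ p μ) :
    ‖f ⊔ g‖ ≤ 2 ^ (p⁻¹).toReal * max ‖f‖ ‖g‖ := by
  have hp0 : p ≠ 0 := (zero_lt_one.trans_le (Fact.out : 1 ≤ p)).ne'
  have hq : 0 < p.toReal := ENNReal.toReal_pos hp0 hp
  have hpow : ∀ f : Lp ℝ p μ, eLpNorm f p μ ^ p.toReal = ∫⁻ t, ‖f t‖ₑ ^ p.toReal ∂μ := fun f => by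
    rw [eLpNorm_eq_lintegral_rpow_enorm_toReal hp0 hp, ← ENNReal.rpow_mul, one_div,
      inv_mul_cancel₀ hq.ne', ENNReal.rpow_one]
  set M := max (eLpNorm f p μ) (eLpNorm g p μ) with hM
  have hMtop : M ≠ ∞ := by
    rw [hM, ne_eq, max_eq_top]
    exact fun h => h.elim (Lp.eLpNorm_ne_top f) (Lp.eLpNorm_ne_top g)
  have h1 : eLpNorm (f ⊔ g : Lp ℝ p μ) p μ ^ p.toReal ≤ 2 * M ^ p.toReal := by
    rw [hpow, two_mul]
    calc ∫⁻ t, ‖(f ⊔ g : Lp ℝ p μ) t‖ₑ ^ p.toReal ∂μ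
        ≤ ∫⁻ t, (‖f t‖ₑ ^ p.toReal + ‖g t‖ₑ ^ p.toReal) ∂μ := by
          refine lintegral_mono_ae ?_
          filter_upwards [Lp.coeFn_sup f g] with t ht
          rw [ht, Pi.sup_apply]
          rcases le_total (f t) (g t) with h | h
          · rw [sup_eq_right.2 h]; exact le_add_self
          · rw [sup_eq_left.2 h]; exact le_self_add
      _ = eLpNorm f p μ ^ p.toReal + eLpNorm g p μ ^ p.toReal := by
          rw [lintegral_add_left' ((Lp.aestronglyMeasurable f).enorm.pow_const _), hpow, hpow]
      _ ≤ _ := add_le_add (ENNReal.rpow_le_rpow (le_max_left _ _) hq.le)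
          (ENNReal.rpow_le_rpow (le_max_right _ _) hq.le)
  have h2 : eLpNorm (f ⊔ g : Lp ℝ p μ) p μ ≤ 2 ^ (p⁻¹).toReal * M := by
    have h3 := ENNReal.rpow_le_rpow h1 (inv_nonneg.2 hq.le)
    rwa [ENNReal.mul_rpow_of_nonneg _ _ (inv_nonneg.2 hq.le), ← ENNReal.rpow_mul,
      ← ENNReal.rpow_mul, mul_inv_cancel₀ hq.ne', ENNReal.rpow_one, ENNReal.rpow_one,
      ← ENNReal.toReal_inv] at h3
  rw [Lp.norm_def, Lp.norm_def, Lp.norm_def]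
  have h4 := ENNReal.toReal_mono (ENNReal.mul_ne_top (by simp) hMtop) h2
  rwa [ENNReal.toReal_mul, ← ENNReal.toReal_rpow, hM,
    ENNReal.toReal_max (Lp.eLpNorm_ne_top f) (Lp.eLpNorm_ne_top g)] at h4

instance isProbabilityMeasure_unitInterval :
    IsProbabilityMeasure (volume.restrict (Set.Ioo (0 : ℝ) 1)) :=
  ⟨by simp⟩

variable {p : ℕ → ℝ≥0∞} [∀ n, Fact (1 ≤ p n)] {U : Ultrafilter ℕ}

theorem isAMNorm_ultraproduct (hp : ∀ n, p n ≠ ∞) (hp_lim : Tendsto p U (𝓝 ∞)) :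
    IsAMNorm (BanachUltraproduct (fun n => LpUnit (p n)) U) := by
  refine BanachUltraproduct.isAMNorm_of_tendsto (fun n => 2 ^ ((p n)⁻¹).toReal) ?_
    fun n a b => Lp_norm_sup_le (hp n) a b
  have h1 : Tendsto (fun n => (p n)⁻¹) U (𝓝 0) := by
    simpa using tendsto_inv_iff.2 hp_lim
  have h2 : Tendsto (fun n => ((p n)⁻¹).toReal) U (𝓝 0) :=
    (ENNReal.tendsto_toReal ENNReal.zero_ne_top).comp h1
  have h3 := ((Real.continuous_const_rpow (two_ne_zero (α := ℝ))).tendsto 0).comp h2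
  rwa [Real.rpow_zero] at h3

/-- The overlaps of the lifts tend to 0 along U, so `Lp_exists_isometry` applies to U-almost every
coordinate, with errors bounded by a quantity tending to 4e < ε. -/
theorem isApproxHomogeneous_ultraproduct (hp : ∀ n, p n ≠ ∞) :
    IsApproxHomogeneous (BanachUltraproduct (fun n => LpUnit (p n)) U) := by
  intro k b c hb hc hbc hb0 ε hε
  rcases Nat.eq_zero_or_pos k with rfl | hk
  · exact ⟨_, isoLat_subset_isoDisj refl_mem_isoLat, fun _ => refl_mem_isoLat, fun j => j.elim0⟩
  have : NeZero k := ⟨hk.ne'⟩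
  choose x hx hxpos using fun j => BanachUltraproduct.exists_lift (b j)
  choose y hy hypos using fun j => BanachUltraproduct.exists_lift (c j)
  obtain ⟨e, ⟨heb, heε⟩, he⟩ : ∃ e : ℝ, ((∀ j, e < ‖b j‖) ∧ e < ε / 4) ∧ 0 < e := by
    have hev : ∀ᶠ r in 𝓝[>] (0 : ℝ), (∀ j, r < ‖b j‖) ∧ r < ε / 4 := by
      refine Filter.Eventually.filter_mono nhdsWithin_le_nhds (Filter.Eventually.and ?_ ?_)
      · exact Filter.eventually_all.2 fun j => eventually_lt_nhds (norm_pos_iff.2 (hb0 j))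
      · exact eventually_lt_nhds (by linarith)
    exact (hev.and self_mem_nhdsWithin).exists
  have hov : ∀ (z : Fin k → lp (fun n => LpUnit (p n)) ∞),
      (∀ i j, i ≠ j → LatDisjoint (BanachUltraproduct.mk (fun n => LpUnit (p n)) U (z i))
        (BanachUltraproduct.mk (fun n => LpUnit (p n)) U (z j))) →
      ∀ j, Tendsto (fun n => overlap (fun i => z i n) j) U (𝓝 0) := by
    intro z hz j
    have h1 : Tendsto (fun n => overlap (fun i => z i n) j) U
        (𝓝 (∑ i ∈ Finset.univ.erase j, (0 : ℝ))) := by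
      refine tendsto_finsetSum _ fun i hi => ?_
      have h2 := BanachUltraproduct.tendsto_norm_abs_inf_abs (U := U) (z i) (z j)
      have h3 : |BanachUltraproduct.mk (fun n => LpUnit (p n)) U (z i)| ⊓
          |BanachUltraproduct.mk (fun n => LpUnit (p n)) U (z j)| = 0 :=
        hz i j (Finset.ne_of_mem_erase hi)
      rwa [h3, norm_zero] at h2
    simpa using h1
  have hxov := hov x fun i j hij => by rw [hx, hx]; exact hb i j hij
  have hyov := hov y fun i j hij => by rw [hy, hy]; exact hc i j hij
  have hxn : ∀ j, Tendsto (fun n => ‖x j n‖) U (𝓝 ‖b j‖) := fun j => by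
    rw [← hx j]; exact BanachUltraproduct.norm_mk (x j)
  have hyn : ∀ j, Tendsto (fun n => ‖y j n‖) U (𝓝 ‖c j‖) := fun j => by
    rw [← hy j]; exact BanachUltraproduct.norm_mk (y j)
  -- The identity serves on the U-negligible set of coordinates where the tuples are not yet
  -- disjoint enough.
  have hiso : ∀ n, ∃ g T : LpUnit (p n) ≃ₗᵢ[ℝ] LpUnit (p n), T ∈ IsoLat (LpUnit (p n)) ∧
      (∀ f, |g f| = T |f|) ∧ ((∀ j, 0 ≤ x j n ∧ 0 ≤ y j n) → g = T) ∧
      ((∀ j, e + overlap (fun i => x i n) j < ‖x j n‖) →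
        (∀ j, e + overlap (fun i => y i n) j < ‖y j n‖) → ∀ j, ‖g (x j n) - y j n‖ ≤
        2 * ((e + overlap (fun i => x i n) j) + (e + overlap (fun i => y i n) j)) +
          |‖x j n‖ - ‖y j n‖|) := by
    intro n
    by_cases h : (∀ j, e + overlap (fun i => x i n) j < ‖x j n‖) ∧
        ∀ j, e + overlap (fun i => y i n) j < ‖y j n‖
    · obtain ⟨g, T, hT, hgT, hpos, hg⟩ := Lp_exists_isometry (hp n) (fun i => x i n)
        (fun i => y i n) he h.1 h.2
      exact ⟨g, T, hT, hgT, hpos, fun _ _ => hg⟩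
    · exact ⟨LinearIsometryEquiv.refl ℝ _, LinearIsometryEquiv.refl ℝ _, refl_mem_isoLat,
        fun f => rfl, fun _ => rfl, fun h1 h2 => absurd ⟨h1, h2⟩ h⟩
  choose g T hT hgT hpos hg using hiso
  refine ⟨BanachUltraproduct.mapEquiv U g, mem_isoDisj_of_abs
    (BanachUltraproduct.mapEquiv_mem_isoLat hT) (BanachUltraproduct.abs_mapEquiv hgT),
    fun h => ?_, fun j => ?_⟩
  · have : g = T := funext fun n =>
      hpos n fun j => ⟨hxpos j (h j).1 n, hypos j (h j).2 n⟩
    rw [this]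
    exact BanachUltraproduct.mapEquiv_mem_isoLat hT
  · have h1 : Tendsto (fun n => ‖g n (x j n) - y j n‖) U
        (𝓝 ‖BanachUltraproduct.mapEquiv U g (b j) - c j‖) := by
      rw [← hx j, ← hy j, BanachUltraproduct.mapEquiv_mk, ← map_sub]
      exact BanachUltraproduct.norm_mk (BanachUltraproduct.lpMap g (x j) - y j)
    have h2 : Tendsto (fun n => 2 * ((e + overlap (fun i => x i n) j) +
        (e + overlap (fun i => y i n) j)) + |‖x j n‖ - ‖y j n‖|) U (𝓝 (4 * e)) := by
      have h3 := ((((hxov j).const_add e).add ((hyov j).const_add e)).const_mul 2).add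
        (((hxn j).sub (hyn j)).abs)
      rw [hbc j, sub_self, abs_zero] at h3
      convert h3 using 2
      ring
    have h4 : ∀ᶠ n in (U : Filter ℕ), (∀ j, e + overlap (fun i => x i n) j < ‖x j n‖) ∧
        ∀ j, e + overlap (fun i => y i n) j < ‖y j n‖ := by
      refine Filter.Eventually.and (Filter.eventually_all.2 fun j => ?_)
        (Filter.eventually_all.2 fun j => ?_)
      · exact ((hxov j).const_add e).eventually_lt (hxn j) (by simpa using heb j)
      · exact ((hyov j).const_add e).eventually_lt (hyn j) (by simpa [← hbc j] using heb j)
    have h5 : ‖BanachUltraproduct.mapEquiv U g (b j) - c j‖ ≤ 4 * e :=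
      le_of_tendsto_of_tendsto h1 h2 (by
        filter_upwards [h4] with n hn
        exact hg n hn.1 hn.2 j)
    linarith

/-- The indicators of the two halves of the interval have norm 2^(-1/p) ≥ 1/2 for every p ≥ 1, so
they do not vanish in the ultraproduct. -/
theorem exists_disjoint_ultraproduct (hp : ∀ n, p n ≠ ∞) :
    ∃ e f : BanachUltraproduct (fun n => LpUnit (p n)) U, e ≠ 0 ∧ f ≠ 0 ∧ LatDisjoint e f := by
  have hA : MeasurableSet (Set.Ioo (0 : ℝ) (1 / 2)) := measurableSet_Ioo
  have hB : MeasurableSet (Set.Ioo (1 / 2 : ℝ) 1) := measurableSet_Ioo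
  set μ := volume.restrict (Set.Ioo (0 : ℝ) 1) with hμ
  have hμA : μ.real (Set.Ioo (0 : ℝ) (1 / 2)) = 1 / 2 := by
    rw [hμ, measureReal_restrict_apply hA, Set.inter_eq_left.2
      (Set.Ioo_subset_Ioo_right (by norm_num)), Measure.real, Real.volume_Ioo]
    norm_num
  have hμB : μ.real (Set.Ioo (1 / 2 : ℝ) 1) = 1 / 2 := by
    rw [hμ, measureReal_restrict_apply hB, Set.inter_eq_left.2
      (Set.Ioo_subset_Ioo_left (by norm_num)), Measure.real, Real.volume_Ioo]
    norm_num
  have hnorm : ∀ n, ∀ s (hs : MeasurableSet s), μ.real s = 1 / 2 →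
      1 / 2 ≤ ‖indicatorConstLp (p n) hs (measure_ne_top μ s) (1 : ℝ)‖ ∧
      ‖indicatorConstLp (p n) hs (measure_ne_top μ s) (1 : ℝ)‖ ≤ 1 := by
    intro n s hs hμs
    have h1 : 1 ≤ p n := Fact.out
    have hp0 : p n ≠ 0 := (zero_lt_one.trans_le h1).ne'
    have hq : 1 ≤ (p n).toReal := by
      rw [← ENNReal.toReal_one]; exact ENNReal.toReal_mono (hp n) h1
    rw [norm_indicatorConstLp hp0 (hp n), hμs, norm_one, one_mul]
    constructor
    · conv_lhs => rw [← Real.rpow_one (1 / 2)]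
      exact Real.rpow_le_rpow_of_exponent_ge (by norm_num) (by norm_num)
        (by rw [div_le_one (by linarith)]; exact hq)
    · exact Real.rpow_le_one (by norm_num) (by norm_num) (by positivity)
  have hvec : ∀ s (hs : MeasurableSet s), μ.real s = 1 / 2 →
      ∃ x : lp (fun n => LpUnit (p n)) ∞,
        (∀ n, x n = indicatorConstLp (p n) hs (measure_ne_top μ s) (1 : ℝ)) ∧
        BanachUltraproduct.mk (fun n => LpUnit (p n)) U x ≠ 0 := by
    intro s hs hμs
    let x : lp (fun n => LpUnit (p n)) ∞ :=
      ⟨fun n => indicatorConstLp (p n) hs (measure_ne_top μ s) (1 : ℝ), memℓp_infty ⟨1, by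
        rintro _ ⟨n, rfl⟩
        exact (hnorm n s hs hμs).2⟩⟩
    refine ⟨x, fun n => rfl, fun h0 => ?_⟩
    have h1 := ge_of_tendsto' (BanachUltraproduct.norm_mk (U := U) x)
      fun n => (hnorm n s hs hμs).1
    rw [h0, norm_zero] at h1
    norm_num at h1
  obtain ⟨x, hx, hx0⟩ := hvec _ hA hμA
  obtain ⟨y, hy, hy0⟩ := hvec _ hB hμB
  refine ⟨_, _, hx0, hy0, ?_⟩
  have h1 := BanachUltraproduct.tendsto_norm_abs_inf_abs (U := U) x y
  have h2 : ∀ n, |x n| ⊓ |y n| = 0 := fun n => by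
    rw [hx, hy]
    refine Lp.ext ?_
    filter_upwards [Lp.coeFn_inf |indicatorConstLp (p n) hA (measure_ne_top μ _) (1 : ℝ)|
        |indicatorConstLp (p n) hB (measure_ne_top μ _) (1 : ℝ)|,
      Lp.coeFn_abs (indicatorConstLp (p n) hA (measure_ne_top μ _) (1 : ℝ)),
      Lp.coeFn_abs (indicatorConstLp (p n) hB (measure_ne_top μ _) (1 : ℝ)),
      indicatorConstLp_coeFn (p := p n) (hs := hA) (hμs := measure_ne_top μ _) (c := (1 : ℝ)),
      indicatorConstLp_coeFn (p := p n) (hs := hB) (hμs := measure_ne_top μ _) (c := (1 : ℝ)),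
      Lp.coeFn_zero ℝ (p n) μ] with t h1 h2 h3 h4 h5 h6
    rw [h1, Pi.inf_apply, h2, h3, h4, h5, h6, Pi.zero_apply]
    by_cases ht : t < 1 / 2
    · rw [Set.indicator_of_notMem (s := Set.Ioo (1 / 2 : ℝ) 1) (fun h => absurd h.1 (not_lt.2 ht.le)),
        abs_zero]
      exact inf_eq_right.2 (abs_nonneg _)
    · rw [Set.indicator_of_notMem (s := Set.Ioo (0 : ℝ) (1 / 2)) (fun h => absurd h.2 ht), abs_zero]
      exact inf_eq_left.2 (abs_nonneg _)
  simp only [h2, norm_zero] at h1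
  exact norm_eq_zero.1 (tendsto_nhds_unique h1 tendsto_const_nhds)

end LpUltraproduct

/-! ### The theorem. -/

theorem proposition6p6 (p : ℕ → ℝ≥0∞) [∀ n, Fact (1 ≤ p n)] (hp : ∀ n, p n ≠ ∞)
    (hp_lim : Tendsto p atTop (𝓝 ∞)) (U : Ultrafilter ℕ) (hU : (U : Filter ℕ) ≤ cofinite) :
    let 𝔛 := BanachUltraproduct (fun n => LpUnit (p n)) U
    IsMSpace 𝔛 ∧
    (∃ ϖ : ℕ → ℝ≥0 → ℝ≥0, (∀ k δ, ϖ k δ ≤ 3 * k * δ) ∧ IsFraisseBanachLattice 𝔛 ϖ) ∧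
    (∀ X : VectorSublattice 𝔛, FiniteDimensional ℝ X → ∀ (δ : ℝ≥0) (ε : ℝ), 0 < ε →
      ActsTransitively (IsoDisj 𝔛) (EmbDisj δ X 𝔛) (3 * Module.finrank ℝ X * δ + ε)) ∧
    ∃ G : VectorSublattice 𝔛,
      IsClosed (G.toSubmodule : Set 𝔛) ∧ TopologicalSpace.SeparableSpace G ∧
      ¬ FiniteDimensional ℝ G ∧ IsMSpace G ∧
      (∃ ϖ : ℕ → ℝ≥0 → ℝ≥0, (∀ k δ, ϖ k δ ≤ 3 * k * δ) ∧ IsFraisseBanachLattice G ϖ) ∧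
      ∀ X : VectorSublattice G, FiniteDimensional ℝ X → ∀ (δ : ℝ≥0) (ε : ℝ), 0 < ε →
        ActsTransitively (IsoDisj G) (EmbDisj δ X G) (3 * Module.finrank ℝ X * δ + ε) := by
  intro 𝔛
  have hlim : Tendsto p U (𝓝 ∞) := hp_lim.mono_left (Nat.cofinite_eq_atTop ▸ hU)
  have hE : IsAMNorm 𝔛 := isAMNorm_ultraproduct hp hlim
  have hH : IsApproxHomogeneous 𝔛 := isApproxHomogeneous_ultraproduct hp
  obtain ⟨e, f, he, hf, hef⟩ := exists_disjoint_ultraproduct (U := U) hp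
  -- Starting from e and f puts two nonzero disjoint vectors in G, which both infinite dimension and
  -- the case of large δ require.
  obtain ⟨G, hGc, hGs, hGS, hGH⟩ := hH.exists_separable (S := {e, f})
    ((Set.countable_singleton f).insert e) ⟨e, Or.inl rfl⟩
  have hGE : IsAMNorm G := hE.vectorSublattice G
  have hGef : ∃ e f : G, e ≠ 0 ∧ f ≠ 0 ∧ LatDisjoint e f :=
    ⟨⟨e, hGS (Or.inl rfl)⟩, ⟨f, hGS (Or.inr rfl)⟩, fun h => he (congrArg Subtype.val h),
      fun h => hf (congrArg Subtype.val h), VectorSublattice.latDisjoint_coe.1 hef⟩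
  exact ⟨hE.isMSpace,
    ⟨_, fun _ _ => le_rfl, isFraisseBanachLattice_of_homogeneous hE hH ⟨e, f, he, hf, hef⟩⟩,
    fun X _ δ ε hε => actsTransitively_isoDisj hE hH ⟨e, f, he, hf, hef⟩ δ ε hε,
    G, hGc, hGs, hGH.not_finiteDimensional hGef, hGE.isMSpace,
    ⟨_, fun _ _ => le_rfl, isFraisseBanachLattice_of_homogeneous hGE hGH hGef⟩,
    fun X _ δ ε hε => actsTransitively_isoDisj hGE hGH hGef δ ε hε⟩
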